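/- **Setting.** Identifiers, labels and keys are finite binary words; property values form a set $\mathcal V$ with a partial order $\le$, every value is named by a binary word (different values have different names), and, given the names of two values $a,b$, it can be decided in (nondeterministic) exponential time whether $a\le b$. A *property graph* $G=(N,E,\rho,\lambda,\pi)$ consists of finite disjoint sets $N$ (nodes) and $E$ (edges) of identifiers, $\rho:E\to N\times N$ (source and target), $\lambda$ assigning a finite set of labels to every $o\in N\cup E$, and a partial function $\pi$ with finite domain from pairs of an element of $N\cup E$ and a key to $\mathcal V$. A *path* is a sequence $v_0e_1v_1\dots e_nv_n$ ($n\ge 0$) with $v_i\in N$, $e_i\in E$ and $\rho(e_i)=(v_{i-1},v_i)$. *Path patterns* are built from node patterns $(x:\varphi)$ and edge patterns $\xrightarrow{\varphi}$ (node variable $x$ and label expression $\varphi$ optional; $\varphi$ is a propositional formula over labels with $\wedge,\vee,\neg$) by concatenation, union and Kleene star; operands of union and star contain no node variables, and an operand of star does not match paths of length $0$. A *graph pattern* $q$ is a finite conjunction $z_1=P_1,\dots,z_m=P_m$ of path patterns with distinct path variables. A *match* of $q$ in $G$ maps node variables to nodes and each $z_i$ to a path of $G$ matching $P_i$, where $(x:\varphi)$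 matches the paths of length $0$ at the node assigned to $x$ if its label set satisfies $\varphi$, $\xrightarrow{\varphi}$ matches the paths $v_0e_1v_1$ such that the label set of $e_1$ satisfies $\varphi$, and concatenation, union and star have their usual meaning (zero repetitions: any path of length $0$). An *RGPC constraint* is $q;F\Rightarrow C$ with a graph pattern $q$ and finite sets $F,C$ of predicates of the forms $x=y$, $x\ne y$, $x.A\oplus y.B$, $x.A\oplus c$, where $x,y$ are node variables of $q$, $A,B$ are keys, $c\in\mathcal V$ and $\oplus\in\{=,\ne,\le,\ge,<,>\}$; a predicate is satisfied only if all properties mentioned in it exist. $G$ *satisfies* the constraint if every match of $q$ in $G$ that satisfies all of $F$ satisfies all of $C$. The constraint is *positive* if no label expression in $q$ contains a negation. A property graph $G'=(N',E',\rho',\lambda',\pi')$ is a *subgraph* of $G$ if $N'\subseteq N$, $E'\subseteq E$, $\rho'(e)=\rho(e)$ for $e\in E'$, $\lambda'(o)\subseteq\lambda(o)$ for $o\in N'\cup E'$, and whenever $\pi'(o,k)$ is defined, $\pi(o,k)$ is defined and has the same value. It is an *object subgraph* if moreover $\pi'(o,k)=\pi(o,k)$ (both defined and equal, or both undefined) for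 all $o\in N'\cup E'$ and all keys $k$, i.e. if only nodes, edges and labels are deleted. For a set $\Sigma$ of constraints, a *repair* of $G$ is a subgraph $G'$ of $G$ that satisfies $\Sigma$ such that no subgraph $G''\ne G'$ of $G$ which has $G'$ as a subgraph satisfies $\Sigma$. A *repair by node, edge and label deletions* is defined in the same way with object subgraphs in place of subgraphs throughout. **Proposition.** Let $\Sigma$ be a fixed finite set of positive RGPC constraints. Given a property graph $G$, a repair of $G$ by node, edge and label deletions can be computed in nondeterministic exponential time in the size of (an encoding of) $G$, i.e. in data complexity: there are a nondeterministic program and a polynomial $p$ such that on every encoding of size $s$ of a property graph $G$ all computations halt within $2^{p(s)}$ steps, at least one computation accepts, and every accepting computation outputs an encoding of such a repair of $G$. The same holds for repairs of $G$ with respect to arbitrary subgraphs. -/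

import Mathlib

namespace PGRepair

/-! ## Nondeterministic computation with a step count

The machine model is the WHILE language over binary trees with nondeterministic choice. A program
has finitely many variables; a variable holds a tree. Every step (one assignment, one test, one
choice) takes one unit of time. Trees can be stored as shared pointer structures, so that each step
amounts to a bounded number of pointer operations (the bound depends on the program only); there is
no equality test on trees beyond the test for `nil`. Hence the model simulates, and is simulated by,
nondeterministic Turing machines with polynomial overhead, and nondeterministic exponential time is
the same notion for both. -/

/-- Binary trees. -/
inductive Data : Type
  | nil : Data
  | cons : Data → Data → Data

namespace Data

/-- The number of vertices of a tree, counting all copies of repeated subtrees. -/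
def size : Data → ℕ
  | nil => 1
  | cons a b => a.size + b.size + 1

/-- The left subtree. -/
def hd : Data → Data
  | nil => nil
  | cons a _ => a

/-- The right subtree. -/
def tl : Data → Data
  | nil => nil
  | cons _ b => b

/-- The encoding of truth values. -/
def ofBool : Bool → Data
  | false => nil
  | true => cons nil nil

/-- The encoding of lists, given an encoding of the entries. -/
def ofList {α : Type*} (enc : α → Data) : List α → Data
  | [] => nil
  | a :: l => cons (enc a) (ofList enc l)

end Data

/-- The contents of the variables `0, 1, 2, …`. -/
abbrev Store := ℕ → Data

/-- Expressions. -/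
inductive Expr : Type
  | var : ℕ → Expr
  | nil : Expr
  | cons : Expr → Expr → Expr
  | hd : Expr → Expr
  | tl : Expr → Expr

/-- The value of an expression. -/
def Expr.eval (s : Store) : Expr → Data
  | .var x => s x
  | .nil => Data.nil
  | .cons a b => Data.cons (a.eval s) (b.eval s)
  | .hd a => (a.eval s).hd
  | .tl a => (a.eval s).tl

/-- Programs. The trees other than `nil` count as true in tests. -/
inductive Prog : Type
  | assign : ℕ → Expr → Prog
  | seq : Prog → Prog → Prog
  | ite : Expr → Prog → Prog → Prog
  | loop : Expr → Prog → Prog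
  | choose : Prog → Prog → Prog

/-- A configuration: the programs that remain to be executed, in order, and the store. -/
abbrev Config := List Prog × Store

/-- One step of a computation. Only `choose` has more than one successor. -/
inductive Step : Config → Config → Prop
  | assign (x : ℕ) (e : Expr) (k : List Prog) (s : Store) :
      Step (.assign x e :: k, s) (k, Function.update s x (e.eval s))
  | seq (c d : Prog) (k : List Prog) (s : Store) : Step (.seq c d :: k, s) (c :: d :: k, s)
  | ite_true (e : Expr) (c d : Prog) (k : List Prog) (s : Store) (h : e.eval s ≠ Data.nil) :
      Step (.ite e c d :: k, s) (c :: k, s)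
  | ite_false (e : Expr) (c d : Prog) (k : List Prog) (s : Store) (h : e.eval s = Data.nil) :
      Step (.ite e c d :: k, s) (d :: k, s)
  | loop_true (e : Expr) (c : Prog) (k : List Prog) (s : Store) (h : e.eval s ≠ Data.nil) :
      Step (.loop e c :: k, s) (c :: .loop e c :: k, s)
  | loop_false (e : Expr) (c : Prog) (k : List Prog) (s : Store) (h : e.eval s = Data.nil) :
      Step (.loop e c :: k, s) (k, s)
  | choose_left (c d : Prog) (k : List Prog) (s : Store) : Step (.choose c d :: k, s) (c :: k, s)
  | choose_right (c d : Prog) (k : List Prog) (s : Store) : Step (.choose c d :: k, s) (d :: k, s)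

/-- `b` can be reached from `a` by exactly `n` steps. -/
def ReachesIn : ℕ → Config → Config → Prop
  | 0, a, b => a = b
  | n + 1, a, b => ∃ c, Step a c ∧ ReachesIn n c b

/-- The start configuration: the input is in variable `0`, all other variables hold `nil`. -/
def initConfig (c : Prog) (x : Data) : Config := ([c], fun i => if i = 0 then x else Data.nil)

/-- Some computation of `c` on `x` halts and accepts with output `y`: the output is the content of
variable `0`, and a halting computation accepts if variable `1` does not hold `nil`. -/
def AcceptsWith (c : Prog) (x y : Data) : Prop :=
  ∃ (n : ℕ) (s : Store), ReachesIn n (initConfig c x) ([], s) ∧ s 1 ≠ Data.nil ∧ s 0 = y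

/-- The search problem "given `a`, compute some `b` with `R a b`" is solvable in nondeterministic
exponential time, where `encIn a t` means that `t` is an encoding of the instance `a`, and
`encOut b y` that `y` is an encoding of the solution `b`: for some program and some polynomial `p`,
on every encoding `t` of an instance, all computations halt within `2 ^ p (size t)` steps
(a configuration without successor has halted), some computation accepts, and every accepting
computation outputs an encoding of a solution. -/
def SolvableInNExpTime {α β : Type*} (encIn : α → Data → Prop) (encOut : β → Data → Prop)
    (R : α → β → Prop) : Prop :=
  ∃ (c : Prog) (p : Polynomial ℕ), ∀ (a : α) (t : Data), encIn a t →
    (∀ (n : ℕ) (b : Config), ReachesIn n (initConfig c t) b → n ≤ 2 ^ p.eval t.size) ∧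
    (∃ y, AcceptsWith c t y) ∧
    ∀ y, AcceptsWith c t y → ∃ b, encOut b y ∧ R a b

/-! ## Property graphs -/

/-- Finite binary words. -/
abbrev Word := List Bool

/-- Identifiers of nodes and edges. -/
abbrev Ident := Word

/-- Labels. -/
abbrev Label := Word

/-- Keys of properties. -/
abbrev Key := Word

/-- A property graph with property values in `V`. Functions that are defined for some identifiers
only are given a default value elsewhere, so that equality of structures is equality of graphs. -/
@[ext]
structure PropertyGraph (V : Type*) where
  nodes : Finset Ident
  edges : Finset Ident
  disjoint : Disjoint nodes edges
  /-- source and target of the edges -/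
  ends : Ident → Option (Ident × Ident)
  labels : Ident → Finset Label
  prop : Ident → Key → Option V
  ends_isSome : ∀ e, (ends e).isSome ↔ e ∈ edges
  ends_mem : ∀ e u v, ends e = some (u, v) → u ∈ nodes ∧ v ∈ nodes
  labels_eq_empty : ∀ o, o ∉ nodes → o ∉ edges → labels o = ∅
  prop_eq_none : ∀ o k, o ∉ nodes → o ∉ edges → prop o k = none
  prop_finite : {x : Ident × Key | prop x.1 x.2 ≠ none}.Finite

/-- A path `v₀ e₁ v₁ … eₙ vₙ`: the node `v₀` and the list `(e₁, v₁), …, (eₙ, vₙ)`. -/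
structure Path where
  start : Ident
  steps : List (Ident × Ident)

namespace Path

/-- The last node of a path. -/
def target (p : Path) : Ident := (p.steps.map Prod.snd).getLastD p.start

/-- The concatenation of two paths, meaningful if the first ends where the second starts. -/
def append (p q : Path) : Path := ⟨p.start, p.steps ++ q.steps⟩

end Path

variable {V : Type*}

namespace PropertyGraph

/-- The steps are consecutive edges (with their targets) of `G`, the first one leaving `u`. -/
def IsWalkFrom (G : PropertyGraph V) : Ident → List (Ident × Ident) → Prop
  | _, [] => True
  | u, (e, v) :: l => G.ends e = some (u, v) ∧ G.IsWalkFrom v l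

/-- `p` is a path in `G`. -/
def IsPath (G : PropertyGraph V) (p : Path) : Prop :=
  p.start ∈ G.nodes ∧ G.IsWalkFrom p.start p.steps

/-- `H` is a subgraph of `G`: it arises by deleting nodes, edges, labels or properties. -/
structure IsSubgraph (H G : PropertyGraph V) : Prop where
  nodes : H.nodes ⊆ G.nodes
  edges : H.edges ⊆ G.edges
  ends : ∀ e ∈ H.edges, H.ends e = G.ends e
  labels : ∀ o, o ∈ H.nodes ∨ o ∈ H.edges → H.labels o ⊆ G.labels o
  prop : ∀ o, o ∈ H.nodes ∨ o ∈ H.edges → ∀ k v, H.prop o k = some v → G.prop o k = some v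

/-- `H` is a subgraph of `G` in which all remaining nodes and edges have the same properties as in
`G`: it arises by deleting nodes, edges or labels only. -/
structure IsObjectSubgraph (H G : PropertyGraph V) : Prop extends IsSubgraph H G where
  prop_eq : ∀ o, o ∈ H.nodes ∨ o ∈ H.edges → ∀ k, H.prop o k = G.prop o k

end PropertyGraph

/-! ## Patterns -/

/-- Label expressions. -/
inductive LabelExpr : Type
  | label : Label → LabelExpr
  | and : LabelExpr → LabelExpr → LabelExpr
  | or : LabelExpr → LabelExpr → LabelExpr
  | not : LabelExpr → LabelExpr

namespace LabelExpr

/-- A set of labels satisfies a label expression. -/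
def Sat (L : Finset Label) : LabelExpr → Prop
  | label l => l ∈ L
  | and φ ψ => φ.Sat L ∧ ψ.Sat L
  | or φ ψ => φ.Sat L ∨ ψ.Sat L
  | not φ => ¬ φ.Sat L

/-- The expression contains no negation. -/
def Positive : LabelExpr → Prop
  | label _ => True
  | and φ ψ => φ.Positive ∧ ψ.Positive
  | or φ ψ => φ.Positive ∧ ψ.Positive
  | not _ => False

end LabelExpr

/-- Path patterns. The variable and the label expression of a node pattern, and the label expression
of an edge pattern, are optional. Node variables are numbered. -/
inductive PathPattern : Type
  | node : Option ℕ → Option LabelExpr → PathPattern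
  | edge : Option LabelExpr → PathPattern
  | concat : PathPattern → PathPattern → PathPattern
  | union : PathPattern → PathPattern → PathPattern
  | star : PathPattern → PathPattern

/-- The paths `p₁ ⋯ pₘ` of `G`, `m ≥ 0`, where all `pᵢ` satisfy `M`; for `m = 0` these are the paths
of length `0`. -/
inductive IsIteration (G : PropertyGraph V) (M : Path → Prop) : Path → Prop
  | zero (v : Ident) (hv : v ∈ G.nodes) : IsIteration G M ⟨v, []⟩
  | succ (p q : Path) (hp : M p) (hq : IsIteration G M q) (h : p.target = q.start) :
      IsIteration G M (p.append q)

namespace PathPattern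

/-- The node variables of a path pattern. -/
def vars : PathPattern → Set ℕ
  | node x _ => {y | x = some y}
  | edge _ => ∅
  | concat P Q => P.vars ∪ Q.vars
  | union P Q => P.vars ∪ Q.vars
  | star P => P.vars

/-- The pattern may match paths of length `0`. -/
def AllowsEmpty : PathPattern → Prop
  | node _ _ => True
  | edge _ => False
  | concat P Q => P.AllowsEmpty ∧ Q.AllowsEmpty
  | union P Q => P.AllowsEmpty ∨ Q.AllowsEmpty
  | star _ => True

/-- Union and repetition apply to patterns without node variables only, and a pattern below a
repetition does not match paths of length `0`. -/
def WellFormed : PathPattern → Prop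
  | node _ _ => True
  | edge _ => True
  | concat P Q => P.WellFormed ∧ Q.WellFormed
  | union P Q => P.WellFormed ∧ Q.WellFormed ∧ P.vars = ∅ ∧ Q.vars = ∅
  | star P => P.WellFormed ∧ P.vars = ∅ ∧ ¬ P.AllowsEmpty

/-- No label expression in the pattern contains a negation. -/
def Positive : PathPattern → Prop
  | node _ φ => ∀ ψ, φ = some ψ → ψ.Positive
  | edge φ => ∀ ψ, φ = some ψ → ψ.Positive
  | concat P Q => P.Positive ∧ Q.Positive
  | union P Q => P.Positive ∧ Q.Positive
  | star P => P.Positive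

/-- The path `p` of `G` matches the pattern if the node variables are mapped to nodes by `μ`. -/
def Matches (G : PropertyGraph V) (μ : ℕ → Ident) : PathPattern → Path → Prop
  | node x φ, p => p.steps = [] ∧ p.start ∈ G.nodes ∧
      (∀ y, x = some y → μ y = p.start) ∧ (∀ ψ, φ = some ψ → ψ.Sat (G.labels p.start))
  | edge φ, p => ∃ e v, p.steps = [(e, v)] ∧ G.ends e = some (p.start, v) ∧
      (∀ ψ, φ = some ψ → ψ.Sat (G.labels e))
  | concat P Q, p => ∃ p₁ p₂, P.Matches G μ p₁ ∧ Q.Matches G μ p₂ ∧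
      p₁.target = p₂.start ∧ p = p₁.append p₂
  | union P Q, p => P.Matches G μ p ∨ Q.Matches G μ p
  | star P, p => IsIteration G (P.Matches G μ) p

end PathPattern

/-- Graph patterns `z₁ = P₁, …, zₘ = Pₘ`. Path variables are numbered (separately from the node
variables). -/
abbrev GraphPattern := List (ℕ × PathPattern)

namespace GraphPattern

/-- The node variables of a graph pattern. -/
def vars (q : GraphPattern) : Set ℕ := {x | ∃ zP ∈ q, x ∈ zP.2.vars}

/-- The path variables are pairwise distinct, and the path patterns are well-formed. -/
def WellFormed (q : GraphPattern) : Prop :=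
  (q.map Prod.fst).Nodup ∧ ∀ zP ∈ q, zP.2.WellFormed

/-- The mapping of the node variables to nodes by `μ`, and of the path variables to paths by `ν`, is
a match for `q` in `G`. -/
def IsMatch (q : GraphPattern) (G : PropertyGraph V) (μ : ℕ → Ident) (ν : ℕ → Path) : Prop :=
  ∀ zP ∈ q, G.IsPath (ν zP.1) ∧ zP.2.Matches G μ (ν zP.1)

end GraphPattern

/-! ## Constraints -/

/-- Comparison operators. -/
inductive Cmp : Type
  | eq | ne | le | ge | lt | gt

/-- The meaning of the comparison operators. -/
def Cmp.Holds [PartialOrder V] : Cmp → V → V → Prop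
  | eq, a, b => a = b
  | ne, a, b => a ≠ b
  | le, a, b => a ≤ b
  | ge, a, b => b ≤ a
  | lt, a, b => a < b
  | gt, a, b => b < a

/-- Predicates `x = y`, `x ≠ y`, `x.A ⊕ y.B` and `x.A ⊕ c`. -/
inductive Predicate (V : Type*) : Type _
  | varEq : ℕ → ℕ → Predicate V
  | varNe : ℕ → ℕ → Predicate V
  | propProp : ℕ → Key → Cmp → ℕ → Key → Predicate V
  | propConst : ℕ → Key → Cmp → V → Predicate V

namespace Predicate

/-- The node variables of a predicate. -/
def vars : Predicate V → Set ℕ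
  | varEq x y => {x, y}
  | varNe x y => {x, y}
  | propProp x _ _ y _ => {x, y}
  | propConst x _ _ _ => {x}

/-- A mapping of the node variables to nodes satisfies a predicate; in particular all properties
that are mentioned have to exist. -/
def Sat [PartialOrder V] (G : PropertyGraph V) (μ : ℕ → Ident) : Predicate V → Prop
  | varEq x y => μ x = μ y
  | varNe x y => μ x ≠ μ y
  | propProp x A op y B => ∃ a b, G.prop (μ x) A = some a ∧ G.prop (μ y) B = some b ∧ op.Holds a b
  | propConst x A op c => ∃ a, G.prop (μ x) A = some a ∧ op.Holds a c

end Predicate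

/-- Constraints `q; F ⇒ C`. -/
structure Constraint (V : Type*) where
  pattern : GraphPattern
  filter : Finset (Predicate V)
  condition : Finset (Predicate V)

namespace Constraint

/-- The pattern is well-formed, and the predicates refer to node variables of the pattern only. -/
def WellFormed (σ : Constraint V) : Prop :=
  σ.pattern.WellFormed ∧ (∀ f ∈ σ.filter, f.vars ⊆ σ.pattern.vars) ∧
    ∀ f ∈ σ.condition, f.vars ⊆ σ.pattern.vars

/-- No label expression in the pattern contains a negation. -/
def Positive (σ : Constraint V) : Prop := ∀ zP ∈ σ.pattern, zP.2.Positive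

/-- `G` satisfies the constraint: every match that satisfies the filter satisfies the condition. -/
def Sat [PartialOrder V] (σ : Constraint V) (G : PropertyGraph V) : Prop :=
  ∀ (μ : ℕ → Ident) (ν : ℕ → Path), σ.pattern.IsMatch G μ ν →
    (∀ f ∈ σ.filter, f.Sat G μ) → ∀ f ∈ σ.condition, f.Sat G μ

end Constraint

/-! ## Repairs -/

/-- `H` is a repair of `G` with respect to `S`, where `Sub` is the kind of subgraphs under
consideration: a maximal subgraph that satisfies all constraints in `S`. -/
def IsRepair [PartialOrder V] (Sub : PropertyGraph V → PropertyGraph V → Prop)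
    (S : Finset (Constraint V)) (G H : PropertyGraph V) : Prop :=
  Sub H G ∧ (∀ σ ∈ S, σ.Sat H) ∧
    ¬ ∃ H', Sub H' G ∧ Sub H H' ∧ H ≠ H' ∧ ∀ σ ∈ S, σ.Sat H'

/-! ## Encodings -/

/-- The encoding of words. -/
def encWord : Word → Data := Data.ofList Data.ofBool

/-- The encoding of two values, given names for the values. -/
def encValues (code : V → Word) (ab : V × V) : Data :=
  .cons (encWord (code ab.1)) (encWord (code ab.2))

/-- The labels and properties of a node or an edge, written out as lists. -/
structure Annotation (V : Type*) where
  labels : List Label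
  props : List (Key × V)

/-- The lists contain exactly the labels and properties of `o` in `G`, without repetition. -/
def Annotation.Lists (A : Annotation V) (G : PropertyGraph V) (o : Ident) : Prop :=
  A.labels.Nodup ∧ (∀ l, l ∈ A.labels ↔ l ∈ G.labels o) ∧
    A.props.Nodup ∧ ∀ k v, (k, v) ∈ A.props ↔ G.prop o k = some v

/-- The encoding of labels and properties. -/
def Annotation.enc (code : V → Word) (A : Annotation V) : Data :=
  .cons (Data.ofList encWord A.labels)
    (Data.ofList (fun kv : Key × V => .cons (encWord kv.1) (encWord (code kv.2))) A.props)

/-- A property graph, written out as lists: the nodes with their annotations, and the edges with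
their sources, targets and annotations. -/
structure Listing (V : Type*) where
  nodes : List (Ident × Annotation V)
  edges : List (Ident × (Ident × Ident) × Annotation V)

/-- The lists contain exactly the nodes and edges of `G`, without repetition. -/
def Listing.Lists (D : Listing V) (G : PropertyGraph V) : Prop :=
  (D.nodes.map Prod.fst).Nodup ∧ (∀ o, o ∈ D.nodes.map Prod.fst ↔ o ∈ G.nodes) ∧
  (D.edges.map Prod.fst).Nodup ∧ (∀ o, o ∈ D.edges.map Prod.fst ↔ o ∈ G.edges) ∧
  (∀ r ∈ D.nodes, r.2.Lists G r.1) ∧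
  ∀ r ∈ D.edges, G.ends r.1 = some r.2.1 ∧ r.2.2.Lists G r.1

/-- The encoding of such lists. -/
def Listing.enc (code : V → Word) (D : Listing V) : Data :=
  .cons
    (Data.ofList (fun r : Ident × Annotation V => .cons (encWord r.1) (r.2.enc code)) D.nodes)
    (Data.ofList (fun r : Ident × (Ident × Ident) × Annotation V =>
      .cons (encWord r.1)
        (.cons (.cons (encWord r.2.1.1) (encWord r.2.1.2)) (r.2.2.enc code))) D.edges)

/-- `t` is an encoding of the property graph `G`; the order in which nodes, edges, labels and
properties are listed is arbitrary. -/
def PropertyGraph.IsEncodedBy (code : V → Word) (G : PropertyGraph V) (t : Data) : Prop :=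
  ∃ D : Listing V, D.Lists G ∧ D.enc code = t

end PGRepair

/-! Exponential time leaves room for brute force. Cut `G` into items: nodes, edges with their end
points, single labels, single properties. A graph is determined by its items, being a subgraph is
inclusion of items, and a subset of the items of `G` comes from a subgraph as soon as edges keep
their end points and annotations keep their carriers (`Item.graph_ext`, `Item.isSubgraph_iff`,
`Item.exists_graph`). The list of all sublists of the items has exponential size, and
polynomial-time work on it still takes exponential time in the size of `G` (`ExpBounded.comp`).

With this list at hand, a fixed constraint can be checked in polynomial time. Paths may be
arbitrarily long, but once the node variables are assigned, only the existence of suitable end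
points matters (`GraphPattern.exists_isMatch_iff`). Each path pattern becomes a binary relation on
nodes, and star becomes reflexive transitive closure (`PathPattern.connects_star`). The closure is
tested without iteration: `v` is reachable from `u` if and only if `v` lies in every set of nodes
that contains `u` and is closed under steps, and all sets of nodes occur in the list (`matchD_iff`).
The number of node variables is fixed, so all assignments can be tried (`satD_iff`).

A repair exists because the graph without nodes satisfies every well-formed constraint: a longest
list among those describing admissible subgraphs is maximal (`exists_bestD`), and maximal lists are
repairs (`isRepair_of_bestD`).

Nondeterminism enters only through the order on values. The given procedure is called for all pairs
of relevant values and the answers are stored in a table; a rejecting call spoils the table, and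
then the whole computation rejects (`exists_tableProg`, `solvableInNExpTime_of_powList`).

On the machine level, `ang` allows one proof to treat all computations and some computation alike.
Programs for functions use variable `M` for the value, `M + 1` as a stack and `M + 2` as scratch,
where `M` lies above all variables of the given procedure. -/

namespace PGRepair

/-! ## Running programs -/

/-- All computations (`ang = false`), or some computation (`ang = true`), starting with the programs
`k` and the store `s` halt within `n` steps in a store that satisfies `Q`. -/
def Runs (ang : Bool) : ℕ → List Prog → Store → (Store → Prop) → Prop
  | _, [], s, Q => Q s
  | 0, _ :: _, _, _ => False
  | n + 1, c :: k, s, Q =>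
    if ang then ∃ b, Step (c :: k, s) b ∧ Runs ang n b.1 b.2 Q
    else ∀ b, Step (c :: k, s) b → Runs ang n b.1 b.2 Q

namespace Runs

variable {ang : Bool} {n m : ℕ} {c d : Prog} {k : List Prog} {s : Store} {Q R : Store → Prop}

theorem nil_iff : Runs ang n [] s Q ↔ Q s := by cases n <;> rfl

theorem mono (h : Runs ang n k s Q) (hn : n ≤ m) (hQ : ∀ s', Q s' → R s') : Runs ang m k s R := by
  induction n generalizing m k s with
  | zero =>
    cases k with
    | nil => exact nil_iff.2 (hQ _ h)
    | cons c k => exact h.elim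
  | succ n ih =>
    cases k with
    | nil => exact nil_iff.2 (hQ _ h)
    | cons c k =>
      obtain ⟨m, rfl⟩ : ∃ m', m = m' + 1 := ⟨m - 1, by omega⟩
      cases ang
      · simp only [Runs, Bool.false_eq_true, if_false] at h ⊢
        exact fun b hb => ih (h b hb) (by omega)
      · simp only [Runs, if_true] at h ⊢
        obtain ⟨b, hb, h⟩ := h
        exact ⟨b, hb, ih h (by omega)⟩

theorem mono_time (h : Runs ang n k s Q) (hn : n ≤ m) : Runs ang m k s Q := h.mono hn fun _ => id

theorem step_append {c : Prog} {k l : List Prog} {s : Store} {b : Config}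
    (h : Step (c :: k, s) b) : Step (c :: (k ++ l), s) (b.1 ++ l, b.2) := by
  cases h
  · exact .assign ..
  · exact .seq ..
  · exact .ite_true _ _ _ _ _ ‹_›
  · exact .ite_false _ _ _ _ _ ‹_›
  · exact .loop_true _ _ _ _ ‹_›
  · exact .loop_false _ _ _ _ ‹_›
  · exact .choose_left ..
  · exact .choose_right ..

theorem step_of_append {c : Prog} {k l : List Prog} {s : Store} {b : Config}
    (h : Step (c :: (k ++ l), s) b) : ∃ b', Step (c :: k, s) b' ∧ b = (b'.1 ++ l, b'.2) := by
  cases h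
  · exact ⟨_, .assign .., rfl⟩
  · exact ⟨_, .seq .., rfl⟩
  · exact ⟨_, .ite_true _ _ _ _ _ ‹_›, rfl⟩
  · exact ⟨_, .ite_false _ _ _ _ _ ‹_›, rfl⟩
  · exact ⟨_, .loop_true _ _ _ _ ‹_›, rfl⟩
  · exact ⟨_, .loop_false _ _ _ _ ‹_›, rfl⟩
  · exact ⟨_, .choose_left .., rfl⟩
  · exact ⟨_, .choose_right .., rfl⟩

theorem append {l : List Prog} (h : Runs ang n k s Q) (h' : ∀ s', Q s' → Runs ang m l s' R) :
    Runs ang (n + m) (k ++ l) s R := by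
  induction n generalizing k s with
  | zero =>
    cases k with
    | nil => exact (h' _ h).mono_time (by omega)
    | cons c k => exact h.elim
  | succ n ih =>
    cases k with
    | nil => exact (h' _ h).mono_time (by omega)
    | cons c k =>
      rw [show n + 1 + m = (n + m) + 1 by omega]
      cases ang
      · simp only [Runs, Bool.false_eq_true, if_false, List.cons_append] at h ⊢
        intro b hb
        obtain ⟨b', hb', rfl⟩ := step_of_append hb
        exact ih (h b' hb')
      · simp only [Runs, if_true, List.cons_append] at h ⊢
        obtain ⟨b, hb, h⟩ := h
        exact ⟨_, step_append hb, ih h⟩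

/-- A step with a unique successor behaves alike in both modes, so the rules for deterministic
commands can be stated for both at once. -/
theorem of_step {b : Config} (hb : Step (c :: k, s) b) (hu : ∀ b', Step (c :: k, s) b' → b' = b)
    (h : Runs ang n b.1 b.2 Q) : Runs ang (n + 1) (c :: k) s Q := by
  cases ang
  · simp only [Runs, Bool.false_eq_true, if_false]
    intro b' hb'
    rw [hu b' hb']
    exact h
  · simp only [Runs, if_true]
    exact ⟨b, hb, h⟩

theorem assign {x : ℕ} {e : Expr} (h : Runs ang n k (Function.update s x (e.eval s)) Q) :
    Runs ang (n + 1) (.assign x e :: k) s Q :=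
  of_step (.assign ..) (fun b' hb' => by cases hb'; rfl) h

theorem seq (h : Runs ang n (c :: d :: k) s Q) : Runs ang (n + 1) (.seq c d :: k) s Q :=
  of_step (.seq ..) (fun b' hb' => by cases hb'; rfl) h

theorem ite_true {e : Expr} (he : e.eval s ≠ Data.nil) (h : Runs ang n (c :: k) s Q) :
    Runs ang (n + 1) (.ite e c d :: k) s Q :=
  of_step (.ite_true _ _ _ _ _ he)
    (fun b' hb' => by cases hb' <;> first | rfl | contradiction) h

theorem ite_false {e : Expr} (he : e.eval s = Data.nil) (h : Runs ang n (d :: k) s Q) :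
    Runs ang (n + 1) (.ite e c d :: k) s Q :=
  of_step (.ite_false _ _ _ _ _ he)
    (fun b' hb' => by cases hb' <;> first | rfl | contradiction) h

theorem loop_true {e : Expr} (he : e.eval s ≠ Data.nil)
    (h : Runs ang n (c :: .loop e c :: k) s Q) : Runs ang (n + 1) (.loop e c :: k) s Q :=
  of_step (.loop_true _ _ _ _ he)
    (fun b' hb' => by cases hb' <;> first | rfl | contradiction) h

theorem loop_false {e : Expr} (he : e.eval s = Data.nil) (h : Runs ang n k s Q) :
    Runs ang (n + 1) (.loop e c :: k) s Q :=
  of_step (.loop_false _ _ _ _ he)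
    (fun b' hb' => by cases hb' <;> first | rfl | contradiction) h

theorem exists_step (c : Prog) (k : List Prog) (s : Store) : ∃ b, Step (c :: k, s) b := by
  cases c with
  | assign x e => exact ⟨_, .assign ..⟩
  | seq c d => exact ⟨_, .seq ..⟩
  | ite e c d =>
    by_cases h : e.eval s = Data.nil
    · exact ⟨_, .ite_false _ _ _ _ _ h⟩
    · exact ⟨_, .ite_true _ _ _ _ _ h⟩
  | loop e c =>
    by_cases h : e.eval s = Data.nil
    · exact ⟨_, .loop_false _ _ _ _ h⟩
    · exact ⟨_, .loop_true _ _ _ _ h⟩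
  | choose c d => exact ⟨_, .choose_left ..⟩

/-- Links mode `false` to the two universal clauses of `SolvableInNExpTime`. Only the empty list of
programs has no successor (`exists_step`), so a configuration with work left cannot satisfy the time
bound `0`. -/
theorem false_iff : Runs false n k s Q ↔
    (∀ m b, ReachesIn m (k, s) b → m ≤ n) ∧ ∀ m s', ReachesIn m (k, s) ([], s') → Q s' := by
  induction n generalizing k s with
  | zero =>
    cases k with
    | nil =>
      refine ⟨fun h => ⟨fun m b hb => ?_, fun m s' hs' => ?_⟩, fun h => h.2 0 s rfl⟩
      · cases m with
        | zero => exact le_rfl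
        | succ m => obtain ⟨_, h, _⟩ := hb; cases h
      · cases m with
        | zero => cases hs'; exact h
        | succ m => obtain ⟨_, h, _⟩ := hs'; cases h
    | cons c k =>
      refine ⟨fun h => h.elim, fun h => ?_⟩
      obtain ⟨b, hb⟩ := exists_step c k s
      exact absurd (h.1 1 b ⟨b, hb, rfl⟩) (by omega)
  | succ n ih =>
    cases k with
    | nil =>
      refine ⟨fun h => ⟨fun m b hb => ?_, fun m s' hs' => ?_⟩, fun h => h.2 0 s rfl⟩
      · cases m with
        | zero => omega
        | succ m => obtain ⟨_, h, _⟩ := hb; cases h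
      · cases m with
        | zero => cases hs'; exact h
        | succ m => obtain ⟨_, h, _⟩ := hs'; cases h
    | cons c k =>
      simp only [Runs, Bool.false_eq_true, if_false]
      refine ⟨fun h => ⟨fun m b hb => ?_, fun m s' hs' => ?_⟩, fun h b hb => ih.2 ⟨?_, ?_⟩⟩
      · cases m with
        | zero => omega
        | succ m =>
          obtain ⟨b', hb', h'⟩ := hb
          have := (ih.1 (h b' hb')).1 m b h'
          omega
      · cases m with
        | zero => cases hs'
        | succ m =>
          obtain ⟨b', hb', h'⟩ := hs'
          exact (ih.1 (h b' hb')).2 m s' h'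
      · intro m b' hb'
        have := h.1 (m + 1) b' ⟨b, hb, hb'⟩
        omega
      · exact fun m s' hs' => h.2 (m + 1) s' ⟨b, hb, hs'⟩

theorem exists_of_true (h : Runs true n k s Q) : ∃ m s', ReachesIn m (k, s) ([], s') ∧ Q s' := by
  induction n generalizing k s with
  | zero =>
    cases k with
    | nil => exact ⟨0, s, rfl, h⟩
    | cons c k => exact h.elim
  | succ n ih =>
    cases k with
    | nil => exact ⟨0, s, rfl, h⟩
    | cons c k =>
      simp only [Runs, if_true] at h
      obtain ⟨b, hb, h⟩ := h
      obtain ⟨m, s', h1, h2⟩ := ih h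
      exact ⟨m + 1, s', ⟨b, hb, h1⟩, h2⟩

/-- Turns the accepting computation supplied by solvability into a statement in mode `true`. -/
theorem true_of_reachesIn {s' : Store} (h : ReachesIn m (k, s) ([], s')) (hQ : Q s') :
    Runs true m k s Q := by
  induction m generalizing k s with
  | zero => cases h; exact hQ
  | succ m ih =>
    obtain ⟨⟨k', t⟩, hb, h⟩ := h
    cases k with
    | nil => cases hb
    | cons c k =>
      simp only [Runs, if_true]
      exact ⟨_, hb, ih h⟩

end Runs

/-! ## Programs with few variables -/

/-- All variables of the expression are below `M`. -/
def Expr.VarsBelow (M : ℕ) : Expr → Prop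
  | .var x => x < M
  | .nil => True
  | .cons a b => a.VarsBelow M ∧ b.VarsBelow M
  | .hd a => a.VarsBelow M
  | .tl a => a.VarsBelow M

/-- All variables of the program are below `M`. -/
def Prog.VarsBelow (M : ℕ) : Prog → Prop
  | .assign x e => x < M ∧ e.VarsBelow M
  | .seq c d => c.VarsBelow M ∧ d.VarsBelow M
  | .ite e c d => e.VarsBelow M ∧ c.VarsBelow M ∧ d.VarsBelow M
  | .loop e c => e.VarsBelow M ∧ c.VarsBelow M
  | .choose c d => c.VarsBelow M ∧ d.VarsBelow M

theorem Expr.VarsBelow.mono {M N : ℕ} (h : M ≤ N) {e : Expr} (he : e.VarsBelow M) :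
    e.VarsBelow N := by
  induction e with
  | var x => exact lt_of_lt_of_le he h
  | nil => trivial
  | cons a b iha ihb => exact ⟨iha he.1, ihb he.2⟩
  | hd a ih => exact ih he
  | tl a ih => exact ih he

theorem Prog.VarsBelow.mono {M N : ℕ} (h : M ≤ N) {c : Prog} (hc : c.VarsBelow M) :
    c.VarsBelow N := by
  induction c with
  | assign x e => exact ⟨lt_of_lt_of_le hc.1 h, hc.2.mono h⟩
  | seq c d ihc ihd => exact ⟨ihc hc.1, ihd hc.2⟩
  | ite e c d ihc ihd => exact ⟨hc.1.mono h, ihc hc.2.1, ihd hc.2.2⟩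
  | loop e c ih => exact ⟨hc.1.mono h, ih hc.2⟩
  | choose c d ihc ihd => exact ⟨ihc hc.1, ihd hc.2⟩

theorem Expr.exists_varsBelow (e : Expr) : ∃ M, e.VarsBelow M := by
  induction e with
  | var x => exact ⟨x + 1, Nat.lt_succ_self x⟩
  | nil => exact ⟨0, trivial⟩
  | cons a b iha ihb =>
    obtain ⟨M, hM⟩ := iha
    obtain ⟨N, hN⟩ := ihb
    exact ⟨max M N, hM.mono (le_max_left _ _), hN.mono (le_max_right _ _)⟩
  | hd a ih => exact ih
  | tl a ih => exact ih

theorem Prog.exists_varsBelow (c : Prog) : ∃ M, c.VarsBelow M := by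
  induction c with
  | assign x e =>
    obtain ⟨M, hM⟩ := e.exists_varsBelow
    exact ⟨max (x + 1) M, lt_of_lt_of_le (Nat.lt_succ_self x) (le_max_left _ _),
      hM.mono (le_max_right _ _)⟩
  | seq c d ihc ihd =>
    obtain ⟨M, hM⟩ := ihc
    obtain ⟨N, hN⟩ := ihd
    exact ⟨max M N, hM.mono (le_max_left _ _), hN.mono (le_max_right _ _)⟩
  | ite e c d ihc ihd =>
    obtain ⟨K, hK⟩ := e.exists_varsBelow
    obtain ⟨M, hM⟩ := ihc
    obtain ⟨N, hN⟩ := ihd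
    exact ⟨max K (max M N), hK.mono (le_max_left _ _),
      hM.mono ((le_max_left _ _).trans (le_max_right _ _)),
      hN.mono ((le_max_right _ _).trans (le_max_right _ _))⟩
  | loop e c ih =>
    obtain ⟨K, hK⟩ := e.exists_varsBelow
    obtain ⟨M, hM⟩ := ih
    exact ⟨max K M, hK.mono (le_max_left _ _), hM.mono (le_max_right _ _)⟩
  | choose c d ihc ihd =>
    obtain ⟨M, hM⟩ := ihc
    obtain ⟨N, hN⟩ := ihd
    exact ⟨max M N, hM.mono (le_max_left _ _), hN.mono (le_max_right _ _)⟩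

theorem Expr.eval_congr {M : ℕ} {s r : Store} (h : ∀ i < M, s i = r i) {e : Expr}
    (he : e.VarsBelow M) : e.eval s = e.eval r := by
  induction e with
  | var x => exact h x he
  | nil => rfl
  | cons a b iha ihb => simp only [Expr.eval, iha he.1, ihb he.2]
  | hd a ih => simp only [Expr.eval, ih he]
  | tl a ih => simp only [Expr.eval, ih he]

theorem Step.congr {M : ℕ} {k : List Prog} {s r : Store} (hk : ∀ c ∈ k, c.VarsBelow M)
    (h : ∀ i < M, s i = r i) {b : Config} (hb : Step (k, s) b) :
    ∃ r', Step (k, r) (b.1, r') ∧ (∀ c ∈ b.1, c.VarsBelow M) ∧ (∀ i < M, b.2 i = r' i) ∧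
      ∀ i, M ≤ i → r' i = r i := by
  cases hb with
  | assign x e k =>
    simp only [List.mem_cons, forall_eq_or_imp] at hk
    refine ⟨_, .assign .., hk.2, fun i hi => ?_, fun i hi => ?_⟩
    · simp only [Function.update_apply, Expr.eval_congr h hk.1.2, h i hi]
    · have := hk.1.1
      rw [Function.update_of_ne (by omega)]
  | seq c d k =>
    simp only [List.mem_cons, forall_eq_or_imp] at hk
    refine ⟨_, .seq .., ?_, h, fun _ _ => rfl⟩
    simp only [List.mem_cons, forall_eq_or_imp]
    exact ⟨hk.1.1, hk.1.2, hk.2⟩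
  | ite_true e c d k _ he =>
    simp only [List.mem_cons, forall_eq_or_imp] at hk
    refine ⟨_, .ite_true _ _ _ _ _ (Expr.eval_congr h hk.1.1 ▸ he), ?_, h, fun _ _ => rfl⟩
    simp only [List.mem_cons, forall_eq_or_imp]
    exact ⟨hk.1.2.1, hk.2⟩
  | ite_false e c d k _ he =>
    simp only [List.mem_cons, forall_eq_or_imp] at hk
    refine ⟨_, .ite_false _ _ _ _ _ (Expr.eval_congr h hk.1.1 ▸ he), ?_, h, fun _ _ => rfl⟩
    simp only [List.mem_cons, forall_eq_or_imp]
    exact ⟨hk.1.2.2, hk.2⟩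
  | loop_true e c k _ he =>
    have hk' := hk
    simp only [List.mem_cons, forall_eq_or_imp] at hk'
    refine ⟨_, .loop_true _ _ _ _ (Expr.eval_congr h hk'.1.1 ▸ he), ?_, h, fun _ _ => rfl⟩
    simp only [List.mem_cons, forall_eq_or_imp]
    exact ⟨hk'.1.2, hk'.1, hk'.2⟩
  | loop_false e c k _ he =>
    simp only [List.mem_cons, forall_eq_or_imp] at hk
    exact ⟨_, .loop_false _ _ _ _ (Expr.eval_congr h hk.1.1 ▸ he), hk.2, h, fun _ _ => rfl⟩
  | choose_left c d k =>
    simp only [List.mem_cons, forall_eq_or_imp] at hk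
    refine ⟨_, .choose_left .., ?_, h, fun _ _ => rfl⟩
    simp only [List.mem_cons, forall_eq_or_imp]
    exact ⟨hk.1.1, hk.2⟩
  | choose_right c d k =>
    simp only [List.mem_cons, forall_eq_or_imp] at hk
    refine ⟨_, .choose_right .., ?_, h, fun _ _ => rfl⟩
    simp only [List.mem_cons, forall_eq_or_imp]
    exact ⟨hk.1.2, hk.2⟩

/-- A program with variables below `M` does not depend on and does not change other variables. -/
theorem Runs.congr {ang : Bool} {M n : ℕ} {k : List Prog} {s r : Store} {Q : Store → Prop}
    (hk : ∀ c ∈ k, c.VarsBelow M) (h : ∀ i < M, s i = r i) (hr : Runs ang n k s Q) :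
    Runs ang n k r fun r' => ∃ s', Q s' ∧ (∀ i < M, s' i = r' i) ∧ ∀ i, M ≤ i → r' i = r i := by
  induction n generalizing k s r with
  | zero =>
    cases k with
    | nil => exact ⟨s, hr, h, fun _ _ => rfl⟩
    | cons c k => exact hr.elim
  | succ n ih =>
    cases k with
    | nil => exact ⟨s, hr, h, fun _ _ => rfl⟩
    | cons c k =>
      cases ang
      · simp only [Runs, Bool.false_eq_true, if_false] at hr ⊢
        intro b hb
        -- In mode `false` an arbitrary step from `r` has to be imitated from `s`, so the stores
        -- change roles. That the step leaves the high variables of `r` alone is then read off `hb`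
        -- itself.
        obtain ⟨s', h1, h2, h3, h4⟩ := Step.congr hk (fun i hi => (h i hi).symm) hb
        refine (ih h2 (fun i hi => (h3 i hi).symm) (hr _ h1)).mono le_rfl ?_
        rintro r' ⟨t, ht, hlt, hge⟩
        refine ⟨t, ht, hlt, fun i hi => ?_⟩
        rw [hge i hi]
        cases hb with
        | assign x e =>
          have := (hk _ (List.mem_cons_self ..)).1
          exact Function.update_of_ne (by omega) _ _
        | _ => rfl
      · simp only [Runs, if_true] at hr ⊢
        obtain ⟨b, hb, hr⟩ := hr
        obtain ⟨r', h1, h2, h3, h4⟩ := Step.congr hk h hb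
        refine ⟨_, h1, (ih h2 h3 hr).mono le_rfl ?_⟩
        rintro r'' ⟨t, ht, hlt, hge⟩
        exact ⟨t, ht, hlt, fun i hi => (hge i hi).trans (h4 i hi)⟩


/-! ## Programs that compute functions -/

/-- Started with `x` in variable `M`, the program `c` halts within `n` steps with an element of `R`
in variable `M`, and variable `M + 1` is not changed. -/
def Realizes (M : ℕ) (ang : Bool) (c : Prog) (x : Data) (n : ℕ) (R : Data → Prop) : Prop :=
  ∀ s : Store, s M = x → Runs ang n [c] s fun s' => R (s' M) ∧ s' (M + 1) = s (M + 1)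

namespace Realizes

variable {M : ℕ} {ang : Bool} {c d e : Prog} {x : Data} {n m l : ℕ} {R Q : Data → Prop}

theorem mono (h : Realizes M ang c x n R) (hn : n ≤ m) (hR : ∀ y, R y → Q y) :
    Realizes M ang c x m Q := fun s hs =>
  (h s hs).mono hn fun _ hs' => ⟨hR _ hs'.1, hs'.2⟩

theorem run (h : Realizes M ang c x n R) {k : List Prog} {s : Store} {T : Store → Prop}
    (hs : s M = x) (h' : ∀ s', R (s' M) → s' (M + 1) = s (M + 1) → Runs ang m k s' T) :
    Runs ang (n + m) (c :: k) s T :=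
  Runs.append (h s hs) fun s' hs' => h' s' hs'.1 hs'.2

theorem seq (h : Realizes M ang c x n R) (h' : ∀ y, R y → Realizes M ang d y m Q) :
    Realizes M ang (.seq c d) x (n + m + 1) Q := fun _ hs =>
  .seq (h.run hs fun s' h1 h2 => (h' _ h1 s' rfl).mono le_rfl fun _ ht => ⟨ht.1, ht.2.trans h2⟩)

theorem assign {E : Expr} (h : ∀ s : Store, s M = x → R (E.eval s)) :
    Realizes M ang (.assign M E) x 1 R := fun s hs =>
  .assign (Runs.nil_iff.2 ⟨by simpa using h s hs, by simp⟩)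

/-- Compute two values and combine them. -/
def pairProg (M : ℕ) (c d : Prog) : Prog :=
  .seq (.assign (M + 1) (.cons (.var M) (.var (M + 1)))) (.seq c
    (.seq (.assign (M + 2) (.hd (.var (M + 1))))
    (.seq (.assign (M + 1) (.cons (.var M) (.tl (.var (M + 1)))))
    (.seq (.assign M (.var (M + 2))) (.seq d
    (.seq (.assign M (.cons (.hd (.var (M + 1))) (.var M)))
    (.assign (M + 1) (.tl (.var (M + 1))))))))))

/-- The input is pushed on the stack so that it survives `c`; the first result takes its place while
`d` runs. Both calls return the stack unchanged, which is why `Realizes` demands this of variable `M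
+ 1`. -/
theorem pair (hc : Realizes M ang c x n R) (hd : Realizes M ang d x m Q) :
    Realizes M ang (pairProg M c d) x (n + m + 13)
      (fun z => ∃ y y', R y ∧ Q y' ∧ z = .cons y y') := fun s hs => by
  refine Runs.mono_time (n := (n + ((m + 3) + 7)) + 3) ?_ (by omega)
  refine .seq (.assign (.seq (hc.run (by simpa using hs) fun s₁ h₁ h₁' => ?_)))
  refine .seq (.assign (.seq (.assign (.seq (.assign (.seq (hd.run ?_ fun s₂ h₂ h₂' => ?_)))))))
  · simp [h₁', hs, Expr.eval, Data.hd]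
  · refine .seq (.assign (.assign (Runs.nil_iff.2 ?_)))
    simp [Expr.eval, h₂', Data.hd, Data.tl, h₁', h₁, h₂]

/-- Branch according to a computed value. -/
def iteProg (M : ℕ) (c d e : Prog) : Prog :=
  .seq (.assign (M + 1) (.cons (.var M) (.var (M + 1)))) (.seq c
    (.seq (.assign (M + 2) (.var M)) (.seq (.assign M (.hd (.var (M + 1))))
    (.seq (.assign (M + 1) (.tl (.var (M + 1)))) (.ite (.var (M + 2)) d e)))))

theorem ite {b : Data} (hc : Realizes M ang c x n (· = b))
    (hd : b ≠ .nil → Realizes M ang d x m Q) (he : b = .nil → Realizes M ang e x m Q) :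
    Realizes M ang (iteProg M c d e) x (n + m + 10) Q := fun s hs => by
  refine Runs.mono_time (n := (n + (m + 7)) + 3) ?_ (by omega)
  refine .seq (.assign (.seq (hc.run (by simpa using hs) fun s₁ h₁ h₁' => ?_)))
  refine .seq (.assign (.seq (.assign (.seq (.assign ?_)))))
  by_cases hb : b = .nil
  · refine Runs.ite_false (by simp [Expr.eval, h₁, hb]) ?_
    refine Runs.mono (he hb _ ?_) le_rfl fun t ht => ⟨ht.1, ht.2.trans ?_⟩
    · simp [h₁', hs, Expr.eval, Data.hd]
    · simp [h₁', hs, Expr.eval, Data.tl]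
  · refine Runs.ite_true (by simp [Expr.eval, h₁, hb]) ?_
    refine Runs.mono (hd hb _ ?_) le_rfl fun t ht => ⟨ht.1, ht.2.trans ?_⟩
    · simp [h₁', hs, Expr.eval, Data.hd]
    · simp [h₁', hs, Expr.eval, Data.tl]

end Realizes

/-! ### Trees as lists, and their sizes. -/

namespace Data

/-- The entries of a tree, seen as a list. -/
def toList : Data → List Data
  | nil => []
  | cons a b => a :: b.toList

/-- A list of trees as a tree. -/
abbrev ofL : List Data → Data := ofList id

@[simp] theorem toList_ofList {α : Type*} (f : α → Data) (l : List α) :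
    (ofList f l).toList = l.map f := by
  induction l with
  | nil => rfl
  | cons a l ih => simp [ofList, toList, ih]

theorem ofList_eq {α : Type*} (f : α → Data) (l : List α) : ofList f l = ofL (l.map f) := by
  induction l with
  | nil => rfl
  | cons a l ih => simp only [ofList, ih, List.map_cons, id]

@[simp] theorem ofL_toList (d : Data) : ofL d.toList = d := by
  induction d with
  | nil => rfl
  | cons a b _ ih => simp only [toList, ofList, id, ih]

theorem size_pos (d : Data) : 0 < d.size := by cases d <;> simp [size]

theorem size_hd_le (d : Data) : d.hd.size ≤ d.size := by
  cases d with
  | nil => exact le_rfl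
  | cons a b => simp only [hd, size]; omega

theorem size_tl_le (d : Data) : d.tl.size ≤ d.size := by
  cases d with
  | nil => exact le_rfl
  | cons a b => simp only [tl, size]; omega

theorem length_toList_le (d : Data) : d.toList.length < d.size := by
  induction d with
  | nil => simp [toList, size]
  | cons a b _ ih => simp only [toList, size, List.length_cons]; omega

theorem size_lt_of_mem_toList {a d : Data} (h : a ∈ d.toList) : a.size < d.size := by
  induction d with
  | nil => simp [toList] at h
  | cons b c _ ih =>
    simp only [toList, List.mem_cons] at h
    rcases h with rfl | h
    · simp only [size]; omega
    · have := ih h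
      simp only [size]; omega

theorem size_ofL_append (l m : List Data) :
    (ofL (l ++ m)).size + 1 = (ofL l).size + (ofL m).size := by
  induction l with
  | nil => simp [ofList, size]; omega
  | cons a l ih => simp only [List.cons_append, ofL, ofList, size, id] at ih ⊢; omega

end Data

/-! ### Loops over lists and equality of trees. -/

namespace Realizes

variable {M : ℕ} {ang : Bool} {c : Prog} {n : ℕ}

/-- Started with `((acc, l), x)`, run `c` on `(y, (acc, x))` for all entries `y` of `l`, each time
replacing `acc` by the result. -/
def foldProg (M : ℕ) (c : Prog) : Prog :=
  .seq (.loop (.tl (.hd (.var M)))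
    (.seq (.assign (M + 1) (.cons (.var M) (.var (M + 1))))
    (.seq (.assign M (.cons (.hd (.tl (.hd (.var M))))
      (.cons (.hd (.hd (.var M))) (.tl (.var M)))))
    (.seq c
    (.seq (.assign M (.cons (.cons (.var M) (.tl (.tl (.hd (.hd (.var (M + 1)))))))
      (.tl (.hd (.var (M + 1))))))
    (.assign (M + 1) (.tl (.var (M + 1)))))))))
  (.assign M (.hd (.hd (.var M))))

/-- The invariant relates the entries still to come to the accumulator, so that correctness and size
bounds on intermediate values are proved together. While `c` runs, the state of the loop lies on the
stack; saving and restoring it accounts for the 9 extra steps per entry. -/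
theorem fold {x : Data} (Inv : List Data → Data → Prop)
    (hc : ∀ y l acc, Inv (y :: l) acc →
      Realizes M ang c (.cons y (.cons acc x)) n fun acc' => Inv l acc')
    {l a : Data} (h : Inv l.toList a) :
    Realizes M ang (foldProg M c) (.cons (.cons a l) x) (l.toList.length * (n + 9) + 3)
      fun r => Inv [] r := by
  intro s hs
  refine .seq ?_
  suffices key : ∀ (t : Store) (l a : Data), Inv l.toList a → t M = .cons (.cons a l) x →
      t (M + 1) = s (M + 1) → Runs ang (l.toList.length * (n + 9) + 2) _ t _ from key s l a h hs rfl
  clear h hs a l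
  intro t l
  induction l generalizing t with
  | nil =>
    intro a h ht ht'
    refine .loop_false (by simp [Expr.eval, ht, Data.hd, Data.tl]) (.assign (Runs.nil_iff.2 ?_))
    simp [Expr.eval, ht, ht', Data.hd, Data.toList] at h ⊢
    exact h
  | cons y l _ ih =>
    intro a h ht ht'
    refine Runs.mono_time (n := n + ((l.toList.length * (n + 9) + 2) + 3) + 6) ?_ ?_
    · refine .loop_true (by simp [Expr.eval, ht, Data.hd, Data.tl]) ?_
      refine .seq (.assign (.seq (.assign (.seq ?_))))
      refine (hc y l.toList a h).run (by simp [Expr.eval, ht, Data.hd, Data.tl]) fun s₁ h₁ h₁' => ?_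
      refine .seq (.assign (.assign ?_))
      refine ih _ _ h₁ ?_ ?_
      · simp [Expr.eval, h₁', ht, Data.hd, Data.tl]
      · simp [Expr.eval, h₁', ht', Data.tl]
    · simp only [Data.toList, List.length_cons, Nat.add_mul]
      omega

/-- Compare two trees. -/
def eqProg (M : ℕ) : Prog :=
  .seq (.assign (M + 2) (.cons .nil .nil))
    (.seq (.assign M (.cons (.var M) .nil))
    (.seq (.loop (.var M)
      (.ite (.hd (.hd (.var M)))
        (.ite (.tl (.hd (.var M)))
          (.assign M (.cons (.cons (.hd (.hd (.hd (.var M)))) (.hd (.tl (.hd (.var M)))))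
            (.cons (.cons (.tl (.hd (.hd (.var M)))) (.tl (.tl (.hd (.var M)))))
              (.tl (.var M)))))
          (.seq (.assign M .nil) (.assign (M + 2) .nil)))
        (.ite (.tl (.hd (.var M)))
          (.seq (.assign M .nil) (.assign (M + 2) .nil))
          (.assign M (.tl (.var M))))))
    (.assign M (.var (M + 2)))))

-- A worklist holds the pairs of subtrees that still have to agree. Splitting a pair of inner
-- vertices and dropping a pair of leaves both lower the total size of the first components by one,
-- which gives termination and the time bound. The hypothesis `hB` merely names the body of the loop
-- in `eqProg`.
open Classical in
theorem eq_loop {k : List Prog} {Q : Store → Prop} {B : Prog} {w : List (Data × Data)} {s t : Store}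
    {m : ℕ}
    (hB : Prog.seq (.assign (M + 2) (.cons .nil .nil)) (.seq (.assign M (.cons (.var M) .nil))
      (.seq (.loop (.var M) B) (.assign M (.var (M + 2))))) = eqProg M)
    (hs : s M = Data.ofList (fun p : Data × Data => .cons p.1 p.2) w)
    (hs1 : s (M + 1) = t (M + 1)) (hs2 : s (M + 2) = .cons .nil .nil)
    (h : ∀ s', s' (M + 1) = t (M + 1) → s' (M + 2) = Data.ofBool (∀ p ∈ w, p.1 = p.2) →
      Runs ang m k s' Q) :
    Runs ang ((w.map fun p => p.1.size).sum * 6 + 6 + m) (.loop (.var M) B :: k) s Q := by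
  induction hn : (w.map fun p => p.1.size).sum using Nat.strong_induction_on generalizing w s with
  | _ N ih =>
  subst hn
  simp only [eqProg, Prog.seq.injEq, Prog.loop.injEq, true_and, and_true] at hB
  -- On a mismatch, emptying the worklist ends the loop and the flag in `M + 2` is lowered.
  have hfail : ∀ u : Store, u (M + 1) = t (M + 1) → (¬ ∀ p ∈ w, p.1 = p.2) →
      Runs ang (m + 4) (.seq (.assign M .nil) (.assign (M + 2) .nil) :: .loop (.var M) B :: k)
        u Q := by
    intro u hu hw
    refine .seq (.assign (.assign (.loop_false (by simp [Expr.eval]) ?_)))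
    refine h _ (by simpa using hu) ?_
    rw [decide_eq_false hw]
    simp [Data.ofBool, Expr.eval]
  match w with
  | [] =>
    refine Runs.mono_time (n := m + 1)
      (.loop_false (by simp [Expr.eval, hs, Data.ofList]) (h _ hs1 ?_)) (by omega)
    simp [hs2, Data.ofBool]
  | (a, b) :: w =>
    simp only [Data.ofList] at hs
    have ha := a.size_pos
    refine Runs.mono_time (n := ((w.map fun p => p.1.size).sum * 6 + 6 * a.size + 2 + m + 3) + 1) ?_
      (by simp only [List.map_cons, List.sum_cons]; omega)
    refine .loop_true (by simp [Expr.eval, hs]) ?_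
    rw [hB]
    match a, b with
    | .nil, .nil =>
      refine .ite_false (by simp [Expr.eval, hs, Data.hd]) ?_
      refine .ite_false (by simp [Expr.eval, hs, Data.hd, Data.tl]) (.assign ?_)
      rw [← hB]
      refine Runs.mono_time (ih _ ?_ (w := w) ?_ ?_ ?_ (fun s' h1 h2 => h s' h1 ?_) rfl) ?_
      · simp [Data.size]
      · simp [Expr.eval, hs, Data.tl]
      · simpa using hs1
      · simpa using hs2
      · simpa using h2
      · simp [Data.size]
    | .nil, .cons b₁ b₂ =>
      refine .ite_false (by simp [Expr.eval, hs, Data.hd]) ?_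
      refine .ite_true (by simp [Expr.eval, hs, Data.hd, Data.tl]) ?_
      rw [← hB]
      exact (hfail s hs1 (by simp)).mono_time (by simp [Data.size]; omega)
    | .cons a₁ a₂, .nil =>
      refine .ite_true (by simp [Expr.eval, hs, Data.hd]) ?_
      refine .ite_false (by simp [Expr.eval, hs, Data.hd, Data.tl]) ?_
      rw [← hB]
      exact (hfail s hs1 (by simp)).mono_time (by simp [Data.size]; omega)
    | .cons a₁ a₂, .cons b₁ b₂ =>
      refine .ite_true (by simp [Expr.eval, hs, Data.hd]) ?_
      refine .ite_true (by simp [Expr.eval, hs, Data.hd, Data.tl]) (.assign ?_)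
      rw [← hB]
      refine Runs.mono_time (ih _ ?_ (w := (a₁, b₁) :: (a₂, b₂) :: w) ?_ ?_ ?_
        (fun s' h1 h2 => h s' h1 ?_) rfl) ?_
      · simp [Data.size]; omega
      · simp [Expr.eval, hs, Data.tl, Data.hd, Data.ofList]
      · simpa using hs1
      · simpa using hs2
      · simpa [and_assoc] using h2
      · simp [Data.size]; omega

open Classical in
theorem eq (a b : Data) : Realizes M ang (eqProg M) (.cons a b) (a.size * 6 + 12)
    (· = Data.ofBool (a = b)) := by
  intro s hs
  refine Runs.mono_time (n := ((([(a, b)] : List (Data × Data)).map fun p => p.1.size).sum * 6 + 6 + 1) + 5)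
    (.seq (.assign (.seq (.assign (.seq
      (eq_loop (t := s) (w := [(a, b)]) (m := 1) rfl ?_ ?_ ?_ fun s' h1 h2 => ?_)))))) ?_
  · simp [Expr.eval, hs, Data.ofList]
  · simp
  · simp [Expr.eval]
  · refine .assign (Runs.nil_iff.2 ?_)
    simp only [List.mem_singleton, forall_eq] at h2
    simp [Expr.eval, h1, h2]
  · simp

end Realizes

/-! ## Polynomial time -/

/-- All coefficients are natural numbers. Monotonicity is what allows bounds to be evaluated at
upper estimates of sizes. -/
theorem polynomial_eval_mono (p : Polynomial ℕ) : Monotone fun n => p.eval n := by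
  induction p using Polynomial.induction_on' with
  | add p q hp hq =>
    simp only [Polynomial.eval_add]
    exact hp.add hq
  | monomial k a =>
    intro m n h
    simp only [Polynomial.eval_monomial]
    gcongr

/-- The function `f` can be computed in polynomial time, with variables from `M` to `M + 2`, and its
values are of polynomial size. -/
@[fun_prop]
def PolyTime (M : ℕ) (f : Data → Data) : Prop :=
  ∃ (c : Prog) (p : Polynomial ℕ), ∀ x, (f x).size ≤ p.eval x.size ∧
    ∀ ang, Realizes M ang c x (p.eval x.size) (· = f x)

open Classical in
/-- The predicate `P` can be decided in polynomial time. -/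
def PolyDec (M : ℕ) (P : Data → Prop) : Prop := PolyTime M fun x => Data.ofBool (P x)

namespace PolyTime

variable {M : ℕ} {f g : Data → Data}

theorem of_bounds {c : Prog} (p q : Polynomial ℕ) (hq : ∀ x, (f x).size ≤ q.eval x.size)
    (h : ∀ ang x, Realizes M ang c x (p.eval x.size) (· = f x)) : PolyTime M f := by
  refine ⟨c, p + q, fun x => ⟨?_, fun ang => (h ang x).mono ?_ fun _ => id⟩⟩ <;>
  · have := hq x
    simp only [Polynomial.eval_add]
    omega

@[fun_prop]
theorem id' : PolyTime M fun x => x :=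
  of_bounds (c := .assign M (.var M)) 1 Polynomial.X (by simp) fun ang x =>
    (Realizes.assign fun s hs => by simpa [Expr.eval] using hs).mono (by simp) fun _ => id

-- The outer program is timed by the size of the intermediate value. A time bound alone would not
-- control it, as repeated assignments `x := cons x x` build a tree of exponential size in linear
-- time; hence `PolyTime` bounds sizes too.
@[fun_prop]
theorem comp (hf : PolyTime M f) (hg : PolyTime M g) : PolyTime M fun x => f (g x) := by
  obtain ⟨c, p, hp⟩ := hf
  obtain ⟨d, q, hq⟩ := hg
  refine of_bounds (c := .seq d c) (q + p.comp q + 1) (p.comp q) (fun x => ?_) fun ang x => ?_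
  · rw [Polynomial.eval_comp]
    exact (hp _).1.trans (polynomial_eval_mono p (hq x).1)
  · refine Realizes.mono (((hq x).2 ang).seq (m := p.eval (q.eval x.size)) fun y hy => ?_) ?_
      fun _ => id
    · subst hy
      exact ((hp _).2 ang).mono (polynomial_eval_mono p (hq x).1) fun _ => id
    · simp [Polynomial.eval_comp]

theorem _root_.PGRepair.Expr.exists_eval_const (d : Data) : ∃ e : Expr, ∀ s, e.eval s = d := by
  induction d with
  | nil => exact ⟨.nil, fun _ => rfl⟩
  | cons a b iha ihb =>
    obtain ⟨e, he⟩ := iha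
    obtain ⟨e', he'⟩ := ihb
    exact ⟨.cons e e', fun s => by simp [Expr.eval, he, he']⟩

@[fun_prop]
theorem const (d : Data) : PolyTime M fun _ => d := by
  obtain ⟨e, he⟩ := Expr.exists_eval_const d
  exact of_bounds (c := .assign M e) 1 (Polynomial.C d.size) (by simp) fun ang x =>
    (Realizes.assign fun s hs => he s).mono (by simp) fun _ => id

theorem hd' : PolyTime M Data.hd :=
  of_bounds (c := .assign M (.hd (.var M))) 1 Polynomial.X (by simpa using Data.size_hd_le)
    fun ang x => (Realizes.assign fun s hs => by simp [Expr.eval, hs]).mono (by simp) fun _ => id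

theorem tl' : PolyTime M Data.tl :=
  of_bounds (c := .assign M (.tl (.var M))) 1 Polynomial.X (by simpa using Data.size_tl_le)
    fun ang x => (Realizes.assign fun s hs => by simp [Expr.eval, hs]).mono (by simp) fun _ => id

@[fun_prop]
theorem hd (hf : PolyTime M f) : PolyTime M fun x => (f x).hd := comp hd' hf

@[fun_prop]
theorem tl (hf : PolyTime M f) : PolyTime M fun x => (f x).tl := comp tl' hf

@[fun_prop]
theorem cons (hf : PolyTime M f) (hg : PolyTime M g) :
    PolyTime M fun x => Data.cons (f x) (g x) := by
  obtain ⟨c, p, hp⟩ := hf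
  obtain ⟨d, q, hq⟩ := hg
  refine of_bounds (c := Realizes.pairProg M c d) (p + q + 13) (p + q + 1) (fun x => ?_)
    fun ang x => ?_
  · have := (hp x).1
    have := (hq x).1
    simp only [Data.size, Polynomial.eval_add, Polynomial.eval_one]
    omega
  · refine Realizes.mono (((hp x).2 ang).pair ((hq x).2 ang)) (by simp) ?_
    rintro _ ⟨_, _, rfl, rfl, rfl⟩
    rfl

/-- Iterating a polynomial-time step may leave polynomial time, since the accumulator may double in
each round. The last hypothesis allows only a summand that depends on the entry and the context, so
the total growth is at most the number of entries times a polynomial. -/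
theorem foldl {step : Data → Data → Data → Data} {l a : Data → Data}
    (hstep : PolyTime M fun z => step z.hd z.tl.hd z.tl.tl) (hl : PolyTime M l)
    (ha : PolyTime M a)
    (hq : ∃ q : Polynomial ℕ, ∀ y acc x,
      (step y acc x).size ≤ acc.size + q.eval (y.size + x.size)) :
    PolyTime M fun x => (l x).toList.foldl (fun acc y => step y acc x) (a x) := by
  obtain ⟨q, hq⟩ := hq
  have ht : PolyTime M fun x => Data.cons (Data.cons (a x) (l x)) x := by fun_prop
  obtain ⟨c, p, hp⟩ := hstep
  obtain ⟨_, pl, hpl⟩ := hl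
  obtain ⟨_, pa, hpa⟩ := ha
  obtain ⟨c₀, p₀, hp₀⟩ := ht
  -- `K` bounds one increment, `B` the accumulator, and `T` the time of one step on `(y, (acc, x))`;
  -- the two pairings contribute the summand `2`.
  let K : Polynomial ℕ := q.comp (pl + Polynomial.X)
  let B : Polynomial ℕ := pa + pl * K
  let T : Polynomial ℕ := p.comp (pl + B + Polynomial.X + 2)
  have key : ∀ ang x, Realizes M ang (Realizes.foldProg M c) (.cons (.cons (a x) (l x)) x)
      ((l x).toList.length * (T.eval x.size + 9) + 3)
      fun r => r = (l x).toList.foldl (fun acc y => step y acc x) (a x) ∧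
        r.size ≤ B.eval x.size := by
    intro ang x
    refine Realizes.mono (Realizes.fold (fun r acc =>
      r.foldl (fun acc y => step y acc x) acc =
        (l x).toList.foldl (fun acc y => step y acc x) (a x) ∧
      acc.size + r.length * K.eval x.size ≤ B.eval x.size ∧ ∀ y ∈ r, y.size ≤ pl.eval x.size)
      ?_ ⟨rfl, ?_, ?_⟩) le_rfl ?_
    · rintro y r acc ⟨h1, h2, h3⟩
      have hy := h3 y (List.mem_cons_self ..)
      refine ((hp (.cons y (.cons acc x))).2 ang).mono ?_ ?_
      · simp only [T, Polynomial.eval_comp]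
        refine polynomial_eval_mono p ?_
        simp only [Data.size, Polynomial.eval_add, Polynomial.eval_X, Polynomial.eval_ofNat]
        omega
      · rintro _ rfl
        refine ⟨h1, ?_, fun z hz => h3 z (List.mem_cons_of_mem _ hz)⟩
        refine le_trans ?_ h2
        have h4 := hq y acc x
        have h5 : q.eval (y.size + x.size) ≤ K.eval x.size := by
          simp only [K, Polynomial.eval_comp]
          refine polynomial_eval_mono q ?_
          simpa using hy
        simp only [Data.hd, Data.tl, List.length_cons, Nat.add_mul]
        omega
    · have h1 := (hpa x).1
      have h2 : (l x).toList.length * K.eval x.size ≤ pl.eval x.size * K.eval x.size :=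
        Nat.mul_le_mul_right _ ((Data.length_toList_le _).le.trans (hpl x).1)
      simp only [B, Polynomial.eval_add, Polynomial.eval_mul]
      omega
    · exact fun y hy => (Data.size_lt_of_mem_toList hy).le.trans (hpl x).1
    · rintro r ⟨h1, h2, -⟩
      exact ⟨h1, by simpa using h2⟩
  refine of_bounds (c := .seq c₀ (Realizes.foldProg M c)) (p₀ + (pl * (T + 9) + 3) + 1) B
    (fun x => ?_) fun ang x => ?_
  -- The size bound is part of the loop invariant, hence a statement about runs. It is extracted
  -- from some run, started in a store that holds the input everywhere.
  · obtain ⟨m, s', -, h⟩ :=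
      (key true x (fun _ => .cons (.cons (a x) (l x)) x) rfl).exists_of_true
    rw [← h.1.1]
    exact h.1.2
  · refine Realizes.mono (((hp₀ x).2 ang).seq (Q := fun r => r = _ ∧ r.size ≤ _) fun y hy => by
      subst hy
      exact key ang x) ?_ fun _ h => h.1
    have h2 : (l x).toList.length * (T.eval x.size + 9) ≤ pl.eval x.size * (T.eval x.size + 9) :=
        Nat.mul_le_mul_right _ ((Data.length_toList_le _).le.trans (hpl x).1)
    simp only [Polynomial.eval_add, Polynomial.eval_mul, Polynomial.eval_one,
      Polynomial.eval_ofNat]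
    omega

open Classical in
theorem ite {P : Data → Prop} (hP : PolyDec M P) (hf : PolyTime M f) (hg : PolyTime M g) :
    PolyTime M fun x => if P x then f x else g x := by
  obtain ⟨c, p, hp⟩ := hP
  obtain ⟨d, q, hq⟩ := hf
  obtain ⟨e, r, hr⟩ := hg
  refine of_bounds (c := Realizes.iteProg M c d e) (p + (q + r) + 10) (q + r) (fun x => ?_)
    fun ang x => ?_
  · have := (hq x).1
    have := (hr x).1
    simp only [Polynomial.eval_add]
    split_ifs <;> omega
  · refine Realizes.mono (((hp x).2 ang).ite (m := q.eval x.size + r.eval x.size)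
      (fun h => ((hq x).2 ang).mono (by omega) ?_) (fun h => ((hr x).2 ang).mono (by omega) ?_))
      (by simp) fun _ => id
    · have : P x := by
        by_contra h'
        simp [h', Data.ofBool] at h
      simp [this]
    · have : ¬ P x := by
        intro h'
        simp [h', Data.ofBool] at h
      simp [this]

end PolyTime

theorem Data.size_ofBool_le (b : Bool) : (Data.ofBool b).size ≤ 3 := by
  cases b <;> simp [Data.ofBool, Data.size]

/-! ### Closure properties of polynomial-time predicates. -/

namespace PolyDec

variable {M : ℕ} {f g : Data → Data} {P Q : Data → Prop}

theorem congr (hP : PolyDec M P) (h : ∀ x, Q x ↔ P x) : PolyDec M Q := by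
  have : Q = P := funext fun x => propext (h x)
  exact this ▸ hP

theorem const (p : Prop) : PolyDec M fun _ => p := PolyTime.const _

theorem eq (hf : PolyTime M f) (hg : PolyTime M g) : PolyDec M fun x => f x = g x := by
  classical
  have h : PolyTime M fun z => Data.ofBool (z.hd = z.tl) := by
    obtain ⟨c, p, hp⟩ : PolyTime M fun z => Data.cons z.hd z.tl := by fun_prop
    refine PolyTime.of_bounds (c := .seq c (Realizes.eqProg M)) (p + (Polynomial.X * 6 + 12) + 1) 3
      (fun x => by simpa using Data.size_ofBool_le _) fun ang x => ?_
    refine Realizes.mono (((hp x).2 ang).seq fun y hy => by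
      subst hy
      exact Realizes.eq x.hd x.tl) ?_
      fun _ => id
    have := x.size_hd_le
    simp only [Polynomial.eval_add, Polynomial.eval_mul, Polynomial.eval_one, Polynomial.eval_X,
      Polynomial.eval_ofNat]
    omega
  exact PolyTime.comp h (hf.cons hg)

theorem comp (hP : PolyDec M P) (hf : PolyTime M f) : PolyDec M fun x => P (f x) :=
  PolyTime.comp hP hf

theorem and (hP : PolyDec M P) (hQ : PolyDec M Q) : PolyDec M fun x => P x ∧ Q x := by
  classical
  have h := PolyTime.ite hP hQ (PolyTime.const (M := M) .nil)
  unfold PolyDec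
  convert h using 2 with x
  by_cases h1 : P x <;> by_cases h2 : Q x <;> simp [h1, h2, Data.ofBool]

theorem not (hP : PolyDec M P) : PolyDec M fun x => ¬ P x := by
  classical
  have h := PolyTime.ite hP (PolyTime.const (M := M) .nil)
    (PolyTime.const (M := M) (.cons .nil .nil))
  unfold PolyDec
  convert h using 2 with x
  by_cases h1 : P x <;> simp [h1, Data.ofBool]

theorem or (hP : PolyDec M P) (hQ : PolyDec M Q) : PolyDec M fun x => P x ∨ Q x :=
  (hP.not.and hQ.not).not.congr fun x => by tauto

theorem imp (hP : PolyDec M P) (hQ : PolyDec M Q) : PolyDec M fun x => P x → Q x :=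
  (hP.and hQ.not).not.congr fun x => by tauto

/-- A fold whose accumulator is a flag of bounded size. The context `x` is handed to `P` together
with the entry, so bounded quantifiers can be nested. -/
theorem exists_mem {P : Data → Data → Prop} (hf : PolyTime M f)
    (hP : PolyDec M fun z => P z.hd z.tl) :
    PolyDec M fun x => ∃ y ∈ (f x).toList, P y x := by
  classical
  have hstep : PolyTime M fun z => if P z.hd z.tl.tl then Data.cons .nil .nil else z.tl.hd :=
    PolyTime.ite (hP.comp (f := fun z => Data.cons z.hd z.tl.tl) (by fun_prop)) (by fun_prop)
      (by fun_prop)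
  have h := PolyTime.foldl (step := fun y acc x => if P y x then Data.cons .nil .nil else acc)
    hstep hf (PolyTime.const .nil) ⟨3, fun y acc x => ?_⟩
  · unfold PolyDec
    convert h using 2 with x
    have key : ∀ (l : List Data) (a : Data), l.foldl
        (fun acc y => if P y x then Data.cons .nil .nil else acc) a =
        if ∃ y ∈ l, P y x then Data.cons .nil .nil else a := by
      intro l
      induction l with
      | nil => simp
      | cons y l ih =>
        intro a
        rw [List.foldl_cons, ih]
        by_cases h1 : P y x <;> simp [h1]
    rw [key]
    by_cases h1 : ∃ y ∈ (f x).toList, P y x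
    · simp only [h1, if_true, decide_true, Data.ofBool]
    · simp only [h1, if_false, decide_false, Data.ofBool]
  · split_ifs <;> simp [Data.size]

theorem forall_mem {P : Data → Data → Prop} (hf : PolyTime M f)
    (hP : PolyDec M fun z => P z.hd z.tl) :
    PolyDec M fun x => ∀ y ∈ (f x).toList, P y x :=
  (exists_mem (P := fun y x => ¬ P y x) hf hP.not).not.congr fun x => by
    simp

theorem mem (hf : PolyTime M f) (hg : PolyTime M g) : PolyDec M fun x => f x ∈ (g x).toList :=
  (exists_mem (P := fun y x => y = f x) hg (eq (by fun_prop) (by fun_prop))).congr fun x => by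
    simp

theorem forall_finset {α : Type*} (s : Finset α) {P : α → Data → Prop}
    (h : ∀ a ∈ s, PolyDec M (P a)) : PolyDec M fun x => ∀ a ∈ s, P a x := by
  classical
  induction s using Finset.induction_on with
  | empty => exact (const True).congr (by simp)
  | insert a s _ ih =>
    simp only [Finset.mem_insert, forall_eq_or_imp] at h ⊢
    exact h.1.and (ih h.2)

end PolyDec

/-! ### Polynomial-time operations on lists. -/

namespace PolyTime

variable {M : ℕ} {f g : Data → Data}

theorem reverse (hf : PolyTime M f) : PolyTime M fun x => Data.ofL (f x).toList.reverse := by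
  have h := foldl (M := M) (step := fun y acc _ => .cons y acc) (by fun_prop) hf
    (const .nil) ⟨Polynomial.X + 1, fun y acc x => by simp [Data.size]; omega⟩
  convert h using 2 with x
  have key : ∀ (l : List Data) (a : Data), l.foldl (fun acc y => Data.cons y acc) a =
      Data.ofL (l.reverse ++ a.toList) := by
    intro l
    induction l with
    | nil => simp
    | cons y l ih => intro a; rw [List.foldl_cons, ih]; simp [Data.toList]
  rw [key]
  simp [Data.toList]

theorem append (hf : PolyTime M f) (hg : PolyTime M g) :
    PolyTime M fun x => Data.ofL ((f x).toList ++ (g x).toList) := by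
  have h := foldl (M := M) (step := fun y acc _ => .cons y acc) (by fun_prop) hf.reverse
    hg ⟨Polynomial.X + 1, fun y acc x => by simp [Data.size]; omega⟩
  convert h using 2 with x
  have key : ∀ (l : List Data) (a : Data), l.reverse.foldl (fun acc y => Data.cons y acc) a =
      Data.ofL (l ++ a.toList) := by
    intro l a
    rw [List.foldl_reverse]
    induction l with
    | nil => simp
    | cons y l ih => simp [ih, Data.ofL, Data.ofList]
  simp [key]

theorem flatMap {G : Data → Data → Data} (hf : PolyTime M f)
    (hG : PolyTime M fun z => G z.hd z.tl) :
    PolyTime M fun x => Data.ofL ((f x).toList.flatMap fun y => (G y x).toList) := by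
  have hG' : PolyTime M fun z => G z.hd z.tl.tl :=
    comp (f := fun z => G z.hd z.tl) hG (g := fun z => .cons z.hd z.tl.tl) (by fun_prop)
  have h := foldl (M := M)
    (step := fun y acc x => Data.ofL (acc.toList ++ (G y x).toList))
    (append (f := fun z => z.tl.hd) (by fun_prop) hG') hf
    (const .nil) ?_
  · convert h using 2 with x
    have key : ∀ (l : List Data) (a : Data), l.foldl
        (fun acc y => Data.ofL (acc.toList ++ (G y x).toList)) a =
        Data.ofL (a.toList ++ l.flatMap fun y => (G y x).toList) := by
      intro l
      induction l with
      | nil => simp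
      | cons y l ih => intro a; rw [List.foldl_cons, ih]; simp
    rw [key]
    simp [Data.toList]
  · obtain ⟨_, p, hp⟩ := hG
    refine ⟨p.comp (Polynomial.X + 1), fun y acc x => ?_⟩
    have h1 := Data.size_ofL_append acc.toList (G y x).toList
    have h2 := (hp (.cons y x)).1
    simp only [Data.ofL_toList, Data.hd, Data.tl, Data.size] at h1 h2
    simp only [Polynomial.eval_comp, Polynomial.eval_add, Polynomial.eval_X, Polynomial.eval_one]
    omega

theorem map {G : Data → Data → Data} (hf : PolyTime M f) (hG : PolyTime M fun z => G z.hd z.tl) :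
    PolyTime M fun x => Data.ofL ((f x).toList.map fun y => G y x) := by
  have h := flatMap (G := fun y x => .cons (G y x) .nil) hf (hG.cons (const .nil))
  convert h using 2 with x
  simp [Data.toList, List.map_eq_flatMap]

open Classical in
theorem filter {P : Data → Data → Prop} (hf : PolyTime M f) (hP : PolyDec M fun z => P z.hd z.tl) :
    PolyTime M fun x => Data.ofL ((f x).toList.filter fun y => P y x) := by
  have h := flatMap (G := fun y x => if P y x then .cons y .nil else .nil) hf
    (ite hP (by fun_prop) (by fun_prop))
  convert h using 2 with x
  congr 1
  induction (f x).toList with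
  | nil => rfl
  | cons y l ih => by_cases h1 : P y x <;> simp [h1, ih, Data.toList]

end PolyTime

/-! ## Exponential time -/

/-- The function is bounded by `2 ^ p n` for some polynomial `p`. -/
def ExpBounded (f : ℕ → ℕ) : Prop := ∃ p : Polynomial ℕ, ∀ n, f n ≤ 2 ^ p.eval n

namespace ExpBounded

variable {f g : ℕ → ℕ}

theorem two_pow (p : Polynomial ℕ) : ExpBounded fun n => 2 ^ p.eval n := ⟨p, fun _ => le_rfl⟩

theorem mono (hg : ExpBounded g) (h : ∀ n, f n ≤ g n) : ExpBounded f :=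
  hg.imp fun _ hp n => (h n).trans (hp n)

theorem poly (p : Polynomial ℕ) : ExpBounded fun n => p.eval n :=
  ⟨p, fun _ => Nat.lt_two_pow_self.le⟩

theorem const (k : ℕ) : ExpBounded fun _ => k := (poly (Polynomial.C k)).mono fun n => by simp

theorem mul (hf : ExpBounded f) (hg : ExpBounded g) : ExpBounded fun n => f n * g n := by
  obtain ⟨p, hp⟩ := hf
  obtain ⟨q, hq⟩ := hg
  refine ⟨p + q, fun n => ?_⟩
  rw [Polynomial.eval_add, pow_add]
  exact Nat.mul_le_mul (hp n) (hq n)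

theorem add (hf : ExpBounded f) (hg : ExpBounded g) : ExpBounded fun n => f n + g n := by
  obtain ⟨p, hp⟩ := hf
  obtain ⟨q, hq⟩ := hg
  -- Both summands are at most `2 ^ (p + q)`; the extra `1` in the exponent pays for adding them.
  refine ⟨p + q + 1, fun n => ?_⟩
  have h1 := hp n
  have h2 := hq n
  have h3 : 2 ^ p.eval n ≤ 2 ^ (p.eval n + q.eval n) := Nat.pow_le_pow_right (by omega) (by omega)
  have h4 : 2 ^ q.eval n ≤ 2 ^ (p.eval n + q.eval n) := Nat.pow_le_pow_right (by omega) (by omega)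
  rw [Polynomial.eval_add, Polynomial.eval_add, Polynomial.eval_one, pow_succ]
  change f n + g n ≤ _
  omega

/-- Exponential bounds are closed under sums and products, hence under polynomials. This is why
polynomial-time processing of exponentially large data is affordable. -/
theorem comp (p : Polynomial ℕ) (hf : ExpBounded f) : ExpBounded fun n => p.eval (f n) := by
  induction p using Polynomial.induction_on' with
  | add p q hp hq => exact (hp.add hq).mono fun n => by simp
  | monomial k a =>
    suffices h : ExpBounded fun n => f n ^ k by
      exact ((const a).mul h).mono fun n => by simp [Polynomial.eval_monomial]
    induction k with
    | zero => exact (const 1).mono fun n => by simp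
    | succ k ih => exact (ih.mul hf).mono fun n => by simp [pow_succ]

end ExpBounded

/-! ### The list of all sublists. -/

/-- The list of all sublists of (the reverse of) a list. -/
def powList (d : Data) : Data :=
  d.toList.foldl (fun acc y => Data.ofL (acc.toList ++ acc.toList.map (Data.cons y)))
    (Data.ofL [.nil])

/-- Each round keeps the sublists found so far and adds those with `y` in front. Entries met later
stand further left, whence the reversal. -/
theorem mem_powList {d e : Data} : e ∈ (powList d).toList ↔ e.toList.Sublist d.toList.reverse := by
  have key : ∀ (l : List Data) (a : Data) (m : List Data),
      (∀ e, e ∈ a.toList ↔ e.toList.Sublist m) →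
      (e ∈ (l.foldl (fun acc y => Data.ofL (acc.toList ++ acc.toList.map (Data.cons y))) a).toList ↔
        e.toList.Sublist (l.reverse ++ m)) := by
    intro l
    induction l with
    | nil => intro a m h; simpa using h e
    | cons y l ih =>
      intro a m h
      rw [List.foldl_cons, ih _ (y :: m)]
      · simp
      · intro e
        rw [List.sublist_cons_iff]
        simp only [Data.toList_ofList, List.map_id, List.mem_append, List.mem_map, h]
        refine or_congr Iff.rfl ⟨?_, ?_⟩
        · rintro ⟨b, hb, rfl⟩
          exact ⟨_, rfl, hb⟩
        · rintro ⟨r, hr, hrm⟩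
          cases e with
          | nil => simp [Data.toList] at hr
          | cons a b =>
            simp only [Data.toList, List.cons.injEq] at hr
            exact ⟨b, hr.2 ▸ hrm, by rw [hr.1]⟩
  rw [powList, key _ _ []]
  · simp
  · intro e
    cases e <;> simp [Data.toList, Data.ofList]

/-- A round doubles the number of sublists and puts a copy of `y` into each new one. The growth is
by a factor, not a summand, so `PolyTime.foldl` does not apply to `powList`. -/
theorem size_powStep_le (y : Data) (l : List Data) :
    (Data.ofL (l ++ l.map (Data.cons y))).size ≤ (Data.ofL l).size * (y.size + 3) := by
  have h : (Data.ofL (l.map (Data.cons y))).size ≤ (Data.ofL l).size * (y.size + 2) := by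
    induction l with
    | nil => simp [Data.ofList, Data.size]
    | cons a l ih =>
      simp only [Data.ofL, List.map_cons, Data.ofList, id, Data.size, Nat.add_mul] at ih ⊢
      have : a.size ≤ a.size * (y.size + 2) := Nat.le_mul_of_pos_right _ (by omega)
      omega
  have h1 := Data.size_ofL_append l (l.map (Data.cons y))
  have h2 : (Data.ofL l).size * (y.size + 3) =
    (Data.ofL l).size * (y.size + 2) + (Data.ofL l).size := by ring
  omega

theorem realizes_powList (M : ℕ) : ∃ (c : Prog) (b : ℕ → ℕ), Monotone b ∧ ExpBounded b ∧
    ∀ x, (powList x).size ≤ b x.size ∧ ∀ ang, Realizes M ang c x (b x.size) (· = powList x) := by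
  have hstep : PolyTime M fun z =>
      Data.ofL (z.tl.hd.toList ++ (Data.ofL (z.tl.hd.toList.map (Data.cons z.hd))).toList) :=
    PolyTime.append (by fun_prop)
      (PolyTime.map (f := fun z => z.tl.hd) (G := fun y z => .cons z.hd y) (by fun_prop)
        (by fun_prop))
  obtain ⟨c, p, hp⟩ := hstep
  obtain ⟨c₀, p₀, hp₀⟩ : PolyTime M fun x =>
      Data.cons (Data.cons (Data.ofL [.nil]) x) .nil := by fun_prop
  -- At most `s` rounds multiply the size by at most `s + 3 ≤ 2 ^ (s + 3)` each, and the initial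
  -- list has size `3 ≤ 2 ^ 2`.
  let B : ℕ → ℕ := fun s => 2 ^ ((Polynomial.X + 3) * Polynomial.X + 2 : Polynomial ℕ).eval s
  let b : ℕ → ℕ := fun s =>
    p₀.eval s + (s * (p.eval (B s + (s + 3)) + 9) + 3) + 1 + B s
  have hB : Monotone B := fun m n h =>
    Nat.pow_le_pow_right (by omega) (polynomial_eval_mono _ h)
  have key : ∀ ang x, Realizes M ang (Realizes.foldProg M c)
      (.cons (.cons (Data.ofL [.nil]) x) .nil)
      (x.toList.length * (p.eval (B x.size + (x.size + 3)) + 9) + 3)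
      fun r => r = powList x ∧ r.size ≤ B x.size := by
    intro ang x
    -- The second clause of the invariant reserves in advance the factors of all rounds to come.
    refine Realizes.mono (Realizes.fold (fun r acc =>
      r.foldl (fun acc y => Data.ofL (acc.toList ++ acc.toList.map (Data.cons y))) acc =
        powList x ∧
      acc.size * 2 ^ ((x.size + 3) * r.length) ≤ B x.size ∧ ∀ y ∈ r, y.size ≤ x.size)
      ?_ ⟨rfl, ?_, ?_⟩) le_rfl ?_
    · rintro y r acc ⟨h1, h2, h3⟩
      have hy := h3 y (List.mem_cons_self ..)
      have hacc : acc.size ≤ B x.size :=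
        le_trans (Nat.le_mul_of_pos_right _ (by positivity)) h2
      refine ((hp (.cons y (.cons acc .nil))).2 ang).mono ?_ ?_
      · refine polynomial_eval_mono p ?_
        simp only [Data.size]
        omega
      · rintro _ rfl
        simp only [Data.hd, Data.tl, Data.toList_ofList, List.map_id]
        refine ⟨h1, le_trans ?_ h2, fun z hz => h3 z (List.mem_cons_of_mem _ hz)⟩
        have h4 := size_powStep_le y acc.toList
        rw [Data.ofL_toList] at h4
        have h5 : y.size + 3 ≤ 2 ^ (x.size + 3) :=
          le_trans (by omega) (Nat.lt_two_pow_self (n := x.size + 3)).le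
        calc _ ≤ (acc.size * 2 ^ (x.size + 3)) * 2 ^ ((x.size + 3) * r.length) :=
              Nat.mul_le_mul_right _ (h4.trans (Nat.mul_le_mul_left _ h5))
          _ = _ := by rw [List.length_cons, mul_assoc, ← pow_add]; ring_nf
    · have h1 := (Data.length_toList_le x).le
      have h2 : 2 ^ ((x.size + 3) * x.toList.length) ≤ 2 ^ ((x.size + 3) * x.size) :=
        Nat.pow_le_pow_right (by omega) (Nat.mul_le_mul_left _ h1)
      simp only [B, Polynomial.eval_add, Polynomial.eval_mul, Polynomial.eval_X,
        Polynomial.eval_ofNat, Data.ofL, Data.ofList, id, Data.size]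
      rw [pow_add]
      omega
    · exact fun y hy => (Data.size_lt_of_mem_toList hy).le
    · rintro r ⟨h1, h2, -⟩
      exact ⟨h1, by simpa using h2⟩
  refine ⟨.seq c₀ (Realizes.foldProg M c), b, ?_, ?_, fun x => ⟨?_, fun ang => ?_⟩⟩
  · intro m n h
    have h1 := polynomial_eval_mono p₀ h
    have h2 := polynomial_eval_mono p (a := B m + (m + 3)) (b := B n + (n + 3))
      (by have := hB h; omega)
    have h3 := Nat.mul_le_mul h (Nat.add_le_add_right h2 9)
    have h4 := hB h
    simp only [b] at h1 h2 h3 ⊢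
    omega
  · have hX : ExpBounded fun s => s := (ExpBounded.poly Polynomial.X).mono fun n => by simp
    have hB' : ExpBounded B := ExpBounded.two_pow _
    exact ((((ExpBounded.poly p₀).add ((hX.mul ((ExpBounded.comp p
      (hB'.add (hX.add (.const 3)))).add (.const 9))).add (.const 3))).add (.const 1)).add hB')
  · obtain ⟨m, s', -, h⟩ := (key true x (fun _ => _) rfl).exists_of_true
    rw [← h.1.1]
    exact h.1.2.trans (Nat.le_add_left _ _)
  · refine Realizes.mono (((hp₀ x).2 ang).seq (Q := fun r => r = _ ∧ r.size ≤ _) fun y hy => by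
      subst hy
      exact key ang x) ?_ fun _ h => h.1
    have h1 := Nat.mul_le_mul_right (p.eval (B x.size + (x.size + 3)) + 9)
      (Data.length_toList_le x).le
    simp only [b]
    omega


/-! ## Calling a nondeterministic decision procedure -/

/-- Set the variables below `M` (and variable `0`) to `nil`. -/
def clearProg : ℕ → Prog
  | 0 => .assign 0 .nil
  | n + 1 => .seq (clearProg n) (.assign n .nil)

theorem runs_clearProg {ang : Bool} {n m : ℕ} {k : List Prog} {s : Store} {Q : Store → Prop}
    (h : ∀ s', (∀ i < n, s' i = .nil) → (∀ i, n ≤ i → i ≠ 0 → s' i = s i) → Runs ang m k s' Q) :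
    Runs ang (2 * n + 1 + m) (clearProg n :: k) s Q := by
  induction n generalizing m k with
  | zero =>
    refine Runs.mono_time (n := m + 1) (.assign (h _ (by simp) fun i _ hi => ?_)) (by omega)
    exact Function.update_of_ne hi _ _
  | succ n ih =>
    refine Runs.mono_time (n := 2 * n + 1 + (m + 1) + 1) (.seq (ih fun s' h1 h2 => .assign ?_))
      (by omega)
    refine h _ (fun i hi => ?_) fun i hi h0 => ?_
    · rcases Nat.lt_succ_iff_lt_or_eq.1 hi with hi | rfl
      · rw [Function.update_of_ne (by omega), h1 i hi]
      · simp [Expr.eval]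
    · rw [Function.update_of_ne (by omega), h2 i (by omega) h0]

/-- Run `c` on the content of variable `M`. The result is `nil` if `c` does not accept, and
otherwise the pair of the input and the output of `c`. -/
def callProg (M : ℕ) (c : Prog) : Prog :=
  .seq (clearProg M) (.seq (.assign 0 (.var M)) (.seq c
    (.ite (.var 1) (.assign M (.cons (.var M) (.var 0))) (.assign M .nil))))

-- `M` exceeds all variables of the given procedure, so its call leaves the value and the stack
-- intact. Every halting computation either accepts, and then its output is the truth value of `P
-- a`, or rejects; a rejection is recorded as `nil`, which no regular result equals. In mode `true`
-- an accepting computation is followed.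
open Classical in
theorem exists_callProg {α : Type*} {enc : α → Data} {P : α → Prop}
    (h : SolvableInNExpTime (fun (a : α) t => t = enc a) (fun (b : Bool) t => t = Data.ofBool b)
      (fun a b => b = true ↔ P a)) :
    ∃ (M : ℕ) (c : Prog) (b : ℕ → ℕ), 2 ≤ M ∧ Monotone b ∧ ExpBounded b ∧ ∀ ang a,
      Realizes M ang c (enc a) (b (enc a).size)
        fun r => r = .cons (enc a) (Data.ofBool (P a)) ∨ ang = false ∧ r = .nil := by
  obtain ⟨c, p, h⟩ := h
  obtain ⟨M₀, hM₀⟩ := c.exists_varsBelow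
  obtain ⟨M, hM, hc⟩ : ∃ M, 2 ≤ M ∧ c.VarsBelow M :=
    ⟨max 2 M₀, le_max_left _ _, hM₀.mono (le_max_right _ _)⟩
  have key : ∀ ang a, Runs ang (2 ^ p.eval (enc a).size) [c] (initConfig c (enc a)).2 fun s =>
      (s 1 ≠ .nil ∧ s 0 = Data.ofBool (P a)) ∨ (ang = false ∧ s 1 = .nil) := by
    intro ang a
    obtain ⟨h1, ⟨y, n, s, hs, hs1, hs0⟩, h3⟩ := h a _ rfl
    -- Although several computations may accept, the specification leaves only one possible output.
    have h4 : ∀ y, AcceptsWith c (enc a) y → y = Data.ofBool (P a) := by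
      intro y hy
      obtain ⟨b, rfl, hb⟩ := h3 y hy
      cases b <;> simp_all
    cases ang
    · refine Runs.false_iff.2 ⟨fun m b hb => h1 m b hb, fun m s' hs' => ?_⟩
      by_cases h5 : s' 1 = .nil
      · exact .inr ⟨rfl, h5⟩
      · exact .inl ⟨h5, h4 _ ⟨m, s', hs', h5, rfl⟩⟩
    · refine (Runs.true_of_reachesIn hs (.inl ⟨hs1, ?_⟩)).mono_time (h1 n _ hs)
      exact h4 _ ⟨n, s, hs, hs1, rfl⟩
  refine ⟨M, callProg M c, fun n => 2 * M + 1 + (2 ^ p.eval n + 7), hM, fun m n hmn => ?_, ?_,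
    fun ang a s hs => ?_⟩
  · have := Nat.pow_le_pow_right (n := 2) (by omega) (polynomial_eval_mono p hmn)
    simp only at this ⊢
    omega
  · exact (ExpBounded.const _).add ((ExpBounded.two_pow p).add (.const 7))
  · refine Runs.mono_time (n := (2 * M + 1 + ((2 ^ p.eval (enc a).size + 3) + 2 + 1)) + 1)
      (.seq (runs_clearProg fun s₁ h₁ h₁' => .seq (.assign ?_))) (by dsimp only; omega)
    refine .seq ?_
    have hsM : s₁ M = enc a := by rw [h₁' M le_rfl (by omega), hs]
    -- Below `M` the store now agrees with the start configuration; from `M` on it may differ, but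
    -- `c` neither reads nor changes it there.
    have hrun := (key ang a).congr (M := M) (r := Function.update s₁ 0 (s₁ M)) (by simpa using hc)
      (fun i hi => by
        by_cases h0 : i = 0
        · simp [initConfig, h0, hsM]
        · simp [initConfig, h0, h₁ i hi])
    refine Runs.mono_time (Runs.append (m := 2) hrun (R := fun s' => (_ ∨ _) ∧ _) ?_) (by omega)
    rintro t ⟨s', hs', hlt, hge⟩
    have htM : t M = enc a := by
      rw [hge M le_rfl, Function.update_of_ne (by omega), hsM]
    have htM' : t (M + 1) = s (M + 1) := by
      rw [hge _ (by omega), Function.update_of_ne (by omega), h₁' _ (by omega) (by omega)]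
    rw [hlt 0 (by omega), hlt 1 (by omega)] at hs'
    rcases hs' with ⟨h1, h0⟩ | ⟨rfl, h1⟩
    · refine .ite_true h1 (.assign (Runs.nil_iff.2 ⟨.inl ?_, ?_⟩))
      · simp [Expr.eval, htM, h0]
      · simp [htM']
    · refine .ite_false h1 (.assign (Runs.nil_iff.2 ⟨.inr ⟨rfl, ?_⟩, ?_⟩))
      · simp [Expr.eval]
      · simp [htM']

open Classical in
/-- The entry for `a` in a table of the truth values of `P`. -/
noncomputable def tableEntry {α : Type*} (enc : α → Data) (P : α → Prop) (a : α) : Data :=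
  .cons (enc a) (Data.ofBool (P a))

/-- New entries are prepended, so the table comes out reversed. An entry `nil` shows that some call
rejected, which can happen in mode `false` only. The component `x` carries the data needed after the
table is complete. -/
theorem exists_tableProg {α : Type*} {enc : α → Data} {P : α → Prop}
    (h : SolvableInNExpTime (fun (a : α) t => t = enc a) (fun (b : Bool) t => t = Data.ofBool b)
      (fun a b => b = true ↔ P a)) :
    ∃ (M : ℕ) (c : Prog) (b : ℕ → ℕ), 2 ≤ M ∧ Monotone b ∧ ExpBounded b ∧
      ∀ ang (l x : Data) (as : List α), l.toList = as.map enc →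
      Realizes M ang c (.cons l x) (b (Data.cons l x).size) fun r => ∃ tab, r = .cons tab x ∧
        tab.size ≤ 5 * (Data.cons l x).size ∧
        (tab.toList = as.reverse.map (tableEntry enc P) ∨ ang = false ∧ .nil ∈ tab.toList) := by
  obtain ⟨M, c, b, hM, hb, hb', hc⟩ := exists_callProg h
  obtain ⟨c₀, p₀, hp₀⟩ : PolyTime M fun z => Data.cons (.cons .nil z.hd) z.tl := by fun_prop
  obtain ⟨c₁, p₁, hp₁⟩ : PolyTime M fun z => z.hd := by fun_prop
  obtain ⟨c₂, p₂, hp₂⟩ : PolyTime M fun z => z.tl.hd := by fun_prop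
  obtain ⟨c₃, p₃, hp₃⟩ : PolyTime M fun z => z.tl := by fun_prop
  let c' := Realizes.pairProg M (.seq c₁ c) c₂
  let B : Polynomial ℕ := 8 * Polynomial.X + 2
  let S : ℕ → ℕ := fun s => p₁.eval (B.eval s) + b s + 1 + p₂.eval (B.eval s) + 13
  let T : ℕ → ℕ := fun s => p₀.eval s + (s * (S s + 9) + 3) + 1 + p₃.eval s + 13
  have hS : Monotone S := fun m n hmn => by
    have h0 := polynomial_eval_mono B hmn
    have h1 := polynomial_eval_mono p₁ h0
    have h2 := polynomial_eval_mono p₂ h0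
    have h3 := hb hmn
    simp only [S] at h1 h2 h3 ⊢
    omega
  have hS' : ExpBounded S := by
    refine (((((ExpBounded.poly (p₁.comp B)).add hb').add (.const 1)).add
      (.poly (p₂.comp B))).add (.const 13)).mono fun n => ?_
    simp [S]
  refine ⟨M, Realizes.pairProg M (.seq c₀ (Realizes.foldProg M c')) c₃, T, hM, fun m n hmn => ?_,
    ?_, fun ang l x as has => ?_⟩
  · have h1 := polynomial_eval_mono p₀ hmn
    have h2 := polynomial_eval_mono p₃ hmn
    have h3 := Nat.mul_le_mul hmn (Nat.add_le_add_right (hS hmn) 9)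
    simp only [T] at h1 h2 h3 ⊢
    omega
  · have hX : ExpBounded fun s => s := (ExpBounded.poly Polynomial.X).mono fun n => by simp
    exact (((((ExpBounded.poly p₀).add ((hX.mul (hS'.add (.const 9))).add (.const 3))).add
      (.const 1)).add (.poly p₃)).add (.const 13))
  · set N := (Data.cons l x).size with hN
    have key : Realizes M ang (Realizes.foldProg M c') (.cons (.cons .nil l) x)
        (l.toList.length * (S N + 9) + 3) fun tab => tab.size ≤ 5 * l.size ∧
          (tab.toList = as.reverse.map (tableEntry enc P) ∨ ang = false ∧ .nil ∈ tab.toList) := by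
      -- An instance of size `s` takes up `s + 1` in the list, and its answer at most `s + 5 ≤ 5 *
      -- (s + 1)` in the table; hence the weight `5`.
      refine Realizes.mono (Realizes.fold (fun r acc => ∃ as₁ as₂, as = as₁ ++ as₂ ∧
        r = as₂.map enc ∧ acc.size + 5 * (Data.ofL r).size ≤ 5 * l.size + 5 ∧
        (Data.ofL r).size ≤ l.size ∧
        (acc.toList = as₁.reverse.map (tableEntry enc P) ∨ ang = false ∧ .nil ∈ acc.toList))
        ?_ ⟨[], as, rfl, has, ?_, ?_, .inl rfl⟩) le_rfl ?_
      · rintro y r acc ⟨as₁, _ | ⟨a, as₂⟩, rfl, hr, h1, h2, h3⟩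
        · simp at hr
        simp only [List.map_cons, List.cons.injEq] at hr
        obtain ⟨rfl, rfl⟩ := hr
        simp only [Data.ofL, Data.ofList, Data.size, id] at h1 h2
        have hl : l.size ≤ N := by simp only [hN, Data.size]; omega
        have hy := (enc a).size_pos
        have hz : (Data.cons (enc a) (.cons acc x)).size ≤ B.eval N := by
          simp only [B, Polynomial.eval_add, Polynomial.eval_mul, Polynomial.eval_X,
            Polynomial.eval_ofNat, hN, Data.size] at hl ⊢
          omega
        have hseq : Realizes M ang (.seq c₁ c) (.cons (enc a) (.cons acc x))
            (p₁.eval (B.eval N) + b N + 1) fun r =>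
            r = tableEntry enc P a ∨ ang = false ∧ r = .nil := by
          refine (((hp₁ _).2 ang).mono (polynomial_eval_mono p₁ hz) fun _ => id).seq ?_
          rintro _ rfl
          exact (hc ang a).mono (hb (by omega)) fun _ => id
        refine Realizes.mono (hseq.pair
          (((hp₂ _).2 ang).mono (polynomial_eval_mono p₂ hz) fun _ => id)) le_rfl ?_
        rintro _ ⟨e, acc', he, hacc, rfl⟩
        obtain rfl : acc = acc' := hacc.symm
        have hes : e.size ≤ (enc a).size + 4 := by
          rcases he with rfl | ⟨-, rfl⟩
          · have := Data.size_ofBool_le (@decide (P a) (Classical.propDecidable _))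
            simp only [tableEntry, Data.size]
            omega
          · simp only [Data.size]; omega
        refine ⟨as₁ ++ [a], as₂, by simp, rfl, ?_, ?_, ?_⟩
        · simp only [Data.ofL, Data.size] at h1 ⊢
          omega
        · exact le_trans (by simp only [Data.ofL]; omega) h2
        · simp only [Data.toList, List.reverse_append, List.reverse_cons,
            List.reverse_nil, List.nil_append, List.singleton_append, List.map_cons, List.mem_cons]
          rcases he with rfl | ⟨h4, rfl⟩
          · rcases h3 with h3 | ⟨h4, h3⟩
            · exact .inl (by rw [h3])
            · exact .inr ⟨h4, .inr h3⟩
          · exact .inr ⟨h4, .inl rfl⟩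
      · simp only [Data.ofL_toList, Data.size]; omega
      · simp
      · rintro r ⟨as₁, as₂, rfl, h1, h2, -, h3⟩
        have : as₂ = [] := by simpa using h1.symm
        subst this
        refine ⟨?_, by simpa using h3⟩
        simp only [Data.ofL, Data.ofList, Data.size] at h2
        omega
    refine Realizes.mono (Realizes.pair (((hp₀ _).2 ang).seq fun y hy => by
      subst hy; exact key) ((hp₃ _).2 ang)) ?_ ?_
    · have h1 : l.toList.length * (S N + 9) ≤ N * (S N + 9) := Nat.mul_le_mul_right _ (by
        have := Data.length_toList_le l
        simp only [hN, Data.size]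
        omega)
      simp only [T, ← hN]
      omega
    · rintro _ ⟨tab, _, ⟨h1, h2⟩, rfl, rfl⟩
      refine ⟨tab, rfl, ?_, h2⟩
      simp only [hN, Data.size]
      omega

/-- Brute force: a search problem is solvable in nondeterministic exponential time if its solutions
can be computed in polynomial time from the list of all sublists of a list computed from the
instance, and a table of values of a predicate that can be decided in nondeterministic exponential
time. -/
theorem solvableInNExpTime_of_powList {α β γ : Type*} {enc : α → Data} {P : α → Prop}
    (h : SolvableInNExpTime (fun (a : α) t => t = enc a) (fun (b : Bool) t => t = Data.ofBool b)
      (fun a b => b = true ↔ P a))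
    {encIn : β → Data → Prop} {encOut : γ → Data → Prop} {R : β → γ → Prop}
    {pre items post : Data → Data} (hpre : ∀ M, PolyTime M pre) (hitems : ∀ M, PolyTime M items)
    (hpost : ∀ M, PolyTime M post)
    (hR : ∀ b t, encIn b t → ∃ as : List α, (pre t).toList = as.map enc ∧
      ∀ tab : Data, tab.toList = as.reverse.map (tableEntry enc P) →
        ∃ g, encOut g (post (.cons (powList (items t)) tab)) ∧ R b g) :
    SolvableInNExpTime encIn encOut R := by
  classical
  obtain ⟨M, c, b, hM, hb, hb', hc⟩ := exists_tableProg h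
  obtain ⟨c₁, p₁, hp₁⟩ : PolyTime M fun t => Data.cons (pre t) (items t) :=
    (hpre M).cons (hitems M)
  obtain ⟨c₂, b₂, hb₂, hb₂', hc₂⟩ := realizes_powList M
  obtain ⟨d, q, hq⟩ : PolyTime M fun z => z.tl := by fun_prop
  obtain ⟨d', q', hq'⟩ : PolyTime M fun z => z.hd := by fun_prop
  -- Regular table entries are pairs, so `nil` detects a rejected call. The head of the result
  -- becomes the acceptance flag and its tail the output.
  obtain ⟨c₃, p₃, hp₃⟩ := PolyTime.ite (M := M) (P := fun z => Data.nil ∈ z.tl.toList)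
    (f := fun _ => .nil) (g := fun z => .cons (.cons .nil .nil) (post z))
    (.mem (.const _) (by fun_prop)) (.const _) ((PolyTime.const _).cons (hpost M))
  -- The table has at most five times the size of the data before the calls, the items at most their
  -- size, and one vertex joins the two.
  let N : Polynomial ℕ := 6 * p₁ + 1
  let U : ℕ → ℕ := fun s => b₂ (N.eval s) + (5 * p₁.eval s) + 1
  have hU : ExpBounded U := by
    obtain ⟨p, hp⟩ := hb₂'
    exact (((ExpBounded.two_pow (p.comp N)).mono fun n => (hp _).trans
      (by rw [Polynomial.eval_comp])).add
      ((ExpBounded.poly (5 * p₁)).mono fun n => by simp)).add (.const 1)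
  let T : ℕ → ℕ := fun s => p₁.eval s + (b (p₁.eval s) +
    ((q.eval (N.eval s) + b₂ (N.eval s) + 1 + q'.eval (N.eval s) + 13) + p₃.eval (U s) + 1) + 1) + 1
  have hT : ExpBounded T := by
    obtain ⟨p, hp⟩ := hb'
    obtain ⟨p', hp'⟩ := hb₂'
    have e1 : ExpBounded fun n => b (p₁.eval n) := (ExpBounded.two_pow (p.comp p₁)).mono fun n =>
      (hp _).trans (by rw [Polynomial.eval_comp])
    have e2 : ExpBounded fun n => b₂ (N.eval n) := (ExpBounded.two_pow (p'.comp N)).mono fun n =>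
      (hp' _).trans (by rw [Polynomial.eval_comp])
    have e3 : ExpBounded fun n => q.eval (N.eval n) :=
      (ExpBounded.poly (q.comp N)).mono fun n => by rw [Polynomial.eval_comp]
    have e4 : ExpBounded fun n => q'.eval (N.eval n) :=
      (ExpBounded.poly (q'.comp N)).mono fun n => by rw [Polynomial.eval_comp]
    exact ((ExpBounded.poly p₁).add ((e1.add ((((((e3.add e2).add (.const 1)).add e4).add
      (.const 13)).add (ExpBounded.comp p₃ hU)).add (.const 1))).add (.const 1))).add (.const 1)
  -- Moving the input to `M` and the result to variables `0` and `1` costs 6 steps.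
  obtain ⟨p, hp⟩ := hT.add (.const 6)
  let c' : Prog := .seq c₁ (.seq c (.seq (Realizes.pairProg M (.seq d c₂) d') c₃))
  have main : ∀ ang a t, encIn a t → Realizes M ang c' t (T t.size) fun r =>
      (∃ g y, encOut g y ∧ R a g ∧ r = .cons (.cons .nil .nil) y) ∨ ang = false ∧ r = .nil := by
    intro ang a t ht
    obtain ⟨as, has, hRa⟩ := hR a t ht
    refine ((hp₁ t).2 ang).seq ?_
    rintro _ rfl
    have hs := (hp₁ t).1
    refine ((hc ang _ _ as has).mono (hb hs) fun _ => id).seq ?_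
    rintro _ ⟨tab, rfl, htab, hok⟩
    have hN : (Data.cons tab (items t)).size ≤ N.eval t.size := by
      simp only [Data.size, N, Polynomial.eval_add, Polynomial.eval_mul, Polynomial.eval_ofNat,
        Polynomial.eval_one] at hs htab ⊢
      omega
    have hN' : (items t).size ≤ N.eval t.size := by
      simp only [Data.size] at hN
      omega
    have hpair : Realizes M ang (Realizes.pairProg M (.seq d c₂) d') (.cons tab (items t))
        (q.eval (N.eval t.size) + b₂ (N.eval t.size) + 1 + q'.eval (N.eval t.size) + 13)
        (· = .cons (powList (items t)) tab) := by
      refine Realizes.mono (Realizes.pair (Realizes.seq (Q := (· = powList (items t)))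
        (((hq _).2 ang).mono (polynomial_eval_mono q hN) fun _ => id) fun y hy => ?_)
        (((hq' _).2 ang).mono (polynomial_eval_mono q' hN) fun _ => id)) le_rfl ?_
      · subst hy
        exact ((hc₂ _).2 ang).mono (hb₂ hN') fun _ => id
      · rintro _ ⟨_, _, rfl, rfl, rfl⟩
        rfl
    refine hpair.seq ?_
    rintro _ rfl
    refine ((hp₃ _).2 ang).mono (polynomial_eval_mono p₃ ?_) ?_
    · have h1 := (hc₂ (items t)).1.trans (hb₂ hN')
      simp only [Data.size, U] at hs htab ⊢
      omega
    · rintro _ rfl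
      simp only [Data.tl]
      rcases hok with hok | ⟨rfl, hok⟩
      · obtain ⟨g, hg, hg'⟩ := hRa tab hok
        refine .inl ⟨g, _, hg, hg', if_neg ?_⟩
        rw [hok]
        simp [tableEntry]
      · exact .inr ⟨rfl, if_pos hok⟩
  let c'' : Prog := .seq (.assign M (.var 0)) (.seq c' (.seq (.assign 1 (.hd (.var M)))
    (.assign 0 (.tl (.var M)))))
  have main' : ∀ ang a t, encIn a t → Runs ang (2 ^ p.eval t.size)
      [c''] (initConfig c'' t).2 fun s =>
      (s 1 ≠ .nil ∧ ∃ g, encOut g (s 0) ∧ R a g) ∨ ang = false ∧ s 1 = .nil := by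
    intro ang a t ht
    refine Runs.mono_time (n := T t.size + 3 + 3) (.seq (.assign (.seq
      ((main ang a t ht).run (by simp [Expr.eval, initConfig]) fun s' h1 _ =>
        .seq (.assign (.assign (Runs.nil_iff.2 ?_))))))) (hp _)
    have hM0 : M ≠ 0 := by omega
    have hM1 : M ≠ 1 := by omega
    rcases h1 with ⟨g, y, hg, hg', hr⟩ | ⟨rfl, hr⟩
    · left
      simp [Expr.eval, hM1, hr, Data.hd, Data.tl]
      exact ⟨g, hg, hg'⟩
    · right
      simp [Expr.eval, Function.update_apply, hr, Data.hd]
  -- Mode `false` gives the time bound and the correctness of accepting computations. In mode `true`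
  -- the rejecting alternative is impossible, which gives an accepting computation.
  refine ⟨c'', p, fun a t ht => ⟨?_, ?_, fun y hy => ?_⟩⟩
  · exact (Runs.false_iff.1 (main' false a t ht)).1
  · obtain ⟨m, s, hs, hs' | ⟨h, -⟩⟩ := (main' true a t ht).exists_of_true
    · exact ⟨_, m, s, hs, hs'.1, rfl⟩
    · cases h
  · obtain ⟨m, s, hs, hs1, rfl⟩ := hy
    rcases (Runs.false_iff.1 (main' false a t ht)).2 m s hs with h | h
    · exact h.2
    · exact absurd h.2 hs1


/-! ## Property graphs as lists of items -/

theorem Data.ofBool_injective : Function.Injective Data.ofBool := by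
  intro a b h
  cases a <;> cases b <;> first | rfl | cases h

theorem Data.ofList_injective {α : Type*} {f : α → Data} (hf : Function.Injective f) :
    Function.Injective (Data.ofList f) := by
  intro l m h
  have := congrArg Data.toList h
  simp only [Data.toList_ofList] at this
  exact hf.list_map this

theorem encWord_injective : Function.Injective encWord :=
  Data.ofList_injective Data.ofBool_injective

@[simp] theorem encWord_inj {a b : Word} : encWord a = encWord b ↔ a = b :=
  encWord_injective.eq_iff

/-- The constituents of a property graph. -/
inductive Item (V : Type*) : Type _
  | node : Ident → Item V
  | edge : Ident → Ident → Ident → Item V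
  | label : Ident → Label → Item V
  | prop : Ident → Key → V → Item V

namespace Item

variable {V : Type*} {G H K : PropertyGraph V}

/-- The item belongs to the property graph. -/
def Mem (G : PropertyGraph V) : Item V → Prop
  | node o => o ∈ G.nodes
  | edge e u v => G.ends e = some (u, v)
  | label o l => l ∈ G.labels o
  | prop o k v => G.prop o k = some v

theorem mem_edges_iff {e : Ident} : e ∈ G.edges ↔ ∃ u v, (edge e u v).Mem G := by
  rw [← G.ends_isSome, Option.isSome_iff_exists]
  simp [Mem]

/-- Edges carry their end points, and functions have fixed default values where they are undefined,
so the items determine every field. -/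
theorem graph_ext (h : ∀ i : Item V, i.Mem G ↔ i.Mem H) : G = H := by
  have hn : G.nodes = H.nodes := Finset.ext fun o => h (node o)
  have he : G.edges = H.edges := Finset.ext fun e => by
    simp only [mem_edges_iff, h]
  ext1
  · exact hn
  · exact he
  · funext e
    ext ⟨u, v⟩
    exact h (edge e u v)
  · funext o
    ext l
    exact h (label o l)
  · funext o k
    ext v
    exact h (prop o k v)

theorem present_of_label {o : Ident} {l : Label} (h : (label o l).Mem G) :
    o ∈ G.nodes ∨ o ∈ G.edges := by
  by_contra! h'
  simp [Mem, G.labels_eq_empty o h'.1 h'.2] at h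

theorem present_of_prop {o : Ident} {k : Key} {v : V} (h : (prop o k v).Mem G) :
    o ∈ G.nodes ∨ o ∈ G.edges := by
  by_contra! h'
  simp [Mem, G.prop_eq_none o k h'.1 h'.2] at h

/-- Turns maximality of subgraphs into maximality of sets of items. The presence conditions in the
definition are automatic, since only nodes and edges of `H` carry annotations. -/
theorem isSubgraph_iff : H.IsSubgraph G ↔ ∀ i : Item V, i.Mem H → i.Mem G := by
  constructor
  · intro h i hi
    cases i with
    | node o => exact h.nodes hi
    | edge e u v => exact (h.ends e (mem_edges_iff.2 ⟨u, v, hi⟩)).symm.trans hi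
    | label o l => exact h.labels o (present_of_label hi) hi
    | prop o k v => exact h.prop o (present_of_prop hi) k v hi
  · intro h
    refine ⟨fun o => h (node o), fun e he => ?_, fun e he => ?_, fun o _ l => h (label o l),
      fun o _ k v => h (prop o k v)⟩
    · obtain ⟨u, v, he⟩ := mem_edges_iff.1 he
      exact mem_edges_iff.2 ⟨u, v, h _ he⟩
    · obtain ⟨u, v, he⟩ := mem_edges_iff.1 he
      exact he.trans (h _ he).symm

theorem isObjectSubgraph_iff : H.IsObjectSubgraph G ↔ H.IsSubgraph G ∧
    ∀ o k v, o ∈ H.nodes ∨ o ∈ H.edges → (prop o k v).Mem G → (prop o k v).Mem H := by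
  constructor
  · exact fun h => ⟨h.toIsSubgraph, fun o k v ho hG => (h.prop_eq o ho k).trans hG⟩
  · rintro ⟨h, h'⟩
    refine ⟨h, fun o ho k => ?_⟩
    ext v
    exact ⟨fun hv => h.prop o ho k v hv, fun hv => h' o k v ho hv⟩

/-- A node or an edge `o` belongs to a set of items. -/
def Present (S : Set (Item V)) (o : Ident) : Prop := node o ∈ S ∨ ∃ u v, edge o u v ∈ S

/-- With an edge, its source and target are present, and all annotations are on nodes and edges that
are present. -/
def Closed (S : Set (Item V)) : Prop :=
  (∀ e u v, edge e u v ∈ S → node u ∈ S ∧ node v ∈ S) ∧ (∀ o l, label o l ∈ S → Present S o) ∧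
    ∀ o k v, prop o k v ∈ S → Present S o

theorem present_mem {o : Ident} : Present {i | i.Mem G} o ↔ o ∈ G.nodes ∨ o ∈ G.edges := by
  rw [mem_edges_iff]
  rfl

theorem closed_mem : Closed {i | i.Mem G} :=
  ⟨fun e u v h => G.ends_mem e u v h, fun _ _ h => present_mem.2 (present_of_label h),
    fun _ _ _ h => present_mem.2 (present_of_prop h)⟩

/-- Every field of `G` is restricted to `S`. Closedness supplies the axioms that relate different
fields; disjointness and finiteness are inherited from `G`. -/
theorem exists_graph {S : Set (Item V)} (hS : Closed S) (hG : ∀ i ∈ S, i.Mem G) :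
    ∃ H : PropertyGraph V, ∀ i : Item V, i.Mem H ↔ i ∈ S := by
  classical
  have hnode : ∀ o, o ∈ G.nodes.filter (fun o => node o ∈ S) ↔ node o ∈ S := fun o =>
    ⟨fun h => (Finset.mem_filter.1 h).2, fun h => Finset.mem_filter.2 ⟨hG _ h, h⟩⟩
  have hedge : ∀ e, e ∈ G.edges.filter (fun e => ∃ u v, edge e u v ∈ S) ↔
      ∃ u v, edge e u v ∈ S := fun e =>
    ⟨fun h => (Finset.mem_filter.1 h).2, fun ⟨u, v, h⟩ =>
      Finset.mem_filter.2 ⟨mem_edges_iff.2 ⟨u, v, hG _ h⟩, u, v, h⟩⟩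
  have hends : ∀ e u v, (G.ends e).filter (fun p => edge e p.1 p.2 ∈ S) = some (u, v) ↔
      edge e u v ∈ S := fun e u v => by
    simp only [Option.filter_eq_some_iff, decide_eq_true_eq, and_iff_right_iff_imp]
    exact hG (edge e u v)
  have hlab : ∀ o l, l ∈ (G.labels o).filter (fun l => label o l ∈ S) ↔ label o l ∈ S :=
    fun o l => ⟨fun h => (Finset.mem_filter.1 h).2, fun h => Finset.mem_filter.2 ⟨hG _ h, h⟩⟩
  have hprop : ∀ o k v, (G.prop o k).filter (fun v => prop o k v ∈ S) = some v ↔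
      prop o k v ∈ S := fun o k v => by
    simp only [Option.filter_eq_some_iff, decide_eq_true_eq, and_iff_right_iff_imp]
    exact hG (prop o k v)
  refine ⟨⟨G.nodes.filter fun o => node o ∈ S, G.edges.filter fun e => ∃ u v, edge e u v ∈ S,
    Finset.disjoint_filter_filter G.disjoint,
    fun e => (G.ends e).filter fun p => edge e p.1 p.2 ∈ S,
    fun o => (G.labels o).filter fun l => label o l ∈ S,
    fun o k => (G.prop o k).filter fun v => prop o k v ∈ S, fun e => ?_, fun e u v h => ?_,
    fun o h h' => ?_, fun o k h h' => ?_, ?_⟩, fun i => ?_⟩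
  · rw [hedge, Option.isSome_iff_exists]
    simp [hends]
  · rw [hnode, hnode]
    exact hS.1 e u v ((hends e u v).1 h)
  · rw [hnode] at h
    rw [hedge] at h'
    refine Finset.eq_empty_of_forall_notMem fun l hl => ?_
    exact (hS.2.1 o l ((hlab o l).1 hl)).elim h h'
  · rw [hnode] at h
    rw [hedge] at h'
    refine Option.eq_none_iff_forall_ne_some.2 fun v hv => ?_
    exact (hS.2.2 o k v ((hprop o k v).1 hv)).elim h h'
  · refine G.prop_finite.subset fun x hx hx' => hx ?_
    simp [hx']
  · cases i with
    | node o => exact hnode o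
    | edge e u v => exact hends e u v
    | label o l => exact hlab o l
    | prop o k v => exact hprop o k v

/-- The `i`-th tag. -/
def tag : ℕ → Data
  | 0 => .nil
  | n + 1 => .cons .nil (tag n)

/-- The encoding of items. -/
def enc (code : V → Word) : Item V → Data
  | node o => .cons (tag 0) (encWord o)
  | edge e u v => .cons (tag 1) (.cons (encWord e) (.cons (encWord u) (encWord v)))
  | label o l => .cons (tag 2) (.cons (encWord o) (encWord l))
  | prop o k v => .cons (tag 3) (.cons (encWord o) (.cons (encWord k) (encWord (code v))))

theorem enc_injective {code : V → Word} (hcode : Function.Injective code) :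
    Function.Injective (enc code) := by
  intro i j h
  cases i <;> cases j <;> simp_all [enc, tag, hcode.eq_iff]

/-- The identifier of a node. -/
def asNode : Item V → Option Ident
  | node o => some o
  | _ => none

/-- An edge with its source and target. -/
def asEdge : Item V → Option (Ident × Ident × Ident)
  | edge e u v => some (e, u, v)
  | _ => none

/-- A label with its place. -/
def asLabel : Item V → Option (Ident × Label)
  | label o l => some (o, l)
  | _ => none

/-- A property with its place. -/
def asProp : Item V → Option (Ident × Key × V)
  | prop o k v => some (o, k, v)
  | _ => none

@[simp] theorem asNode_eq_some {i : Item V} {o : Ident} : i.asNode = some o ↔ i = node o := by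
  cases i <;> simp [asNode]

@[simp] theorem asEdge_eq_some {i : Item V} {r : Ident × Ident × Ident} :
    i.asEdge = some r ↔ i = edge r.1 r.2.1 r.2.2 := by
  cases i <;> simp [asEdge, Prod.ext_iff]

@[simp] theorem asLabel_eq_some {i : Item V} {r : Ident × Label} :
    i.asLabel = some r ↔ i = label r.1 r.2 := by
  cases i <;> simp [asLabel, Prod.ext_iff]

@[simp] theorem asProp_eq_some {i : Item V} {r : Ident × Key × V} :
    i.asProp = some r ↔ i = prop r.1 r.2.1 r.2.2 := by
  cases i <;> simp [asProp, Prod.ext_iff]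

end Item

/-! ### Listings and lists of items. -/

open Item

variable {V : Type*}

/-- The items of a listing. -/
def Listing.items (D : Listing V) : List (Item V) :=
  D.nodes.map (fun r => node r.1) ++ (D.edges.map (fun r => edge r.1 r.2.1.1 r.2.1.2) ++
    (D.nodes ++ D.edges.map fun r => (r.1, r.2.2)).flatMap fun r =>
      r.2.labels.map (label r.1) ++ r.2.props.map fun p => prop r.1 p.1 p.2)

theorem Listing.Lists.mem_items {D : Listing V} {G : PropertyGraph V} (h : D.Lists G)
    (i : Item V) : i ∈ D.items ↔ i.Mem G := by
  obtain ⟨-, hn, -, he, hna, hea⟩ := h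
  have hrec : ∀ o, o ∈ G.nodes ∨ o ∈ G.edges →
      ∃ A, (o, A) ∈ D.nodes ++ D.edges.map fun r => (r.1, r.2.2) := by
    intro o ho
    rw [← hn, ← he] at ho
    rcases ho with ho | ho
    · obtain ⟨r, hr, rfl⟩ := List.mem_map.1 ho
      exact ⟨r.2, List.mem_append_left _ hr⟩
    · obtain ⟨r, hr, rfl⟩ := List.mem_map.1 ho
      exact ⟨r.2.2, List.mem_append_right _ (List.mem_map.2 ⟨r, hr, rfl⟩)⟩
  have hann : ∀ r ∈ D.nodes ++ D.edges.map fun r => (r.1, r.2.2), r.2.Lists G r.1 := by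
    intro r hr
    rcases List.mem_append.1 hr with hr | hr
    · exact hna r hr
    · obtain ⟨r', hr', rfl⟩ := List.mem_map.1 hr
      exact (hea r' hr').2
  rw [items, List.mem_append, List.mem_append, List.mem_flatMap]
  cases i with
  | node o => simpa [Mem] using hn o
  | edge e u v =>
    simp only [List.mem_map, reduceCtorEq, and_false, exists_false, edge.injEq, List.mem_append,
      or_self, or_false, false_or, Mem]
    constructor
    · rintro ⟨r, hr, rfl, rfl, rfl⟩
      exact (hea r hr).1
    · intro h
      have : e ∈ G.edges := mem_edges_iff.2 ⟨u, v, h⟩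
      rw [← he] at this
      obtain ⟨r, hr, rfl⟩ := List.mem_map.1 this
      have h1 := (hea r hr).1.symm.trans h
      simp only [Option.some.injEq] at h1
      exact ⟨r, hr, rfl, by rw [h1], by rw [h1]⟩
  | label o l =>
    simp only [List.mem_map, reduceCtorEq, and_false, exists_false, List.mem_append (s := List.map _ _),
      or_false, false_or, label.injEq]
    constructor
    · rintro ⟨r, hr, l, hl, rfl, rfl⟩
      exact ((hann r hr).2.1 l).1 hl
    · intro h
      obtain ⟨A, hA⟩ := hrec o (present_of_label h)
      exact ⟨_, hA, l, ((hann _ hA).2.1 l).2 h, rfl, rfl⟩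
  | prop o k v =>
    simp only [List.mem_map, reduceCtorEq, and_false, exists_false, List.mem_append (s := List.map _ _),
      false_or, prop.injEq]
    constructor
    · rintro ⟨r, hr, p, hp, rfl, rfl, rfl⟩
      exact ((hann r hr).2.2.2 _ _).1 hp
    · intro h
      obtain ⟨A, hA⟩ := hrec o (present_of_prop h)
      exact ⟨_, hA, (k, v), ((hann _ hA).2.2.2 _ _).2 h, rfl, rfl, rfl⟩

/-- Allows lists of items to be compared by length, and their sublists to be written out again
without repetition. Annotations of different records do not collide because nodes and edges have
disjoint identifiers. -/
theorem Listing.Lists.nodup_items {D : Listing V} {G : PropertyGraph V} (h : D.Lists G) :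
    D.items.Nodup := by
  obtain ⟨hn, hn', he, he', hna, hea⟩ := h
  have hann : ∀ r ∈ D.nodes ++ D.edges.map fun r => (r.1, r.2.2), r.2.Lists G r.1 := by
    intro r hr
    rcases List.mem_append.1 hr with hr | hr
    · exact hna r hr
    · obtain ⟨r', hr', rfl⟩ := List.mem_map.1 hr
      exact (hea r' hr').2
  have hfst : ((D.nodes ++ D.edges.map fun r => (r.1, r.2.2)).map Prod.fst).Nodup := by
    rw [List.map_append, List.map_map]
    refine hn.append he fun o h1 h2 => ?_
    exact Finset.disjoint_left.1 G.disjoint ((hn' o).1 h1) ((he' o).1 h2)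
  refine List.Nodup.append ?_ (List.Nodup.append ?_ ?_ ?_) ?_
  · have : D.nodes.map (fun r => (node r.1 : Item V)) = (D.nodes.map Prod.fst).map node := by simp
    rw [this]
    exact hn.map fun a b h => by simpa using h
  · refine List.Nodup.of_map (fun i => i.asEdge.map Prod.fst) ?_
    rw [List.map_map]
    have : D.edges.map ((fun i : Item V => i.asEdge.map Prod.fst) ∘
        fun r => edge r.1 r.2.1.1 r.2.1.2) = (D.edges.map Prod.fst).map some := by
      simp [asEdge]
    rw [this]
    exact he.map (Option.some_injective _)
  · rw [List.nodup_flatMap]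
    refine ⟨fun r hr => ?_, ?_⟩
    · refine List.Nodup.append ((hann r hr).1.map fun a b h => by simpa using h)
        ((hann r hr).2.2.1.map fun a b h => by simpa [Prod.ext_iff] using h) ?_
      intro i h1 h2
      simp only [List.mem_map] at h1 h2
      obtain ⟨_, -, rfl⟩ := h1
      obtain ⟨_, -, h2⟩ := h2
      cases h2
    · rw [List.Nodup, List.pairwise_map] at hfst
      refine hfst.imp fun {r r'} hr i h1 h2 => hr ?_
      simp only [List.mem_append, List.mem_map] at h1 h2
      rcases h1 with ⟨_, -, rfl⟩ | ⟨_, -, rfl⟩ <;> rcases h2 with ⟨_, -, h2⟩ | ⟨_, -, h2⟩ <;>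
        simp_all
  · intro i h1 h2
    simp only [List.mem_flatMap, List.mem_append, List.mem_map] at h1 h2
    obtain ⟨_, -, rfl⟩ := h1
    obtain ⟨_, -, ⟨_, -, h2⟩ | ⟨_, -, h2⟩⟩ := h2 <;> cases h2
  · intro i h1 h2
    simp only [List.mem_flatMap, List.mem_append, List.mem_map] at h1 h2
    obtain ⟨_, -, rfl⟩ := h1
    obtain ⟨_, -, h2⟩ | ⟨_, -, ⟨_, -, h2⟩ | ⟨_, -, h2⟩⟩ := h2 <;> cases h2

open Classical in
/-- The annotation of `o` in a list of items. -/
noncomputable def annotationOf (X : List (Item V)) (o : Ident) : Annotation V where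
  labels := ((X.filterMap asLabel).filter fun r => r.1 = o).map Prod.snd
  props := ((X.filterMap asProp).filter fun r => r.1 = o).map Prod.snd

/-- A list of items, arranged as a listing. -/
noncomputable def listingOf (X : List (Item V)) : Listing V where
  nodes := (X.filterMap asNode).map fun o => (o, annotationOf X o)
  edges := (X.filterMap asEdge).map fun r => (r.1, r.2, annotationOf X r.1)

theorem lists_listingOf {X : List (Item V)} {H : PropertyGraph V} (hX : X.Nodup)
    (h : ∀ i, i ∈ X ↔ i.Mem H) : (listingOf X).Lists H := by
  have hann : ∀ o, (annotationOf X o).Lists H o := by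
    intro o
    refine ⟨?_, fun l => ?_, ?_, fun k v => ?_⟩
    · refine List.Nodup.map_on ?_ ((hX.filterMap ?_).filter _)
      · simp only [List.mem_filter, decide_eq_true_eq]
        exact fun a ha b hb hab => Prod.ext (ha.2.trans hb.2.symm) hab
      · intro i j r hi hj
        rw [Option.mem_def, asLabel_eq_some] at hi hj
        rw [hi, hj]
    · simp only [annotationOf, List.mem_map, List.mem_filter, List.mem_filterMap, asLabel_eq_some,
        decide_eq_true_eq]
      constructor
      · rintro ⟨r, ⟨⟨_, hi, rfl⟩, rfl⟩, rfl⟩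
        exact (h _).1 hi
      · exact fun hl => ⟨(o, l), ⟨⟨_, (h (label o l)).2 hl, rfl⟩, rfl⟩, rfl⟩
    · refine List.Nodup.map_on ?_ ((hX.filterMap ?_).filter _)
      · simp only [List.mem_filter, decide_eq_true_eq]
        exact fun a ha b hb hab => Prod.ext (ha.2.trans hb.2.symm) hab
      · intro i j r hi hj
        rw [Option.mem_def, asProp_eq_some] at hi hj
        rw [hi, hj]
    · simp only [annotationOf, List.mem_map, List.mem_filter, List.mem_filterMap, asProp_eq_some,
        decide_eq_true_eq]
      constructor
      · rintro ⟨r, ⟨⟨_, hi, rfl⟩, rfl⟩, hr⟩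
        have := (h _).1 hi
        rwa [show r.2.1 = k by rw [hr], show r.2.2 = v by rw [hr]] at this
      · exact fun hl => ⟨(o, k, v), ⟨⟨_, (h (prop o k v)).2 hl, rfl⟩, rfl⟩, rfl⟩
  refine ⟨?_, fun o => ?_, ?_, fun e => ?_, fun r hr => ?_, fun r hr => ?_⟩
  · simp only [listingOf, List.map_map, Function.comp_def, List.map_id']
    refine hX.filterMap fun i j r hi hj => ?_
    rw [Option.mem_def, asNode_eq_some] at hi hj
    rw [hi, hj]
  · simp only [listingOf, List.map_map, Function.comp_def, List.map_id', List.mem_filterMap,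
      asNode_eq_some, exists_eq_right]
    exact h (node o)
  · simp only [listingOf, List.map_map, Function.comp_def]
    refine List.Nodup.map_on ?_ (hX.filterMap ?_)
    -- Two edge items with the same identifier have the same end points, because `ends` is a
    -- function.
    · simp only [List.mem_filterMap, asEdge_eq_some]
      rintro a ⟨_, ha, rfl⟩ b ⟨_, hb, rfl⟩ hab
      have h1 := (h _).1 ha
      have h2 := (h _).1 hb
      simp only [Mem] at h1 h2
      rw [hab, h2] at h1
      simp only [Option.some.injEq, Prod.mk.injEq] at h1
      exact Prod.ext hab (Prod.ext h1.1.symm h1.2.symm)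
    · intro i j r hi hj
      rw [Option.mem_def, asEdge_eq_some] at hi hj
      rw [hi, hj]
  · simp only [listingOf, List.map_map, Function.comp_def, List.mem_map, List.mem_filterMap,
      asEdge_eq_some, mem_edges_iff, ← h]
    constructor
    · rintro ⟨r, ⟨_, hr, rfl⟩, rfl⟩
      exact ⟨_, _, hr⟩
    · rintro ⟨u, v, hr⟩
      exact ⟨(e, u, v), ⟨_, hr, rfl⟩, rfl⟩
  · simp only [listingOf, List.mem_map] at hr
    obtain ⟨o, -, rfl⟩ := hr
    exact hann o
  · simp only [listingOf, List.mem_map, List.mem_filterMap, asEdge_eq_some] at hr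
    obtain ⟨r, ⟨_, hr, rfl⟩, rfl⟩ := hr
    exact ⟨(h _).1 hr, hann _⟩


/-! ## End points of matching paths -/

variable {G : PropertyGraph V} {μ : ℕ → Ident}

theorem Path.target_append {p q : Path} (h : p.target = q.start) :
    (p.append q).target = q.target := by
  simp only [target, append, List.map_append] at h ⊢
  cases hq : q.steps.map Prod.snd with
  | nil => simpa [hq] using h
  | cons a l => simp [List.getLastD_eq_getLast?, List.getLast?_append, List.getLast?_cons]

theorem PropertyGraph.isWalkFrom_append {u : Ident} {k l : List (Ident × Ident)} :
    G.IsWalkFrom u (k ++ l) ↔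
      G.IsWalkFrom u k ∧ G.IsWalkFrom ((k.map Prod.snd).getLastD u) l := by
  induction k generalizing u with
  | nil => simp [IsWalkFrom]
  | cons s k ih =>
    obtain ⟨e, v⟩ := s
    simp only [List.cons_append, IsWalkFrom, ih, List.map_cons, List.getLastD_cons, and_assoc]

theorem PropertyGraph.IsPath.append {p q : Path} (hp : G.IsPath p) (hq : G.IsPath q)
    (h : p.target = q.start) : G.IsPath (p.append q) := by
  refine ⟨hp.1, isWalkFrom_append.2 ⟨hp.2, ?_⟩⟩
  have : (p.steps.map Prod.snd).getLastD p.start = q.start := h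
  rw [Path.append, this]
  exact hq.2

theorem PropertyGraph.IsPath.target_mem {p : Path} (hp : G.IsPath p) : p.target ∈ G.nodes := by
  obtain ⟨u, l⟩ := p
  obtain ⟨h1, h2⟩ := hp
  induction l generalizing u with
  | nil => exact h1
  | cons s l ih =>
    obtain ⟨e, v⟩ := s
    have := ih v (G.ends_mem _ _ _ h2.1).2 h2.2
    simpa only [Path.target, List.map_cons, List.getLastD_cons] using this

namespace PathPattern

theorem Matches.isPath {P : PathPattern} {p : Path} (h : P.Matches G μ p) : G.IsPath p := by
  induction P generalizing p with
  | node x φ => exact ⟨h.2.1, by rw [h.1]; trivial⟩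
  | edge φ =>
    obtain ⟨e, v, h1, h2, -⟩ := h
    exact ⟨(G.ends_mem _ _ _ h2).1, by rw [h1]; exact ⟨h2, trivial⟩⟩
  | concat P Q ihP ihQ =>
    obtain ⟨p₁, p₂, h1, h2, h3, rfl⟩ := h
    exact (ihP h1).append (ihQ h2) h3
  | union P Q ihP ihQ => exact h.elim ihP ihQ
  | star P ih =>
    change IsIteration G (P.Matches G μ) p at h
    induction h with
    | zero v hv => exact ⟨hv, trivial⟩
    | succ p q hp _ h ih' => exact (ih hp).append ih' h

/-- Well-formedness keeps node variables out of unions and stars, so each of them belongs to a node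
pattern that every match has to use. -/
theorem Matches.mem_nodes {P : PathPattern} (hP : P.WellFormed) {p : Path}
    (h : P.Matches G μ p) {x : ℕ} (hx : x ∈ P.vars) : μ x ∈ G.nodes := by
  induction P generalizing p with
  | node y φ =>
    rw [h.2.2.1 x hx]
    exact h.2.1
  | edge φ => exact hx.elim
  | concat P Q ihP ihQ =>
    obtain ⟨p₁, p₂, h1, h2, -, -⟩ := h
    exact hx.elim (ihP hP.1 h1) (ihQ hP.2 h2)
  | union P Q => simp [vars, hP.2.2.1, hP.2.2.2] at hx
  | star P => simp [vars, hP.2.1] at hx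

/-- Some path from `u` to `v` matches the pattern. -/
def Connects (G : PropertyGraph V) (μ : ℕ → Ident) (P : PathPattern) (u v : Ident) : Prop :=
  ∃ p : Path, p.start = u ∧ p.target = v ∧ P.Matches G μ p

theorem Connects.mem {P : PathPattern} {u v : Ident} (h : P.Connects G μ u v) :
    u ∈ G.nodes ∧ v ∈ G.nodes := by
  obtain ⟨p, rfl, rfl, h⟩ := h
  exact ⟨h.isPath.1, h.isPath.target_mem⟩

theorem connects_node {x : Option ℕ} {φ : Option LabelExpr} {u v : Ident} :
    (node x φ).Connects G μ u v ↔ u = v ∧ u ∈ G.nodes ∧ (∀ y, x = some y → μ y = u) ∧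
      ∀ ψ, φ = some ψ → ψ.Sat (G.labels u) := by
  constructor
  · rintro ⟨⟨s, l⟩, rfl, rfl, h1, h2, h3, h4⟩
    simp only at h1
    subst h1
    exact ⟨rfl, h2, h3, h4⟩
  · rintro ⟨rfl, h2, h3, h4⟩
    exact ⟨⟨u, []⟩, rfl, rfl, rfl, h2, h3, h4⟩

theorem connects_edge {φ : Option LabelExpr} {u v : Ident} :
    (edge φ).Connects G μ u v ↔ ∃ e, G.ends e = some (u, v) ∧
      ∀ ψ, φ = some ψ → ψ.Sat (G.labels e) := by
  constructor
  · rintro ⟨⟨s, l⟩, rfl, rfl, e, v, h1, h2, h3⟩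
    simp only at h1
    subst h1
    exact ⟨e, h2, h3⟩
  · rintro ⟨e, h2, h3⟩
    exact ⟨⟨u, [(e, v)]⟩, rfl, rfl, e, v, rfl, h2, h3⟩

theorem connects_concat {P Q : PathPattern} {u v : Ident} :
    (concat P Q).Connects G μ u v ↔ ∃ w, P.Connects G μ u w ∧ Q.Connects G μ w v := by
  constructor
  · rintro ⟨_, rfl, rfl, p, q, h1, h2, h3, rfl⟩
    exact ⟨q.start, ⟨p, rfl, h3, h1⟩, q, rfl, (Path.target_append h3).symm, h2⟩
  · rintro ⟨_, ⟨p, rfl, rfl, h1⟩, q, h3, rfl, h2⟩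
    exact ⟨p.append q, rfl, Path.target_append h3.symm, p, q, h1, h2, h3.symm, rfl⟩

theorem connects_union {P Q : PathPattern} {u v : Ident} :
    (union P Q).Connects G μ u v ↔ P.Connects G μ u v ∨ Q.Connects G μ u v := by
  constructor
  · rintro ⟨p, h1, h2, h | h⟩
    exacts [.inl ⟨p, h1, h2, h⟩, .inr ⟨p, h1, h2, h⟩]
  · rintro (⟨p, h1, h2, h⟩ | ⟨p, h1, h2, h⟩)
    exacts [⟨p, h1, h2, .inl h⟩, ⟨p, h1, h2, .inr h⟩]

/-- An iterated path is a chain of paths matching `P`, of which only the end points are kept. The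
clause on `u` is needed because the closure is reflexive on all identifiers, not only on nodes. -/
theorem connects_star {P : PathPattern} {u v : Ident} :
    (star P).Connects G μ u v ↔
      u ∈ G.nodes ∧ Relation.ReflTransGen (P.Connects G μ) u v := by
  constructor
  · rintro ⟨p, rfl, rfl, h⟩
    change IsIteration G (P.Matches G μ) p at h
    induction h with
    | zero v hv => exact ⟨hv, .refl⟩
    | succ p q hp _ h ih =>
      refine ⟨hp.isPath.1, ?_⟩
      rw [Path.target_append h]
      exact .head ⟨p, rfl, h, hp⟩ ih.2
  · rintro ⟨hu, h⟩
    induction h using Relation.ReflTransGen.head_induction_on with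
    | refl => exact ⟨⟨v, []⟩, rfl, rfl, IsIteration.zero v hu⟩
    | head h _ ih =>
      obtain ⟨q, hq, hqv, hm⟩ := ih h.mem.2
      obtain ⟨p, rfl, hp, hm'⟩ := h
      exact ⟨p.append q, rfl, (Path.target_append (hp.trans hq.symm)).trans hqv,
        IsIteration.succ p q hm' hm (hp.trans hq.symm)⟩

theorem finite_vars (P : PathPattern) : P.vars.Finite := by
  induction P with
  | node x φ =>
    cases x with
    | none => simp [vars]
    | some x => exact (Set.finite_singleton x).subset fun y hy => by simpa [vars, eq_comm] using hy
  | edge φ => exact Set.finite_empty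
  | concat P Q ihP ihQ => exact ihP.union ihQ
  | union P Q ihP ihQ => exact ihP.union ihQ
  | star P ih => exact ih

end PathPattern

theorem GraphPattern.exists_bound (q : GraphPattern) : ∃ K : ℕ, ∀ x ∈ q.vars, x < K := by
  have h : q.vars.Finite := by
    have : q.vars = ⋃ zP ∈ {zP | zP ∈ q}, zP.2.vars := by
      ext x
      simp [vars]
    rw [this]
    exact (List.finite_toSet q).biUnion fun zP _ => zP.2.finite_vars
  obtain ⟨K, hK⟩ := h.bddAbove
  exact ⟨K + 1, fun x hx => Nat.lt_succ_of_le (hK hx)⟩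

/-- Matches exist if and only if suitable end points exist for all path variables. -/
theorem GraphPattern.exists_isMatch_iff {q : GraphPattern} (hq : (q.map Prod.fst).Nodup) :
    (∃ ν, q.IsMatch G μ ν) ↔ ∀ zP ∈ q, ∃ u v, zP.2.Connects G μ u v := by
  constructor
  · rintro ⟨ν, h⟩ zP hz
    exact ⟨_, _, ν zP.1, rfl, rfl, (h zP hz).2⟩
  · intro h
    -- Once `μ` is given, the path patterns no longer interact and the path variables are distinct,
    -- so the paths can be chosen independently. Unused path variables get an arbitrary value.
    have : ∀ z : ℕ, ∃ p : Path, ∀ P, (z, P) ∈ q → P.Matches G μ p := by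
      intro z
      by_cases hz : ∃ P, (z, P) ∈ q
      · obtain ⟨P, hP⟩ := hz
        obtain ⟨_, _, p, -, -, hp⟩ := h _ hP
        refine ⟨p, fun Q hQ => ?_⟩
        have := List.inj_on_of_nodup_map hq hP hQ rfl
        simp only [Prod.mk.injEq, true_and] at this
        exact this ▸ hp
      · exact ⟨⟨[], []⟩, fun P hP => absurd ⟨P, hP⟩ hz⟩
    choose ν hν using this
    exact ⟨ν, fun zP hz => ⟨(hν _ _ hz).isPath, hν _ _ hz⟩⟩


variable {M : ℕ}

/-! ## Evaluating constraints on encoded lists of items -/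

open Classical in
/-- The entries with the `i`-th tag of a list, without the tag. -/
noncomputable def entries (i : ℕ) (X : Data) : Data :=
  .ofL ((X.toList.filter fun a => a.hd = tag i).map Data.tl)

theorem polyTime_entries (i : ℕ) {f : Data → Data} (hf : PolyTime M f) :
    PolyTime M fun x => entries i (f x) := by
  classical
  have h := PolyTime.map (G := fun y _ => y.tl) (PolyTime.filter (P := fun y _ => y.hd = tag i) hf
    (.eq (by fun_prop) (by fun_prop))) (by fun_prop)
  convert h using 2 with x
  simp [entries]

section entries

variable (code : V → Word) (X : List (Item V))

/-- The encoding of a list of items. -/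
abbrev encItems : Data := Data.ofList (Item.enc code) X

theorem entries_node : entries 0 (encItems code X) = Data.ofList encWord (X.filterMap asNode) := by
  rw [entries, Data.ofList_eq encWord, Data.toList_ofList]
  congr 1
  induction X with
  | nil => rfl
  | cons i X ih => cases i <;> simp_all [enc, Data.hd, Data.tl, tag, asNode, List.filterMap_cons]

theorem entries_edge : entries 1 (encItems code X) =
    Data.ofList (fun r => .cons (encWord r.1) (.cons (encWord r.2.1) (encWord r.2.2)))
      (X.filterMap asEdge) := by
  rw [entries, Data.ofList_eq (fun _ => _), Data.toList_ofList]
  congr 1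
  induction X with
  | nil => rfl
  | cons i X ih => cases i <;> simp_all [enc, Data.hd, Data.tl, tag, asEdge, List.filterMap_cons]

theorem entries_label : entries 2 (encItems code X) =
    Data.ofList (fun r => .cons (encWord r.1) (encWord r.2)) (X.filterMap asLabel) := by
  rw [entries, Data.ofList_eq (fun _ => _), Data.toList_ofList]
  congr 1
  induction X with
  | nil => rfl
  | cons i X ih => cases i <;> simp_all [enc, Data.hd, Data.tl, tag, asLabel, List.filterMap_cons]

theorem entries_prop : entries 3 (encItems code X) =
    Data.ofList (fun r => .cons (encWord r.1) (.cons (encWord r.2.1) (encWord (code r.2.2))))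
      (X.filterMap asProp) := by
  rw [entries, Data.ofList_eq (fun _ => _), Data.toList_ofList]
  congr 1
  induction X with
  | nil => rfl
  | cons i X ih => cases i <;> simp_all [enc, Data.hd, Data.tl, tag, asProp, List.filterMap_cons]

variable {code X}

theorem mem_entries_node {a : Data} : a ∈ (entries 0 (encItems code X)).toList ↔
    ∃ o, node o ∈ X ∧ a = encWord o := by
  simp [entries_node, eq_comm (a := a)]

theorem mem_entries_edge {a : Data} : a ∈ (entries 1 (encItems code X)).toList ↔
    ∃ e u v, edge e u v ∈ X ∧ a = .cons (encWord e) (.cons (encWord u) (encWord v)) := by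
  simp [entries_edge, eq_comm (a := a)]

theorem mem_entries_label {a : Data} : a ∈ (entries 2 (encItems code X)).toList ↔
    ∃ o l, label o l ∈ X ∧ a = .cons (encWord o) (encWord l) := by
  simp [entries_label, eq_comm (a := a)]

theorem mem_entries_prop {a : Data} : a ∈ (entries 3 (encItems code X)).toList ↔
    ∃ o k v, prop o k v ∈ X ∧
      a = .cons (encWord o) (.cons (encWord k) (encWord (code v))) := by
  simp [entries_prop, eq_comm (a := a)]

theorem encWord_mem_entries {o : Ident} :
    encWord o ∈ (entries 0 (encItems code X)).toList ↔ node o ∈ X := by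
  simp [mem_entries_node]

end entries

/-! ### Label expressions and path patterns. -/

/-- Evaluation of a label expression. -/
def labelD (X o : Data) : LabelExpr → Prop
  | .label l => .cons o (encWord l) ∈ (entries 2 X).toList
  | .and φ ψ => labelD X o φ ∧ labelD X o ψ
  | .or φ ψ => labelD X o φ ∨ labelD X o ψ
  | .not φ => ¬ labelD X o φ

theorem polyDec_labelD (φ : LabelExpr) {f g : Data → Data} (hf : PolyTime M f)
    (hg : PolyTime M g) : PolyDec M fun x => labelD (f x) (g x) φ := by
  induction φ with
  | label l => exact .mem (hg.cons (.const _)) (polyTime_entries 2 hf)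
  | and φ ψ h1 h2 => exact h1.and h2
  | or φ ψ h1 h2 => exact h1.or h2
  | not φ h => exact h.not

theorem labelD_iff {code : V → Word} {X : List (Item V)} {H : PropertyGraph V}
    (h : ∀ i, i ∈ X ↔ i.Mem H) {o : Ident} {φ : LabelExpr} :
    labelD (encItems code X) (encWord o) φ ↔ φ.Sat (H.labels o) := by
  induction φ with
  | label l =>
    simp only [labelD, mem_entries_label, Data.cons.injEq, encWord_inj, LabelExpr.Sat]
    constructor
    · rintro ⟨_, _, hi, rfl, rfl⟩
      exact (h _).1 hi
    · exact fun hl => ⟨_, _, (h (label o l)).2 hl, rfl, rfl⟩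
  | and φ ψ h1 h2 => exact and_congr h1 h2
  | or φ ψ h1 h2 => exact or_congr h1 h2
  | not φ h => exact not_congr h

/-- The `n`-th entry of a list. -/
def Data.nth (m : Data) : ℕ → Data
  | 0 => m.hd
  | n + 1 => m.tl.nth n

theorem polyTime_nth (n : ℕ) {f : Data → Data} (hf : PolyTime M f) :
    PolyTime M fun x => (f x).nth n := by
  induction n generalizing f with
  | zero => exact hf.hd
  | succ n ih => exact ih hf.tl

theorem Data.nth_ofL {n : ℕ} {m : List Data} (hn : n < m.length) : (ofL m).nth n = m[n] := by
  induction m generalizing n with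
  | nil => simp at hn
  | cons a m ih =>
    cases n with
    | zero => rfl
    | succ n => exact ih (by simpa using hn)

/-- Evaluation of a path pattern for given end points: `X` is a list of items, `PS` a list of such
lists, and `m` the list of the values of the node variables. -/
def matchD (PS X m : Data) : PathPattern → Data → Data → Prop
  | .node x φ, u, v => u = v ∧ u ∈ (entries 0 X).toList ∧ (∀ y ∈ x, m.nth y = u) ∧
      ∀ ψ ∈ φ, labelD X u ψ
  | .edge φ, u, v => ∃ a ∈ (entries 1 X).toList, a.tl = .cons u v ∧ ∀ ψ ∈ φ, labelD X a.hd ψ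
  | .concat P Q, u, v => ∃ w ∈ (entries 0 X).toList, matchD PS X m P u w ∧ matchD PS X m Q w v
  | .union P Q, u, v => matchD PS X m P u v ∨ matchD PS X m Q u v
  | .star P, u, v => u ∈ (entries 0 X).toList ∧ ∀ Y ∈ PS.toList, u ∈ (entries 0 Y).toList →
      (∀ a ∈ (entries 0 X).toList, ∀ b ∈ (entries 0 X).toList, a ∈ (entries 0 Y).toList →
        matchD PS X m P a b → b ∈ (entries 0 Y).toList) → v ∈ (entries 0 Y).toList

theorem PolyDec.forall_option {α : Type*} (x : Option α) {P : α → Data → Prop}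
    (h : ∀ a, PolyDec M (P a)) : PolyDec M fun z => ∀ a ∈ x, P a z := by
  cases x with
  | none => exact (const True).congr (by simp)
  | some a => exact (h a).congr (by simp)

/-- The pattern is fixed and not part of the input, so the recursion unfolds into a fixed nesting of
quantifiers bounded by lists computed from the input. -/
theorem polyDec_matchD (P : PathPattern) {f g h u v : Data → Data} (hf : PolyTime M f)
    (hg : PolyTime M g) (hh : PolyTime M h) (hu : PolyTime M u) (hv : PolyTime M v) :
    PolyDec M fun x => matchD (f x) (g x) (h x) P (u x) (v x) := by
  induction P generalizing f g h u v with
  | node x φ =>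
    exact (PolyDec.eq hu hv).and ((PolyDec.mem hu (polyTime_entries 0 hg)).and
      ((PolyDec.forall_option x fun y => .eq (polyTime_nth y hh) hu).and
        (PolyDec.forall_option φ fun ψ => polyDec_labelD ψ hg hu)))
  | edge φ =>
    exact .exists_mem (P := fun a x => a.tl = .cons (u x) (v x) ∧ ∀ ψ ∈ φ, labelD (g x) a.hd ψ)
      (polyTime_entries 1 hg) ((PolyDec.eq (by fun_prop) (by fun_prop)).and
        (PolyDec.forall_option φ fun ψ => polyDec_labelD ψ (by fun_prop) (by fun_prop)))
  | concat P Q ihP ihQ =>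
    exact .exists_mem (P := fun w x => matchD (f x) (g x) (h x) P (u x) w ∧
        matchD (f x) (g x) (h x) Q w (v x)) (polyTime_entries 0 hg)
      ((ihP (by fun_prop) (by fun_prop) (by fun_prop) (by fun_prop) (by fun_prop)).and
        (ihQ (by fun_prop) (by fun_prop) (by fun_prop) (by fun_prop) (by fun_prop)))
  | union P Q ihP ihQ => exact (ihP hf hg hh hu hv).or (ihQ hf hg hh hu hv)
  | star P ih =>
    refine (PolyDec.mem hu (polyTime_entries 0 hg)).and (.forall_mem
      (P := fun Y x => u x ∈ (entries 0 Y).toList → (∀ a ∈ (entries 0 (g x)).toList,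
        ∀ b ∈ (entries 0 (g x)).toList, a ∈ (entries 0 Y).toList →
        matchD (f x) (g x) (h x) P a b → b ∈ (entries 0 Y).toList) → v x ∈ (entries 0 Y).toList)
      hf (.imp (.mem (by fun_prop) (polyTime_entries 0 (by fun_prop))) (.imp ?_
        (.mem (by fun_prop) (polyTime_entries 0 (by fun_prop))))))
    -- Each quantifier pushes its value on the context: here `z.hd` is `Y`; one level further in,
    -- `z.hd` is `a` and `z.tl.hd` is `Y`.
    refine .forall_mem (P := fun a z => ∀ b ∈ (entries 0 (g z.tl)).toList,
      a ∈ (entries 0 z.hd).toList → matchD (f z.tl) (g z.tl) (h z.tl) P a b →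
        b ∈ (entries 0 z.hd).toList) (polyTime_entries 0 (by fun_prop)) ?_
    refine .forall_mem (P := fun b z =>
      z.hd ∈ (entries 0 z.tl.hd).toList → matchD (f z.tl.tl) (g z.tl.tl) (h z.tl.tl) P z.hd b →
        b ∈ (entries 0 z.tl.hd).toList) (polyTime_entries 0 (by fun_prop)) ?_
    exact .imp (.mem (by fun_prop) (polyTime_entries 0 (by fun_prop)))
      (.imp (ih (by fun_prop) (by fun_prop) (by fun_prop) (by fun_prop) (by fun_prop))
        (.mem (by fun_prop) (polyTime_entries 0 (by fun_prop))))

/-- The case of star carries the idea. If `v` lies in every closed set around `u`, it lies in the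
set of nodes reachable from `u`, which `hPS` provides as a list. Conversely, membership in a closed
set propagates along a chain of steps, so further lists in `PS` do no harm. -/
theorem matchD_iff {code : V → Word} {X : List (Item V)} {H : PropertyGraph V}
    (h : ∀ i, i ∈ X ↔ i.Mem H) {PS m : Data}
    (hPS : ∀ S : Set (Item V), ∃ Y : List (Item V), encItems code Y ∈ PS.toList ∧
      ∀ i, i ∈ Y ↔ i ∈ X ∧ i ∈ S)
    {μ : ℕ → Ident} {P : PathPattern} (hm : ∀ x ∈ P.vars, m.nth x = encWord (μ x)) {u v : Ident} :
    matchD PS (encItems code X) m P (encWord u) (encWord v) ↔ P.Connects H μ u v := by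
  have hn : ∀ o, node o ∈ X ↔ o ∈ H.nodes := fun o => h (node o)
  induction P generalizing u v with
  | node x φ =>
    rw [PathPattern.connects_node, matchD]
    refine and_congr encWord_inj (and_congr (encWord_mem_entries.trans (hn u))
      (and_congr ?_ ?_))
    · refine forall₂_congr fun y hy => ?_
      rw [hm y hy, encWord_inj]
    · exact forall₂_congr fun ψ hψ => labelD_iff h
  | edge φ =>
    simp only [PathPattern.connects_edge, matchD, mem_entries_edge]
    constructor
    · rintro ⟨_, ⟨e, u', v', he, rfl⟩, huv, hφ⟩
      simp only [Data.tl, Data.cons.injEq, encWord_inj] at huv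
      obtain ⟨rfl, rfl⟩ := huv
      exact ⟨e, (h _).1 he, fun ψ hψ => (labelD_iff h).1 (hφ ψ hψ)⟩
    · rintro ⟨e, he, hφ⟩
      exact ⟨_, ⟨e, u, v, (h _).2 he, rfl⟩, rfl, fun ψ hψ => (labelD_iff h).2 (hφ ψ hψ)⟩
  | concat P Q ihP ihQ =>
    simp only [PathPattern.connects_concat, matchD, mem_entries_node]
    have ihP := fun u v => ihP (fun x hx => hm x (.inl hx)) (u := u) (v := v)
    have ihQ := fun u v => ihQ (fun x hx => hm x (.inr hx)) (u := u) (v := v)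
    constructor
    · rintro ⟨_, ⟨w, -, rfl⟩, h1, h2⟩
      exact ⟨w, (ihP _ _).1 h1, (ihQ _ _).1 h2⟩
    · rintro ⟨w, h1, h2⟩
      exact ⟨_, ⟨w, (hn w).2 h1.mem.2, rfl⟩, (ihP _ _).2 h1, (ihQ _ _).2 h2⟩
  | union P Q ihP ihQ =>
    exact (or_congr (ihP fun x hx => hm x (.inl hx)) (ihQ fun x hx => hm x (.inr hx))).trans
      PathPattern.connects_union.symm
  | star P ih =>
    have ih := fun u v => ih hm (u := u) (v := v)
    rw [PathPattern.connects_star, matchD, encWord_mem_entries, hn]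
    refine and_congr_right fun hu => ⟨fun hY => ?_, fun huv Y _ hY hcl => ?_⟩
    · obtain ⟨Y, hYP, hYX⟩ := hPS {i | ∃ o, i = node o ∧
        Relation.ReflTransGen (P.Connects H μ) u o}
      have hYn : ∀ o, node o ∈ Y ↔ o ∈ H.nodes ∧
          Relation.ReflTransGen (P.Connects H μ) u o := fun o => by
        simp [hYX, hn]
      have := hY _ hYP (encWord_mem_entries.2 ((hYn u).2 ⟨hu, .refl⟩)) ?_
      · exact ((hYn v).1 (encWord_mem_entries.1 this)).2
      · intro a ha b hb haY hab
        obtain ⟨a, -, rfl⟩ := mem_entries_node.1 ha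
        obtain ⟨b, hb', rfl⟩ := mem_entries_node.1 hb
        rw [encWord_mem_entries, hYn] at haY ⊢
        exact ⟨(hn b).1 hb', haY.2.tail ((ih a b).1 hab)⟩
    · induction huv with
      | refl => exact hY
      | tail _ hab hY' =>
        exact hcl _ (encWord_mem_entries.2 ((hn _).2 hab.mem.1)) _
          (encWord_mem_entries.2 ((hn _).2 hab.mem.2)) hY' ((ih _ _).2 hab)

/-! ### Comparisons and predicates. -/

/-- Comparison of values by means of a table. -/
def cmpD (tab a b : Data) : Cmp → Prop
  | .eq => a = b
  | .ne => a ≠ b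
  | .le => .cons (.cons a b) (.ofBool true) ∈ tab.toList
  | .ge => .cons (.cons b a) (.ofBool true) ∈ tab.toList
  | .lt => .cons (.cons a b) (.ofBool true) ∈ tab.toList ∧ a ≠ b
  | .gt => .cons (.cons b a) (.ofBool true) ∈ tab.toList ∧ b ≠ a

theorem polyDec_cmpD (op : Cmp) {f g h : Data → Data} (hf : PolyTime M f)
    (hg : PolyTime M g) (hh : PolyTime M h) : PolyDec M fun x => cmpD (f x) (g x) (h x) op := by
  cases op with
  | eq => exact .eq hg hh
  | ne => exact (PolyDec.eq hg hh).not
  | le => exact .mem (by fun_prop) hf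
  | ge => exact .mem (by fun_prop) hf
  | lt => exact (PolyDec.mem (by fun_prop) hf).and (PolyDec.eq hg hh).not
  | gt => exact (PolyDec.mem (by fun_prop) hf).and (PolyDec.eq hh hg).not

/-- The table contains the comparisons of all values in `W`. -/
def IsTable [PartialOrder V] (code : V → Word) (W : Set V) (tab : Data) : Prop :=
  ∀ a ∈ W, ∀ b ∈ W,
    (.cons (.cons (encWord (code a)) (encWord (code b))) (.ofBool true) ∈ tab.toList ↔ a ≤ b)

/-- Names are injective, so equality is read off the names; the strict order is the tabulated one
without equality. -/
theorem cmpD_iff [PartialOrder V] {code : V → Word} (hcode : Function.Injective code) {W : Set V}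
    {tab : Data} (ht : IsTable code W tab) {op : Cmp} {a b : V} (ha : a ∈ W) (hb : b ∈ W) :
    cmpD tab (encWord (code a)) (encWord (code b)) op ↔ op.Holds a b := by
  cases op with
  | eq => simp [cmpD, Cmp.Holds, hcode.eq_iff]
  | ne => simp [cmpD, Cmp.Holds, hcode.eq_iff]
  | le => exact ht a ha b hb
  | ge => exact ht b hb a ha
  | lt => simp [cmpD, Cmp.Holds, hcode.eq_iff, ht a ha b hb, lt_iff_le_and_ne]
  | gt => simp [cmpD, Cmp.Holds, hcode.eq_iff, ht b hb a ha, lt_iff_le_and_ne]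

/-- Evaluation of predicates. -/
def predD (code : V → Word) (X m tab : Data) : Predicate V → Prop
  | .varEq x y => m.nth x = m.nth y
  | .varNe x y => m.nth x ≠ m.nth y
  | .propProp x A op y B => ∃ a ∈ (entries 3 X).toList, (a.hd = m.nth x ∧ a.tl.hd = encWord A) ∧
      ∃ b ∈ (entries 3 X).toList, (b.hd = m.nth y ∧ b.tl.hd = encWord B) ∧
        cmpD tab a.tl.tl b.tl.tl op
  | .propConst x A op c => ∃ a ∈ (entries 3 X).toList,
      (a.hd = m.nth x ∧ a.tl.hd = encWord A) ∧ cmpD tab a.tl.tl (encWord (code c)) op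

theorem polyDec_predD (code : V → Word) (p : Predicate V) {f g h : Data → Data}
    (hf : PolyTime M f) (hg : PolyTime M g) (hh : PolyTime M h) :
    PolyDec M fun x => predD code (f x) (g x) (h x) p := by
  cases p with
  | varEq x y => exact .eq (polyTime_nth x hg) (polyTime_nth y hg)
  | varNe x y => exact (PolyDec.eq (polyTime_nth x hg) (polyTime_nth y hg)).not
  | propProp x A op y B =>
    refine .exists_mem (P := fun a x' => (a.hd = (g x').nth x ∧ a.tl.hd = encWord A) ∧
      ∃ b ∈ (entries 3 (f x')).toList, (b.hd = (g x').nth y ∧ b.tl.hd = encWord B) ∧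
        cmpD (h x') a.tl.tl b.tl.tl op) (polyTime_entries 3 hf) (.and (.and
          (.eq (by fun_prop) (polyTime_nth x (by fun_prop))) (.eq (by fun_prop) (by fun_prop))) ?_)
    exact .exists_mem (P := fun b z => (b.hd = (g z.tl).nth y ∧ b.tl.hd = encWord B) ∧
        cmpD (h z.tl) z.hd.tl.tl b.tl.tl op) (polyTime_entries 3 (by fun_prop)) (.and (.and
          (.eq (by fun_prop) (polyTime_nth y (by fun_prop))) (.eq (by fun_prop) (by fun_prop)))
          (polyDec_cmpD op (by fun_prop) (by fun_prop) (by fun_prop)))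
  | propConst x A op c =>
    exact .exists_mem (P := fun a x' => (a.hd = (g x').nth x ∧ a.tl.hd = encWord A) ∧
      cmpD (h x') a.tl.tl (encWord (code c)) op) (polyTime_entries 3 hf) (.and (.and
          (.eq (by fun_prop) (polyTime_nth x (by fun_prop))) (.eq (by fun_prop) (by fun_prop)))
          (polyDec_cmpD op (by fun_prop) (by fun_prop) (by fun_prop)))

/-- The constants in a predicate. -/
def Predicate.constants : Predicate V → List V
  | propConst _ _ _ c => [c]
  | _ => []

theorem predD_iff [PartialOrder V] {code : V → Word} (hcode : Function.Injective code) {W : Set V}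
    {tab : Data} (ht : IsTable code W tab) {X : List (Item V)} {H : PropertyGraph V}
    (h : ∀ i, i ∈ X ↔ i.Mem H) (hX : ∀ o k v, prop o k v ∈ X → v ∈ W) {m : Data} {μ : ℕ → Ident}
    {p : Predicate V} (hp : ∀ c ∈ p.constants, c ∈ W)
    (hm : ∀ x ∈ p.vars, m.nth x = encWord (μ x)) :
    predD code (encItems code X) m tab p ↔ p.Sat H μ := by
  cases p with
  | varEq x y =>
    simp only [Predicate.vars, Set.mem_insert_iff, Set.mem_singleton_iff, forall_eq_or_imp,
      forall_eq] at hm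
    simp [predD, Predicate.Sat, hm.1, hm.2]
  | varNe x y =>
    simp only [Predicate.vars, Set.mem_insert_iff, Set.mem_singleton_iff, forall_eq_or_imp,
      forall_eq] at hm
    simp [predD, Predicate.Sat, hm.1, hm.2]
  | propProp x A op y B =>
    simp only [Predicate.vars, Set.mem_insert_iff, Set.mem_singleton_iff, forall_eq_or_imp,
      forall_eq] at hm
    simp only [predD, Predicate.Sat, hm.1, hm.2, mem_entries_prop]
    constructor
    · rintro ⟨_, ⟨o, k, a, ha, rfl⟩, ⟨h1, h2⟩, _, ⟨o', k', b, hb, rfl⟩, ⟨h1', h2'⟩, h3⟩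
      simp only [Data.hd, Data.tl, encWord_inj] at h1 h2 h1' h2' h3
      subst h1 h2 h1' h2'
      exact ⟨a, b, (h _).1 ha, (h _).1 hb, (cmpD_iff hcode ht (hX _ _ _ ha) (hX _ _ _ hb)).1 h3⟩
    · rintro ⟨a, b, ha, hb, h3⟩
      have ha := (h (prop _ _ _)).2 ha
      have hb := (h (prop _ _ _)).2 hb
      exact ⟨_, ⟨_, _, _, ha, rfl⟩, ⟨rfl, rfl⟩, _, ⟨_, _, _, hb, rfl⟩, ⟨rfl, rfl⟩,
        (cmpD_iff hcode ht (hX _ _ _ ha) (hX _ _ _ hb)).2 h3⟩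
  | propConst x A op c =>
    simp only [Predicate.vars, Set.mem_singleton_iff, forall_eq] at hm
    simp only [Predicate.constants, List.mem_singleton, forall_eq] at hp
    simp only [predD, Predicate.Sat, hm, mem_entries_prop]
    constructor
    · rintro ⟨_, ⟨o, k, a, ha, rfl⟩, ⟨h1, h2⟩, h3⟩
      simp only [Data.hd, Data.tl, encWord_inj] at h1 h2 h3
      subst h1 h2
      exact ⟨a, (h _).1 ha, (cmpD_iff hcode ht (hX _ _ _ ha) hp).1 h3⟩
    · rintro ⟨a, ha, h3⟩
      have ha := (h (prop _ _ _)).2 ha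
      exact ⟨_, ⟨_, _, _, ha, rfl⟩, ⟨rfl, rfl⟩, (cmpD_iff hcode ht (hX _ _ _ ha) hp).2 h3⟩


/-! ### Constraints. -/

theorem PolyDec.forall_list {α : Type*} (l : List α) {P : α → Data → Prop}
    (h : ∀ a ∈ l, PolyDec M (P a)) : PolyDec M fun x => ∀ a ∈ l, P a x := by
  classical
  exact (PolyDec.forall_finset l.toFinset (by simpa using h)).congr (by simp)

/-- For fixed `K`, this is a nest of `K` bounded quantifiers. It lets all assignments of the node
variables be tried in polynomial time. -/
theorem PolyDec.forall_tuple (K : ℕ) {g : Data → Data} {P : Data → Data → Prop} (hg : PolyTime M g)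
    (hP : PolyDec M fun z => P z.hd z.tl) :
    PolyDec M fun x => ∀ m : List Data, m.length = K → (∀ a ∈ m, a ∈ (g x).toList) →
      P (.ofL m) x := by
  induction K generalizing g P with
  | zero =>
    refine (hP.comp (f := fun x => .cons .nil x) (by fun_prop)).congr fun x => ?_
    simp [Data.hd, Data.tl, Data.ofList]
  | succ K ih =>
    have h := PolyDec.forall_mem (P := fun a x => ∀ m : List Data, m.length = K →
      (∀ b ∈ m, b ∈ (g (Data.cons a x).tl).toList) → P (.cons (Data.cons a x).hd (.ofL m))
        (Data.cons a x).tl) hg ?_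
    · refine h.congr fun x => ⟨fun h a ha m hm hma => ?_, fun h m hm hma => ?_⟩
      · exact h (a :: m) (by simpa using hm) (by simpa using ⟨ha, hma⟩)
      · cases m with
        | nil => simp at hm
        | cons a m =>
          simp only [List.mem_cons, forall_eq_or_imp] at hma
          exact h a hma.1 m (by simpa using hm) hma.2
    · refine (ih (g := fun z => g z.tl) (P := fun m z => P (.cons z.hd m) z.tl) (by fun_prop)
        (hP.comp (f := fun z => .cons (.cons z.tl.hd z.hd) z.tl.tl) (by fun_prop))).congr
        fun z => ?_
      simp only [Data.hd, Data.tl]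

/-- Evaluation of a constraint with less than `K` node variables. -/
def satD (code : V → Word) (K : ℕ) (σ : Constraint V) (PS X tab : Data) : Prop :=
  ∀ m : List Data, m.length = K → (∀ a ∈ m, a ∈ (entries 0 X).toList) →
    (∀ zP ∈ σ.pattern, ∃ a ∈ (entries 0 X).toList, ∃ b ∈ (entries 0 X).toList,
      matchD PS X (.ofL m) zP.2 a b) →
    (∀ f ∈ σ.filter, predD code X (.ofL m) tab f) → ∀ f ∈ σ.condition, predD code X (.ofL m) tab f

theorem polyDec_satD (code : V → Word) (K : ℕ) (σ : Constraint V) {f g h : Data → Data}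
    (hf : PolyTime M f) (hg : PolyTime M g) (hh : PolyTime M h) :
    PolyDec M fun x => satD code K σ (f x) (g x) (h x) := by
  refine .forall_tuple K (P := fun m x => (∀ zP ∈ σ.pattern, ∃ a ∈ (entries 0 (g x)).toList,
      ∃ b ∈ (entries 0 (g x)).toList, matchD (f x) (g x) m zP.2 a b) →
    (∀ p ∈ σ.filter, predD code (g x) m (h x) p) → ∀ p ∈ σ.condition, predD code (g x) m (h x) p)
    (polyTime_entries 0 hg) (.imp (.forall_list _ fun zP _ => ?_) (.imp ?_ ?_))
  · refine .exists_mem (P := fun a z => ∃ b ∈ (entries 0 (g z.tl)).toList,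
      matchD (f z.tl) (g z.tl) z.hd zP.2 a b) (polyTime_entries 0 (by fun_prop)) ?_
    exact .exists_mem (P := fun b z => matchD (f z.tl.tl) (g z.tl.tl) z.tl.hd zP.2 z.hd b)
      (polyTime_entries 0 (by fun_prop))
      (polyDec_matchD _ (by fun_prop) (by fun_prop) (by fun_prop) (by fun_prop) (by fun_prop))
  · exact .forall_finset _ fun p _ =>
      polyDec_predD code p (by fun_prop) (by fun_prop) (by fun_prop)
  · exact .forall_finset _ fun p _ =>
      polyDec_predD code p (by fun_prop) (by fun_prop) (by fun_prop)

/-- A condition that could fail mentions a node variable, hence requires a node in the graph. -/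
theorem Predicate.vars_nonempty (p : Predicate V) : p.vars.Nonempty := by
  cases p <;> simp [Predicate.vars]

theorem satD_iff [PartialOrder V] {code : V → Word} (hcode : Function.Injective code) {W : Set V}
    {tab : Data} (ht : IsTable code W tab) {X : List (Item V)} {H : PropertyGraph V}
    (h : ∀ i, i ∈ X ↔ i.Mem H) (hX : ∀ o k v, prop o k v ∈ X → v ∈ W) {PS : Data}
    (hPS : ∀ S : Set (Item V), ∃ Y : List (Item V), encItems code Y ∈ PS.toList ∧
      ∀ i, i ∈ Y ↔ i ∈ X ∧ i ∈ S)
    {σ : Constraint V} (hσ : σ.WellFormed) {K : ℕ} (hK : ∀ x ∈ σ.pattern.vars, x < K)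
    (hW : ∀ p, p ∈ σ.filter ∨ p ∈ σ.condition → ∀ c ∈ p.constants, c ∈ W) :
    satD code K σ PS (encItems code X) tab ↔ σ.Sat H := by
  obtain ⟨⟨hq, hwf⟩, hF, hC⟩ := hσ
  have key : ∀ (μ : ℕ → Ident) (m : List Data),
      (∀ x ∈ σ.pattern.vars, (Data.ofL m).nth x = encWord (μ x)) →
      (((∀ zP ∈ σ.pattern, ∃ a ∈ (entries 0 (encItems code X)).toList,
        ∃ b ∈ (entries 0 (encItems code X)).toList,
        matchD PS (encItems code X) (.ofL m) zP.2 a b) ↔ ∃ ν, σ.pattern.IsMatch H μ ν) ∧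
      ((∀ f ∈ σ.filter, predD code (encItems code X) (.ofL m) tab f) ↔ ∀ f ∈ σ.filter, f.Sat H μ) ∧
      ((∀ f ∈ σ.condition, predD code (encItems code X) (.ofL m) tab f) ↔
        ∀ f ∈ σ.condition, f.Sat H μ)) := by
    intro μ m hm
    refine ⟨?_, ?_, ?_⟩
    · rw [GraphPattern.exists_isMatch_iff hq]
      refine forall₂_congr fun zP hz => ?_
      have hz' : ∀ x ∈ zP.2.vars, (Data.ofL m).nth x = encWord (μ x) :=
        fun x hx => hm x ⟨zP, hz, hx⟩
      simp only [mem_entries_node]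
      constructor
      · rintro ⟨_, ⟨u, -, rfl⟩, _, ⟨v, -, rfl⟩, huv⟩
        exact ⟨u, v, (matchD_iff h hPS hz').1 huv⟩
      · rintro ⟨u, v, huv⟩
        exact ⟨_, ⟨u, (h (node u)).2 huv.mem.1, rfl⟩, _, ⟨v, (h (node v)).2 huv.mem.2, rfl⟩,
          (matchD_iff h hPS hz').2 huv⟩
    · exact forall₂_congr fun f hf => predD_iff hcode ht h hX (hW f (.inl hf))
        fun x hx => hm x (hF f hf hx)
    · exact forall₂_congr fun f hf => predD_iff hcode ht h hX (hW f (.inr hf))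
        fun x hx => hm x (hC f hf hx)
  constructor
  · intro hs μ ν hν hfil f hf
    have hmem : ∀ x ∈ σ.pattern.vars, μ x ∈ H.nodes := by
      rintro x ⟨zP, hz, hx⟩
      exact (hν zP hz).2.mem_nodes (hwf zP hz) hx
    obtain ⟨x₀, hx₀⟩ := f.vars_nonempty
    have hx₀ := hmem x₀ (hC f hf hx₀)
    classical
    -- Positions that belong to no variable of the pattern must hold nodes as well. The node `μ x₀`
    -- serves, where `x₀` is a variable of the condition `f`.
    let m : List Data := (List.range K).map fun x =>
      encWord (if x ∈ σ.pattern.vars then μ x else μ x₀)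
    have hm : ∀ x ∈ σ.pattern.vars, (Data.ofL m).nth x = encWord (μ x) := by
      intro x hx
      rw [Data.nth_ofL (by simpa [m] using hK x hx)]
      simp [m, hx]
    obtain ⟨h1, h2, h3⟩ := key μ m hm
    refine h3.1 (hs m (by simp [m]) ?_ (h1.2 ⟨ν, hν⟩) (h2.2 hfil)) f hf
    intro a ha
    obtain ⟨x, -, rfl⟩ := List.mem_map.1 ha
    rw [encWord_mem_entries, h]
    by_cases hx : x ∈ σ.pattern.vars
    · simpa [hx, Mem] using hmem x hx
    · simpa [hx, Mem] using hx₀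
  · intro hs m hmK hma
    have : ∀ x, ∃ o, x < K → (Data.ofL m).nth x = encWord o := by
      intro x
      by_cases hx : x < K
      · obtain ⟨o, -, ho⟩ := mem_entries_node.1 (hma _ (List.getElem_mem (hmK.symm ▸ hx)))
        exact ⟨o, fun _ => (Data.nth_ofL (hmK.symm ▸ hx)).trans ho⟩
      · exact ⟨[], fun h => absurd h hx⟩
    choose μ hμ using this
    obtain ⟨h1, h2, h3⟩ := key μ m fun x hx => hμ x (hK x hx)
    rw [h1, h2, h3]
    rintro ⟨ν, hν⟩ hfil
    exact hs μ ν hν hfil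

/-! ### Recognizing admissible and maximal subgraphs. -/

/-- The node or edge `o` belongs to a list of items. -/
def presentD (X o : Data) : Prop :=
  o ∈ (entries 0 X).toList ∨ ∃ a ∈ (entries 1 X).toList, a.hd = o

theorem polyDec_presentD {f g : Data → Data} (hf : PolyTime M f) (hg : PolyTime M g) :
    PolyDec M fun x => presentD (f x) (g x) :=
  .or (.mem hg (polyTime_entries 0 hf)) (.exists_mem (P := fun a x => a.hd = g x)
    (polyTime_entries 1 hf) (.eq (by fun_prop) (by fun_prop)))

theorem presentD_iff {code : V → Word} {X : List (Item V)} {o : Ident} :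
    presentD (encItems code X) (encWord o) ↔ Present {i | i ∈ X} o := by
  rw [presentD, encWord_mem_entries, Present]
  refine or_congr Iff.rfl ?_
  simp only [mem_entries_edge]
  constructor
  · rintro ⟨_, ⟨e, u, v, he, rfl⟩, h⟩
    obtain rfl : e = o := encWord_injective h
    exact ⟨u, v, he⟩
  · rintro ⟨u, v, h⟩
    exact ⟨_, ⟨o, u, v, h, rfl⟩, rfl⟩

/-- The list contains the items of a property graph. -/
def closedD (X : Data) : Prop :=
  (∀ a ∈ (entries 1 X).toList,
    a.tl.hd ∈ (entries 0 X).toList ∧ a.tl.tl ∈ (entries 0 X).toList) ∧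
  (∀ a ∈ (entries 2 X).toList, presentD X a.hd) ∧ ∀ a ∈ (entries 3 X).toList, presentD X a.hd

theorem polyDec_closedD {f : Data → Data} (hf : PolyTime M f) :
    PolyDec M fun x => closedD (f x) := by
  refine .and (.forall_mem (P := fun a x =>
    a.tl.hd ∈ (entries 0 (f x)).toList ∧ a.tl.tl ∈ (entries 0 (f x)).toList)
    (polyTime_entries 1 hf) ?_) (.and ?_ ?_)
  · exact .and (.mem (by fun_prop) (polyTime_entries 0 (by fun_prop)))
      (.mem (by fun_prop) (polyTime_entries 0 (by fun_prop)))
  · exact .forall_mem (P := fun a x => presentD (f x) a.hd) (polyTime_entries 2 hf)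
      (polyDec_presentD (by fun_prop) (by fun_prop))
  · exact .forall_mem (P := fun a x => presentD (f x) a.hd) (polyTime_entries 3 hf)
      (polyDec_presentD (by fun_prop) (by fun_prop))

theorem closedD_iff {code : V → Word} {X : List (Item V)} :
    closedD (encItems code X) ↔ Closed {i | i ∈ X} := by
  refine and_congr ?_ (and_congr ?_ ?_)
  · simp only [mem_entries_edge, Set.mem_ofPred_eq]
    constructor
    · intro h e u v he
      have := h _ ⟨e, u, v, he, rfl⟩
      exact ⟨encWord_mem_entries.1 this.1, encWord_mem_entries.1 this.2⟩
    · rintro h _ ⟨e, u, v, he, rfl⟩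
      exact ⟨encWord_mem_entries.2 (h e u v he).1, encWord_mem_entries.2 (h e u v he).2⟩
  · simp only [mem_entries_label]
    constructor
    · exact fun h o l hl => presentD_iff.1 (h _ ⟨o, l, hl, rfl⟩)
    · rintro h _ ⟨o, l, hl, rfl⟩
      exact presentD_iff.2 (h o l hl)
  · simp only [mem_entries_prop]
    constructor
    · exact fun h o k v hl => presentD_iff.1 (h _ ⟨o, k, v, hl, rfl⟩)
    · rintro h _ ⟨o, k, v, hl, rfl⟩
      exact presentD_iff.2 (h o k v hl)

/-- The list `X` contains the properties in `Y` of all nodes and edges in `X`. -/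
def keepsD (Y X : Data) : Prop :=
  ∀ a ∈ (entries 3 Y).toList, presentD X a.hd → a ∈ (entries 3 X).toList

theorem polyDec_keepsD {f g : Data → Data} (hf : PolyTime M f) (hg : PolyTime M g) :
    PolyDec M fun x => keepsD (f x) (g x) :=
  .forall_mem (P := fun a x => presentD (g x) a.hd → a ∈ (entries 3 (g x)).toList)
    (polyTime_entries 3 hf) (.imp (polyDec_presentD (by fun_prop) (by fun_prop))
      (.mem (by fun_prop) (polyTime_entries 3 (by fun_prop))))

theorem keepsD_iff {code : V → Word} (hcode : Function.Injective code) {X Y : List (Item V)} :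
    keepsD (encItems code Y) (encItems code X) ↔
      ∀ o k v, prop o k v ∈ Y → Present {i | i ∈ X} o → prop o k v ∈ X := by
  simp only [keepsD, mem_entries_prop]
  constructor
  · intro h o k v hY ho
    obtain ⟨o', k', v', h1, h2⟩ := h _ ⟨o, k, v, hY, rfl⟩ (presentD_iff.2 ho)
    simp only [Data.cons.injEq, encWord_inj, hcode.eq_iff] at h2
    obtain ⟨rfl, rfl, rfl⟩ := h2
    exact h1
  · rintro h _ ⟨o, k, v, hY, rfl⟩ ho
    exact ⟨o, k, v, h o k v hY (presentD_iff.1 ho), rfl⟩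

/-- The two kinds of subgraphs. -/
def SubgraphOfKind (obj : Bool) (H G : PropertyGraph V) : Prop :=
  if obj then H.IsObjectSubgraph G else H.IsSubgraph G

theorem subgraphOfKind_iff {obj : Bool} {H G : PropertyGraph V} : SubgraphOfKind obj H G ↔
    H.IsSubgraph G ∧ (obj = true → ∀ o k v, (prop o k v : Item V).Mem G →
      o ∈ H.nodes ∨ o ∈ H.edges → (prop o k v : Item V).Mem H) := by
  cases obj
  · simp [SubgraphOfKind]
  · simp only [SubgraphOfKind, if_true, isObjectSubgraph_iff, true_imp_iff]
    exact and_congr_right fun _ => ⟨fun h o k v h1 h2 => h o k v h2 h1,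
      fun h o k v h1 h2 => h o k v h2 h1⟩

/-- The list contains the items of a subgraph that satisfies the constraints. -/
def goodD (code : V → Word) (obj : Bool) (K : Constraint V → ℕ) (S : Finset (Constraint V))
    (PS X tab : Data) : Prop :=
  closedD X ∧ (obj = true → ∀ Y ∈ PS.toList, keepsD Y X) ∧ ∀ σ ∈ S, satD code (K σ) σ PS X tab

theorem polyDec_goodD (code : V → Word) (obj : Bool) (K : Constraint V → ℕ)
    (S : Finset (Constraint V)) {f g h : Data → Data}
    (hf : PolyTime M f) (hg : PolyTime M g) (hh : PolyTime M h) :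
    PolyDec M fun x => goodD code obj K S (f x) (g x) (h x) :=
  .and (polyDec_closedD hg) (.and (.imp (.const _) (.forall_mem (P := fun Y x => keepsD Y (g x)) hf
    (polyDec_keepsD (by fun_prop) (by fun_prop))))
    (.forall_finset S fun σ _ => polyDec_satD code (K σ) σ hf hg hh))

/-- The list contains the items of a maximal subgraph that satisfies the constraints. -/
def bestD (code : V → Word) (obj : Bool) (K : Constraint V → ℕ) (S : Finset (Constraint V))
    (PS X tab : Data) : Prop :=
  goodD code obj K S PS X tab ∧ ∀ Y ∈ PS.toList, goodD code obj K S PS Y tab →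
    (∀ a ∈ X.toList, a ∈ Y.toList) → ∀ a ∈ Y.toList, a ∈ X.toList

theorem polyDec_bestD (code : V → Word) (obj : Bool) (K : Constraint V → ℕ)
    (S : Finset (Constraint V)) {f g h : Data → Data}
    (hf : PolyTime M f) (hg : PolyTime M g) (hh : PolyTime M h) :
    PolyDec M fun x => bestD code obj K S (f x) (g x) (h x) := by
  refine .and (polyDec_goodD code obj K S hf hg hh) (.forall_mem (P := fun Y x =>
    goodD code obj K S (f x) Y (h x) → (∀ a ∈ (g x).toList, a ∈ Y.toList) →
      ∀ a ∈ Y.toList, a ∈ (g x).toList) hf (.imp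
    (polyDec_goodD code obj K S (by fun_prop) (by fun_prop) (by fun_prop)) (.imp ?_ ?_)))
  · exact .forall_mem (P := fun a z => a ∈ z.hd.toList) (by fun_prop)
      (.mem (by fun_prop) (by fun_prop))
  · exact .forall_mem (P := fun a z => a ∈ (g z.tl).toList) (by fun_prop)
      (.mem (by fun_prop) (by fun_prop))

/-- `PS` contains exactly the encodings of the sublists of `I`. -/
def IsPowList (code : V → Word) (I : List (Item V)) (PS : Data) : Prop :=
  ∀ Y, Y ∈ PS.toList ↔ ∃ X : List (Item V), X.Sublist I ∧ Y = encItems code X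

/-! ### Correctness of the selection and existence of repairs. -/

section correctness

variable [PartialOrder V] {code : V → Word} {S : Finset (Constraint V)}
  {K : Constraint V → ℕ} {W : Set V} {tab PS : Data} {I : List (Item V)} {G : PropertyGraph V}
  {obj : Bool}

theorem goodD_iff (hcode : Function.Injective code) (hS : ∀ σ ∈ S, σ.WellFormed)
    (hK : ∀ σ ∈ S, ∀ x ∈ σ.pattern.vars, x < K σ)
    (hW : ∀ σ ∈ S, ∀ p, p ∈ σ.filter ∨ p ∈ σ.condition → ∀ c ∈ p.constants, c ∈ W)
    (ht : IsTable code W tab) (hI : ∀ i, i ∈ I ↔ i.Mem G)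
    (hIW : ∀ o k v, prop o k v ∈ I → v ∈ W) (hPS : IsPowList code I PS) {X : List (Item V)}
    (hX : X.Sublist I) :
    goodD code obj K S PS (encItems code X) tab ↔ ∃ H : PropertyGraph V, (∀ i, i ∈ X ↔ i.Mem H) ∧
      SubgraphOfKind obj H G ∧ ∀ σ ∈ S, σ.Sat H := by
  have hsat : ∀ H : PropertyGraph V, (∀ i, i ∈ X ↔ i.Mem H) →
      ∀ σ ∈ S, (satD code (K σ) σ PS (encItems code X) tab ↔ σ.Sat H) := by
    intro H h σ hσ
    classical
    refine satD_iff hcode ht h (fun o k v hv => hIW o k v (hX.subset hv)) (fun T => ?_) (hS σ hσ)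
      (hK σ hσ) (hW σ hσ)
    refine ⟨X.filter (· ∈ T), (hPS _).2 ⟨_, List.filter_sublist.trans hX, rfl⟩, fun i => ?_⟩
    simp
  -- `PS` contains `I` itself, and all its other members are sublists of `I`. Quantifying over `PS`
  -- thus compares with the properties of `G` although `I` is not an argument.
  have hkeep : (∀ Y ∈ PS.toList, keepsD Y (encItems code X)) ↔
      ∀ o k v, prop o k v ∈ I → Present {i | i ∈ X} o → prop o k v ∈ X := by
    constructor
    · exact fun h => (keepsD_iff hcode).1 (h _ ((hPS _).2 ⟨I, List.Sublist.refl _, rfl⟩))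
    · intro h Y hY
      obtain ⟨Y, hYI, rfl⟩ := (hPS _).1 hY
      exact (keepsD_iff hcode).2 fun o k v hv => h o k v (hYI.subset hv)
  rw [goodD, closedD_iff, hkeep]
  constructor
  · rintro ⟨h1, h2, h3⟩
    obtain ⟨H, hH⟩ := exists_graph h1 fun i hi => (hI i).1 (hX.subset hi)
    have hXH : ∀ i, i ∈ X ↔ i.Mem H := fun i => (hH i).symm
    have hset : {i | i ∈ X} = {i | i.Mem H} := Set.ext hXH
    refine ⟨H, hXH, subgraphOfKind_iff.2 ⟨?_, fun ho o k v hv hp => ?_⟩, fun σ hσ =>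
      (hsat H hXH σ hσ).1 (h3 σ hσ)⟩
    · exact isSubgraph_iff.2 fun i hi => (hI i).1 (hX.subset ((hXH i).2 hi))
    · rw [← present_mem, ← hset] at hp
      exact (hXH _).1 (h2 ho o k v ((hI _).2 hv) hp)
  · rintro ⟨H, hXH, h1, h2⟩
    have hset : {i | i ∈ X} = {i | i.Mem H} := Set.ext hXH
    refine ⟨hset ▸ closed_mem, fun ho o k v hv hp => ?_, fun σ hσ => (hsat H hXH σ hσ).2 (h2 σ hσ)⟩
    rw [hset, present_mem] at hp
    exact (hXH _).2 ((subgraphOfKind_iff.1 h1).2 ho o k v ((hI _).1 hv) hp)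

/-- The empty list is a candidate, and a candidate of greatest length is maximal under inclusion
because no item is repeated. -/
theorem exists_bestD (hcode : Function.Injective code) (hS : ∀ σ ∈ S, σ.WellFormed)
    (hK : ∀ σ ∈ S, ∀ x ∈ σ.pattern.vars, x < K σ)
    (hW : ∀ σ ∈ S, ∀ p, p ∈ σ.filter ∨ p ∈ σ.condition → ∀ c ∈ p.constants, c ∈ W)
    (ht : IsTable code W tab) (hI : ∀ i, i ∈ I ↔ i.Mem G) (hI' : I.Nodup)
    (hIW : ∀ o k v, prop o k v ∈ I → v ∈ W) (hPS : IsPowList code I PS) :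
    ∃ Y ∈ PS.toList, bestD code obj K S PS Y tab := by
  classical
  have hempty : goodD code obj K S PS (encItems code []) tab := by
    obtain ⟨H, hH⟩ := exists_graph (S := (∅ : Set (Item V))) (G := G) ⟨by simp, by simp, by simp⟩
      (by simp)
    have hn : ∀ u, u ∉ H.nodes := fun u hu => (hH (node u)).1 hu
    refine (goodD_iff hcode hS hK hW ht hI hIW hPS (List.nil_sublist _)).2
      ⟨H, fun i => by simpa using hH i, ?_, ?_⟩
    · refine subgraphOfKind_iff.2 ⟨isSubgraph_iff.2 fun i hi => ((hH i).1 hi).elim, ?_⟩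
      rintro - o k v - ho
      rw [← present_mem] at ho
      rcases ho with ho | ⟨u, v, ho⟩
      · exact ((hH (node o)).1 ho).elim
      · exact ((hH (edge o u v)).1 ho).elim
    -- A condition `f` has a variable, this variable lies in some path pattern, and the path matched
    -- to it would start at a node.
    · intro σ hσ μ ν hν _ f hf
      obtain ⟨x, hx⟩ := f.vars_nonempty
      obtain ⟨zP, hz, -⟩ := (hS σ hσ).2.2 f hf hx
      exact (hn _ (hν zP hz).1.1).elim
  obtain ⟨X, hX, hmax⟩ := Finset.exists_max_image
    (I.sublists.toFinset.filter fun X => goodD code obj K S PS (encItems code X) tab) List.length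
    ⟨[], by simpa using hempty⟩
  simp only [Finset.mem_filter, List.mem_toFinset, List.mem_sublists, and_imp] at hX hmax
  refine ⟨_, (hPS _).2 ⟨X, hX.1, rfl⟩, hX.2, fun Y hY hg hXY => ?_⟩
  obtain ⟨Y, hYI, rfl⟩ := (hPS _).1 hY
  simp only [Data.toList_ofList] at hXY ⊢
  -- Without repetitions, inclusion of entries is inclusion of multisets; as `Y` is not longer than
  -- `X`, both have the same entries.
  have hsub : (X.map (Item.enc code)).Subperm (Y.map (Item.enc code)) :=
    ((hI'.sublist hX.1).map (enc_injective hcode)).subperm hXY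
  have := hsub.perm_of_length_le (by simpa using hmax Y hYI hg)
  exact fun a ha => this.symm.subset ha

theorem isRepair_of_bestD (hcode : Function.Injective code) (hS : ∀ σ ∈ S, σ.WellFormed)
    (hK : ∀ σ ∈ S, ∀ x ∈ σ.pattern.vars, x < K σ)
    (hW : ∀ σ ∈ S, ∀ p, p ∈ σ.filter ∨ p ∈ σ.condition → ∀ c ∈ p.constants, c ∈ W)
    (ht : IsTable code W tab) (hI : ∀ i, i ∈ I ↔ i.Mem G)
    (hIW : ∀ o k v, prop o k v ∈ I → v ∈ W) (hPS : IsPowList code I PS) {X : List (Item V)}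
    (hX : X.Sublist I) (hbest : bestD code obj K S PS (encItems code X) tab) :
    ∃ H, (∀ i, i ∈ X ↔ i.Mem H) ∧ IsRepair (SubgraphOfKind obj) S G H := by
  classical
  obtain ⟨H, hXH, hHG, hsat⟩ := (goodD_iff hcode hS hK hW ht hI hIW hPS hX).1 hbest.1
  refine ⟨H, hXH, hHG, hsat, ?_⟩
  rintro ⟨H', hH'G, hHH', hne, hsat'⟩
  have hsub := isSubgraph_iff.1 (subgraphOfKind_iff.1 hHH').1
  have hsub' := isSubgraph_iff.1 (subgraphOfKind_iff.1 hH'G).1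
  -- A larger subgraph that satisfies the constraints reappears as a list in `PS`, so `bestD` has
  -- already compared with it.
  let Y := I.filter fun i => i.Mem H'
  have hYI : Y.Sublist I := List.filter_sublist
  have hY : ∀ i, i ∈ Y ↔ i.Mem H' := fun i => by
    simp only [Y, List.mem_filter, hI, decide_eq_true_eq, and_iff_right_iff_imp]
    exact hsub' i
  have h := hbest.2 _ ((hPS _).2 ⟨Y, hYI, rfl⟩)
    ((goodD_iff hcode hS hK hW ht hI hIW hPS hYI).2 ⟨H', hY, hH'G, hsat'⟩)
  simp only [Data.toList_ofList, List.mem_map_of_injective (enc_injective hcode),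
    List.forall_mem_map] at h
  refine hne (graph_ext fun i => ⟨hsub i, fun hi => (hXH i).1 (h ?_ i ((hY i).2 hi))⟩)
  exact fun i hi => (hY i).2 (hsub i ((hXH i).1 hi))

end correctness


/-! ## Reading and writing encoded property graphs -/

open Classical in
/-- The annotation of `o` in a list of items. -/
noncomputable def annotationD (X o : Data) : Data :=
  .cons (.ofL (((entries 2 X).toList.filter fun a => a.hd = o).map Data.tl))
    (.ofL (((entries 3 X).toList.filter fun a => a.hd = o).map Data.tl))

theorem polyTime_annotationD {f g : Data → Data} (hf : PolyTime M f) (hg : PolyTime M g) :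
    PolyTime M fun x => annotationD (f x) (g x) := by
  classical
  have h : ∀ i, PolyTime M fun x =>
      Data.ofL (((entries i (f x)).toList.filter fun a => a.hd = g x).map Data.tl) := by
    intro i
    have h := PolyTime.map (G := fun y _ => y.tl) (PolyTime.filter (P := fun y x => y.hd = g x)
      (polyTime_entries i hf) (.eq (by fun_prop) (by fun_prop))) (by fun_prop)
    convert h using 2 with x
    simp
  convert (h 2).cons (h 3) using 2
  simp [annotationD]

theorem annotationD_eq {code : V → Word} {X : List (Item V)} {o : Ident} :
    annotationD (encItems code X) (encWord o) = (annotationOf X o).enc code := by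
  classical
  rw [annotationD, Annotation.enc, Data.ofList_eq encWord,
    Data.ofList_eq (fun kv : Key × V => _), entries_label, entries_prop]
  simp only [Data.toList_ofList, annotationOf, List.filter_map, List.map_map]
  congr 2
  · congr 1
    refine congrArg₂ _ (funext fun r => ?_) rfl
    simp [Data.hd]
  · congr 1
    refine congrArg₂ _ (funext fun r => ?_) rfl
    simp [Data.hd]

/-- The encoding of the listing of a list of items. -/
noncomputable def listingD (X : Data) : Data :=
  .cons (.ofL ((entries 0 X).toList.map fun o => .cons o (annotationD X o)))
    (.ofL ((entries 1 X).toList.map fun r => .cons r.hd (.cons r.tl (annotationD X r.hd))))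

theorem polyTime_listingD {f : Data → Data} (hf : PolyTime M f) :
    PolyTime M fun x => listingD (f x) :=
  .cons (.map (G := fun o x => .cons o (annotationD (f x) o)) (polyTime_entries 0 hf)
      (.cons (by fun_prop) (polyTime_annotationD (by fun_prop) (by fun_prop))))
    (.map (G := fun r x => .cons r.hd (.cons r.tl (annotationD (f x) r.hd)))
      (polyTime_entries 1 hf)
      (.cons (by fun_prop) (.cons (by fun_prop)
        (polyTime_annotationD (by fun_prop) (by fun_prop)))))

theorem listingD_eq {code : V → Word} {X : List (Item V)} :
    listingD (encItems code X) = (listingOf X).enc code := by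
  rw [listingD, Listing.enc, Data.ofList_eq (fun r : Ident × Annotation V => _),
    Data.ofList_eq (fun r : Ident × (Ident × Ident) × Annotation V => _), entries_node,
    entries_edge]
  simp only [Data.toList_ofList, listingOf, List.map_map, Function.comp_def, annotationD_eq,
    Data.hd, Data.tl]

/-- The nodes and edges of an encoded listing, with their annotations. -/
def recordsD (t : Data) : Data :=
  .ofL (t.hd.toList ++ (Data.ofL (t.tl.toList.map fun r => .cons r.hd r.tl.tl)).toList)

/-- The items of an encoded listing. -/
def itemsD (t : Data) : Data :=
  .ofL ((Data.ofL (t.hd.toList.map fun r => .cons (tag 0) r.hd)).toList ++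
    (Data.ofL ((Data.ofL (t.tl.toList.map fun r =>
        .cons (tag 1) (.cons r.hd (.cons r.tl.hd.hd r.tl.hd.tl)))).toList ++
      (Data.ofL ((recordsD t).toList.flatMap fun r => (Data.ofL (
        (Data.ofL (r.tl.hd.toList.map fun l => .cons (tag 2) (.cons r.hd l))).toList ++
        (Data.ofL (r.tl.tl.toList.map fun p => .cons (tag 3) (.cons r.hd p))).toList)).toList
      )).toList)).toList)

theorem polyTime_itemsD : PolyTime M itemsD := by
  have hrec : PolyTime M recordsD :=
    .append (by fun_prop) (.map (G := fun r _ => .cons r.hd r.tl.tl) (by fun_prop) (by fun_prop))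
  refine .append (.map (G := fun r _ => .cons (tag 0) r.hd) (by fun_prop) (by fun_prop))
    (.append (.map (G := fun r _ => .cons (tag 1) (.cons r.hd (.cons r.tl.hd.hd r.tl.hd.tl)))
      (by fun_prop) (by fun_prop))
      (.flatMap (G := fun r _ => Data.ofL (
        (Data.ofL (r.tl.hd.toList.map fun l => .cons (tag 2) (.cons r.hd l))).toList ++
        (Data.ofL (r.tl.tl.toList.map fun p => .cons (tag 3) (.cons r.hd p))).toList)) hrec
      (.append ?_ ?_)))
  · exact .map (f := fun z => z.hd.tl.hd) (G := fun l z => .cons (tag 2) (.cons z.hd.hd l))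
      (by fun_prop) (by fun_prop)
  · exact .map (f := fun z => z.hd.tl.tl) (G := fun l z => .cons (tag 3) (.cons z.hd.hd l))
      (by fun_prop) (by fun_prop)

theorem itemsD_enc {code : V → Word} (D : Listing V) :
    itemsD (D.enc code) = encItems code D.items := by
  rw [encItems, Data.ofList_eq]
  simp [itemsD, recordsD, Listing.enc, Annotation.enc, Listing.items, Data.hd, Data.tl,
    Function.comp_def, List.map_flatMap, List.flatMap_append, List.flatMap_map, Item.enc]

/-! ### The comparison table. -/

/-- The values in a list of items and some further values. -/
def valuesOf (L : List V) (X : List (Item V)) : List V :=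
  (X.filterMap asProp).map (fun r => r.2.2) ++ L

/-- All pairs of entries of a list. -/
def pairsOf (L : List V) : List (V × V) := L.flatMap fun a => L.map fun b => (a, b)

/-- The encoding of all pairs of values in a list of items. -/
noncomputable def pairsD (C X : Data) : Data :=
  let vals := Data.ofL ((Data.ofL ((entries 3 X).toList.map fun a => a.tl.tl)).toList ++ C.toList)
  .ofL (vals.toList.flatMap fun a => (Data.ofL (vals.toList.map fun b => .cons a b)).toList)

theorem polyTime_pairsD (C : Data) {f : Data → Data} (hf : PolyTime M f) :
    PolyTime M fun x => pairsD C (f x) := by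
  have hv : PolyTime M fun x => Data.ofL
      ((Data.ofL ((entries 3 (f x)).toList.map fun a => a.tl.tl)).toList ++ C.toList) :=
    .append (.map (G := fun a _ => a.tl.tl) (polyTime_entries 3 hf) (by fun_prop)) (.const C)
  exact .flatMap (G := fun a x => Data.ofL ((Data.ofL
      ((Data.ofL ((entries 3 (f x)).toList.map fun a => a.tl.tl)).toList ++ C.toList)).toList.map
      fun b => .cons a b)) hv
    (.map (G := fun b z => .cons z.hd b) (hv.comp (g := fun z => z.tl) (by fun_prop))
      (by fun_prop))

theorem toList_pairsD {code : V → Word} (L : List V) (X : List (Item V)) :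
    (pairsD (Data.ofList (fun c => encWord (code c)) L) (encItems code X)).toList =
      (pairsOf (valuesOf L X)).map (encValues code) := by
  have h : (entries 3 (encItems code X)).toList.map (fun a => a.tl.tl) ++
      L.map (fun c => encWord (code c)) = (valuesOf L X).map fun c => encWord (code c) := by
    simp [entries_prop, valuesOf, Data.tl, Function.comp_def]
  simp only [pairsD, Data.toList_ofList, List.map_id, h, pairsOf]
  simp [List.map_flatMap, List.flatMap_map, Function.comp_def, encValues]

theorem isTable_of_toList [PartialOrder V] {code : V → Word} (hcode : Function.Injective code)
    {L : List V} {tab : Data} (h : tab.toList =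
      (pairsOf L).reverse.map (tableEntry (encValues code) fun ab : V × V => ab.1 ≤ ab.2)) :
    IsTable code {a | a ∈ L} tab := by
  classical
  intro a ha b hb
  simp only [h, List.mem_map, List.mem_reverse, tableEntry, Data.cons.injEq, encValues,
    encWord_inj, hcode.eq_iff, Data.ofBool_injective.eq_iff, decide_eq_true_eq]
  constructor
  · rintro ⟨p, -, ⟨rfl, rfl⟩, hp⟩
    exact hp
  · intro hab
    exact ⟨(a, b), List.mem_flatMap.2 ⟨a, ha, List.mem_map.2 ⟨b, hb, rfl⟩⟩, ⟨rfl, rfl⟩, hab⟩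

theorem isPowList_powList {code : V → Word} (I : List (Item V)) :
    IsPowList code I.reverse (powList (encItems code I)) := by
  intro Y
  rw [mem_powList, Data.toList_ofList, ← List.map_reverse, List.sublist_map_iff]
  refine exists_congr fun X => and_congr_right fun _ => ?_
  rw [encItems, Data.ofList_eq]
  constructor
  · intro h
    rw [← h, Data.ofL_toList]
  · rintro rfl
    simp

/-! ### The repair algorithm. -/

/-- Repairs can be computed in nondeterministic exponential time. -/
theorem solvableInNExpTime_isRepair [PartialOrder V] {code : V → Word}
    (hcode : Function.Injective code)
    (hle : SolvableInNExpTime (fun (ab : V × V) t => t = encValues code ab)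
      (fun (b : Bool) t => t = Data.ofBool b) (fun ab b => b = true ↔ ab.1 ≤ ab.2))
    (S : Finset (Constraint V)) (hS : ∀ σ ∈ S, σ.WellFormed) (obj : Bool) :
    SolvableInNExpTime (PropertyGraph.IsEncodedBy code) (PropertyGraph.IsEncodedBy code)
      (IsRepair (SubgraphOfKind obj) S) := by
  classical
  choose K hK using GraphPattern.exists_bound
  -- The constants of the fixed constraints are built into the program, so that the table also
  -- covers comparisons with them.
  let L : List V := S.toList.flatMap fun σ =>
    (σ.filter.toList ++ σ.condition.toList).flatMap Predicate.constants
  let C : Data := Data.ofList (fun c => encWord (code c)) L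
  -- The head of the filtered list is the first maximal candidate. Any candidate would do, and
  -- `exists_bestD` ensures that there is one.
  refine solvableInNExpTime_of_powList hle (pre := fun t => pairsD C (itemsD t)) (items := itemsD)
    (post := fun z => listingD (Data.ofL (z.hd.toList.filter fun X =>
      bestD code obj (fun σ => K σ.pattern) S z.hd X z.tl)).hd)
    (fun M => polyTime_pairsD C polyTime_itemsD) (fun M => polyTime_itemsD) (fun M => ?_) ?_
  · refine polyTime_listingD (.hd ?_)
    convert PolyTime.filter (M := M) (f := fun z => z.hd)
      (P := fun X z => bestD code obj (fun σ => K σ.pattern) S z.hd X z.tl) (by fun_prop)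
      (polyDec_bestD code obj _ S (by fun_prop) (by fun_prop) (by fun_prop))
  · rintro G _ ⟨D, hD, rfl⟩
    simp only [itemsD_enc]
    refine ⟨_, toList_pairsD L D.items, fun tab htab => ?_⟩
    have ht := isTable_of_toList hcode htab
    -- `powList` yields the sublists of the reversed list, so `D.items.reverse` plays the part of
    -- `I` from here on.
    have hPS := isPowList_powList (code := code) D.items
    have hI : ∀ i, i ∈ D.items.reverse ↔ i.Mem G := fun i =>
      List.mem_reverse.trans (hD.mem_items i)
    have hI' : D.items.reverse.Nodup := List.nodup_reverse.2 hD.nodup_items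
    have hIW : ∀ o k v, prop o k v ∈ D.items.reverse → v ∈ {a | a ∈ valuesOf L D.items} := by
      intro o k v hv
      refine List.mem_append_left _ (List.mem_map.2 ⟨(o, k, v), ?_, rfl⟩)
      exact List.mem_filterMap.2 ⟨_, List.mem_reverse.1 hv, by simp⟩
    have hW : ∀ σ ∈ S, ∀ p, p ∈ σ.filter ∨ p ∈ σ.condition → ∀ c ∈ p.constants,
        c ∈ {a | a ∈ valuesOf L D.items} := by
      intro σ hσ p hp c hc
      refine List.mem_append_right _ (List.mem_flatMap.2 ⟨σ, by simpa using hσ, ?_⟩)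
      exact List.mem_flatMap.2 ⟨p, by simpa using hp, hc⟩
    have hK' : ∀ σ ∈ S, ∀ x ∈ σ.pattern.vars, x < K σ.pattern := fun σ _ => hK σ.pattern
    obtain ⟨Y, hY, hbest⟩ := exists_bestD (obj := obj) (K := fun σ => K σ.pattern) hcode hS hK' hW
      ht hI hI' hIW hPS
    have hmem : Y ∈ (powList (encItems code D.items)).toList.filter fun X =>
        bestD code obj (fun σ => K σ.pattern) S (powList (encItems code D.items)) X tab :=
      List.mem_filter.2 ⟨hY, decide_eq_true hbest⟩
    obtain ⟨Z, l, hZ⟩ := List.exists_cons_of_ne_nil (List.ne_nil_of_mem hmem)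
    have hZmem := hZ ▸ List.mem_cons_self (a := Z) (l := l)
    have hhd : listingD Z = listingD (Data.ofL ((powList (encItems code D.items)).toList.filter
        fun X => bestD code obj (fun σ => K σ.pattern) S (powList (encItems code D.items)) X
          tab)).hd := by
      rw [hZ]
      rfl
    rw [List.mem_filter, decide_eq_true_eq] at hZmem
    obtain ⟨X, hX, rfl⟩ := (hPS _).1 hZmem.1
    obtain ⟨H, hXH, hH⟩ := isRepair_of_bestD hcode hS hK' hW ht hI hIW hPS hX hZmem.2
    refine ⟨H, ⟨listingOf X, lists_listingOf (hI'.sublist hX) hXH, ?_⟩, hH⟩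
    exact listingD_eq.symm.trans hhd

end PGRepair

theorem mainTheorem3 {V : Type*} [PartialOrder V]
    (code : V → PGRepair.Word) (hcode : Function.Injective code)
    (hle : PGRepair.SolvableInNExpTime (fun (ab : V × V) t => t = PGRepair.encValues code ab)
      (fun (b : Bool) t => t = PGRepair.Data.ofBool b) (fun ab b => b = true ↔ ab.1 ≤ ab.2))
    (S : Finset (PGRepair.Constraint V)) (hS : ∀ σ ∈ S, σ.WellFormed)
    (hpos : ∀ σ ∈ S, σ.Positive) :
    PGRepair.SolvableInNExpTime
        (PGRepair.PropertyGraph.IsEncodedBy code) (PGRepair.PropertyGraph.IsEncodedBy code)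
        (PGRepair.IsRepair PGRepair.PropertyGraph.IsObjectSubgraph S) ∧
      PGRepair.SolvableInNExpTime
        (PGRepair.PropertyGraph.IsEncodedBy code) (PGRepair.PropertyGraph.IsEncodedBy code)
        (PGRepair.IsRepair PGRepair.PropertyGraph.IsSubgraph S) :=
  -- `SubgraphOfKind` unfolds to object subgraphs for `true` and to arbitrary subgraphs for `false`.
  ⟨PGRepair.solvableInNExpTime_isRepair hcode hle S hS true,
    PGRepair.solvableInNExpTime_isRepair hcode hle S hS false⟩
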